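/- **Setting.** Let $d\ge 1$, let $\mathbb B^d$ be the open unit ball of $\mathbb C^d$, $\partial\mathbb B^d$ the unit sphere and $\sigma$ the rotation-invariant Borel probability measure on $\partial\mathbb B^d$. For $1\le p<\infty$, $H^p(\mathbb B^d)$ is the set of holomorphic $g:\mathbb B^d\to\mathbb C$ with $\|g\|_p=\sup_{0<r<1}\big(\int_{\partial\mathbb B^d}|g(r\zeta)|^p\,d\sigma(\zeta)\big)^{1/p}<\infty$; $H^\infty(\mathbb B^d)$ is the set of bounded holomorphic functions, with the supremum norm. A function $F$ on $\mathbb B^d$ has K-limit $l$ at $\zeta\in\partial\mathbb B^d$ if for every $a>1$, $F(z)\to l$ as $z\to\zeta$ within $\{z:|1-\langle z,\zeta\rangle|<\tfrac a2(1-|z|^2)\}$. A measure is discrete if it is carried by a countable set. Order $\mathbb N_0^d$ by the short lexicographical order (first by $|\alpha|=\alpha_1+\dots+\alpha_d$, then lexicographically with $e_1\prec e_2\prec\dots\prec e_d$), and let $\alpha^{(0)}=0\prec\alpha^{(1)}\prec\dots$ be its enumeration. For a probability measure $\mu$ on $\partial\mathbb B^d$ put $K(n,m)=\int\zeta^{\alpha^{(n)}}\overline{\zeta^{\alpha^{(m)}}}\,d\mu(\zeta)$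 and $\tilde K(n,m)=K(n,m)/\sqrt{K(n,n)K(m,m)}$. The Verblunsky coefficients $\gamma_{\alpha,\beta}$ of $\mu$ are $\gamma_{\alpha^{(n)},\alpha^{(m)}}=\gamma_{n,m}$, $n\le m$, where $(\gamma_{n,m})$ are the Schur–Constantinescu parameters of $\tilde K$: with $d_{n,m}=\sqrt{1-|\gamma_{n,m}|^2}$, they are determined by $\gamma_{n,n}=0$ and, for $n<m$, $$\tilde K(n,m)=R_{n,m-1}U_{n+1,m-1}C_{n+1,m}+d_{n,n+1}\cdots d_{n,m-1}\,\gamma_{n,m}\,d_{n+1,m}\cdots d_{m-1,m}$$ (with $\gamma_{n,m}=0$ if one of the factors $d$ vanishes, and with the first term absent if $m=n+1$). Here $R_{n,k}$ is the row with entries $d_{n,n+1}\cdots d_{n,i-1}\gamma_{n,i}$ for $i=n+1,\dots,k$; $C_{k,m}$ is the column with entries $\gamma_{i,m}d_{i+1,m}\cdots d_{m-1,m}$ for $i=m-1,m-2,\dots,k$; $U_{n,n}=1$ and $U_{n,m}=J_1(\gamma_{n,n+1})J_2(\gamma_{n,n+2})\cdots J_{m-n}(\gamma_{n,m})\,(U_{n+1,m}\oplus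 1)$, where $J_l(c)$ acts on the $l$-th and $(l+1)$-st coordinates by $\begin{pmatrix}c&\sqrt{1-|c|^2}\\ \sqrt{1-|c|^2}&-\overline c\end{pmatrix}$ and as the identity on the others. **Theorem.** Assume that either 1. $g\in H^\infty(\mathbb B^d)$, $\|g\|_\infty\le1$, and $w(z)=|g(z)|^2$ for $z\in\mathbb B^d$; or 2. $1\le p<\infty$, $g\in H^p(\mathbb B^d)$, $\|g\|_p\le1$, and $w(z)=|g(z)|^p$ for $z\in\mathbb B^d$. Assume moreover that $g$ has no zeros in $\mathbb B^d$ and $1/g\in H^\infty(\mathbb B^d)$. Then $w$ has a finite K-limit $w(\zeta)$ at $\sigma$-almost every $\zeta\in\partial\mathbb B^d$. If $\mu_s$ is a discrete measure on $\partial\mathbb B^d$ such that $d\mu=w\,d\sigma+d\mu_s$ is a probability measure, with Verblunsky coefficients $(\gamma_{\alpha,\beta})$, then $\log w\in L^1(\sigma)$ and $$\prod_{\alpha\in\mathbb N_0^d}\big(1-|\gamma_{0,\alpha}|^2\big)=\exp\Big(\int_{\partial\mathbb B^d}\log w(\zeta)\,d\sigma(\zeta)\Big),$$ where the product converges unconditionally.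 -/

import Mathlib

open MeasureTheory Filter Topology
open scoped ENNReal ComplexConjugate

noncomputable section

namespace SzegoBall

/-! ### The ball, the sphere and the rotation-invariant probability measure -/

/-- `ℂᵈ` with its Euclidean norm. -/
abbrev Cn (d : ℕ) : Type := EuclideanSpace ℂ (Fin d)

/-- The open unit ball of `ℂᵈ`. -/
abbrev unitBall (d : ℕ) : Set (Cn d) := Metric.ball 0 1

/-- The unit sphere of `ℂᵈ`, as a type. -/
abbrev USphere (d : ℕ) : Type := Metric.sphere (0 : Cn d) 1

/-- The rotation-invariant probability measure on the unit sphere: surface measure divided by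
its total mass. -/
def sigma (d : ℕ) : Measure (USphere d) :=
  ((volume : Measure (Cn d)).toSphere Set.univ)⁻¹ • (volume : Measure (Cn d)).toSphere

/-! ### Hardy spaces -/

/-- The `H^∞` norm, the supremum of `|g|` on the ball, with values in `[0, ∞]`. -/
def hInfNorm {d : ℕ} (g : Cn d → ℂ) : ℝ≥0∞ := ⨆ z ∈ unitBall d, ‖g z‖ₑ

/-- `g ∈ H^∞(𝔹ᵈ)`: bounded and holomorphic on the ball. -/
def MemHInf {d : ℕ} (g : Cn d → ℂ) : Prop :=
  DifferentiableOn ℂ g (unitBall d) ∧ hInfNorm g < ∞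

/-- The `H^p` norm, `sup_{0 < r < 1} (∫ |g(rζ)|^p dσ(ζ))^{1/p}`, with values in `[0, ∞]`. -/
def hardyNorm {d : ℕ} (p : ℝ) (g : Cn d → ℂ) : ℝ≥0∞ :=
  ⨆ r ∈ Set.Ioo (0 : ℝ) 1, (∫⁻ ζ : USphere d, ‖g (r • (ζ : Cn d))‖ₑ ^ p ∂sigma d) ^ (1 / p)

/-- `g ∈ H^p(𝔹ᵈ)` for a finite exponent `p`. -/
def MemHardy {d : ℕ} (p : ℝ) (g : Cn d → ℂ) : Prop :=
  DifferentiableOn ℂ g (unitBall d) ∧ hardyNorm p g < ∞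

/-! ### K-limits -/

/-- The Korányi approach region `{z : |1 - ⟨z, ζ⟩| < (a/2) (1 - |z|²)}`; it lies in the open
unit ball. -/
def koranyiRegion {d : ℕ} (a : ℝ) (ζ : Cn d) : Set (Cn d) :=
  {z | ‖1 - inner ℂ ζ z‖ < a / 2 * (1 - ‖z‖ ^ 2)}

/-- The filter of approach to `ζ` inside Korányi regions of arbitrary aperture `a > 1`. -/
def koranyiFilter {d : ℕ} (ζ : Cn d) : Filter (Cn d) :=
  ⨆ a ∈ Set.Ioi (1 : ℝ), 𝓝[koranyiRegion a ζ] ζ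

/-- `F` has K-limit `l` at `ζ`: `F(z) → l` as `z → ζ` within every Korányi region at `ζ`. -/
def HasKLimit {d : ℕ} (F : Cn d → ℝ) (ζ : Cn d) (l : ℝ) : Prop :=
  Tendsto F (koranyiFilter ζ) (𝓝 l)

/-- The boundary function of `F`: at `ζ` it is the K-limit of `F`, wherever that exists. -/
def boundaryFun {d : ℕ} (F : Cn d → ℝ) (ζ : USphere d) : ℝ :=
  limUnder (koranyiFilter (ζ : Cn d)) F

/-! ### Measures -/

/-- A measure is discrete if it is carried by a countable set, that is, a countable sum of point
masses. -/
def IsDiscreteMeasure {X : Type*} [MeasurableSpace X] (ν : Measure X) : Prop :=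
  ∃ S : Set X, S.Countable ∧ ν Sᶜ = 0

/-- The measure `w dσ + dμ_s`. -/
def weighted {d : ℕ} (w : USphere d → ℝ) (μs : Measure (USphere d)) : Measure (USphere d) :=
  (sigma d).withDensity (fun ζ => ENNReal.ofReal (w ζ)) + μs

/-! ### Multi-indices in the short lexicographical order -/

/-- The length of a multi-index. -/
def multiLength {d : ℕ} (α : Fin d → ℕ) : ℕ := ∑ i, α i

/-- The strict shortlex order: first by length, then lexicographically with
`e₁ ≺ e₂ ≺ ⋯ ≺ e_d`. -/
def Precedes {d : ℕ} (α β : Fin d → ℕ) : Prop :=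
  multiLength α < multiLength β ∨
    (multiLength α = multiLength β ∧ ∃ i, (∀ j < i, α j = β j) ∧ β i < α i)

/-- The position of a multi-index in the shortlex order (counted from `0`). -/
def shortlexPosition {d : ℕ} (α : Fin d → ℕ) : ℕ := {β : Fin d → ℕ | Precedes β α}.ncard

/-- The multi-index with a given position. -/
def nthIndex (d : ℕ) : ℕ → (Fin d → ℕ) := Function.invFun shortlexPosition

/-- The moment kernel `K(α, β) = ∫ ζ^α conj(ζ^β) dμ(ζ)`. -/
def momentKernel {d : ℕ} (μ : Measure (USphere d)) (α β : Fin d → ℕ) : ℂ :=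
  ∫ ζ : USphere d, (∏ i, (ζ : Cn d) i ^ α i) * conj (∏ i, (ζ : Cn d) i ^ β i) ∂μ

/-! ### The Schur-Constantinescu parameters of a positive kernel on `ℕ`

For a normalised positive kernel `K` on `ℕ` there is a unique family `γ (k, j)`, `k ≤ j`, of
numbers in the closed unit disc with `γ (k, k) = 0` such that, for `k < j`,
`K (k, j) = R_{k, j-1} U_{k+1, j-1} C_{k+1, j}
  + d (k, k+1) ⋯ d (k, j-1) * γ (k, j) * d (k+1, j) ⋯ d (j-1, j)`
(where `γ (k, j) = 0` if one of the factors `d` vanishes). Here `d = sqrt (1 - |γ|²)`,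
* `R_{k, m}` is the row with entries `d (k, k+1) ⋯ d (k, i-1) γ (k, i)` for `i = k+1, …, m`,
* `C_{m, j}` is the column with entries `γ (i, j) d (i+1, j) ⋯ d (j-1, j)` for `i = j-1, …, m`,
* `U_{k, k} = 1` and
  `U_{k, j} = Rot₀(γ (k, k+1)) Rot₁(γ (k, k+2)) ⋯ Rot_{j-k-1}(γ (k, j)) (U_{k+1, j} ⊕ 1)`,
  where `Rot_l(c)` acts in the coordinates `l`, `l+1` by the matrix with rows
  `(c, sqrt (1 - |c|²))` and `(sqrt (1 - |c|²), -conj c)`.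
Finite vectors are written as sequences; `Rot_l` leaves the remaining coordinates alone. -/

/-- The defect `sqrt (1 - |c|²)`. -/
def defect (c : ℂ) : ℝ := Real.sqrt (1 - ‖c‖ ^ 2)

/-- The elementary rotation `Rot_l(c)`. -/
def rot (l : ℕ) (c : ℂ) (v : ℕ → ℂ) : ℕ → ℂ := fun i =>
  if i = l then c * v l + defect c * v (l + 1)
  else if i = l + 1 then defect c * v l - conj c * v (l + 1)
  else v i

/-- `Rot₀(γ (k, k+1)) Rot₁(γ (k, k+2)) ⋯ Rot_{n-1}(γ (k, k+n))`. -/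
def rotChain (γ : ℕ → ℕ → ℂ) (k : ℕ) : ℕ → (ℕ → ℂ) → (ℕ → ℂ)
  | 0, v => v
  | n + 1, v => rotChain γ k n (rot n (γ k (k + n + 1)) v)

/-- The generalised rotation `U_{k, k+n}`. -/
def genRot (γ : ℕ → ℕ → ℂ) : ℕ → ℕ → (ℕ → ℂ) → (ℕ → ℂ)
  | _, 0, v => v
  | k, n + 1, v => rotChain γ k (n + 1) (genRot γ (k + 1) n v)

/-- The entries of the rows `R_{k, m}`, counted from `0`. -/
def rowEntry (γ : ℕ → ℕ → ℂ) (k i : ℕ) : ℂ :=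
  (∏ l ∈ Finset.range i, (defect (γ k (k + 1 + l)) : ℂ)) * γ k (k + 1 + i)

/-- The entries of the columns `C_{m, j}`, counted from `0`. -/
def colEntry (γ : ℕ → ℕ → ℂ) (j i : ℕ) : ℂ :=
  γ (j - 1 - i) j * ∏ l ∈ Finset.range i, (defect (γ (j - 1 - l) j) : ℂ)

/-- The number `R_{k, j-1} U_{k+1, j-1} C_{k+1, j}` for `j = k + n + 1`; the row and the column
have `n` entries. -/
def centralValue (γ : ℕ → ℕ → ℂ) (k n : ℕ) : ℂ :=
  ∑ i ∈ Finset.range n, rowEntry γ k i *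
    genRot γ (k + 1) (n - 1)
      (fun m => if m < n then colEntry γ (k + n + 1) m else 0) i

/-- The product `d (k, k+1) ⋯ d (k, j-1) * d (k+1, j) ⋯ d (j-1, j)` for `j = k + n + 1`. -/
def defectProduct (γ : ℕ → ℕ → ℂ) (k n : ℕ) : ℂ :=
  (∏ l ∈ Finset.range n, (defect (γ k (k + 1 + l)) : ℂ)) *
    ∏ l ∈ Finset.range n, (defect (γ (k + 1 + l) (k + n + 1)) : ℂ)

/-- Stage `N` of the recursion: the parameters `γ (k, j)` with `j - k ≤ N`, and `0` elsewhere.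
They are obtained by solving the displayed equation for `γ (k, j)`. -/
def schurStage (K : ℕ → ℕ → ℂ) : ℕ → ℕ → ℕ → ℂ
  | 0 => fun _ _ => 0
  | n + 1 => fun k j =>
      if j = k + n + 1 then
        (K k j - centralValue (schurStage K n) k n) / defectProduct (schurStage K n) k n
      else schurStage K n k j

/-- The parameters of a normalised positive kernel on `ℕ`; the family is indexed by `k ≤ j` and
extended by `0`. -/
def schurParam (K : ℕ → ℕ → ℂ) (k j : ℕ) : ℂ := schurStage K (j - k) k j

/-- The normalisation `K(n, m) / (sqrt K(n, n) sqrt K(m, m))`. -/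
def normalise (K : ℕ → ℕ → ℂ) (n m : ℕ) : ℂ :=
  K n m / (Real.sqrt (K n n).re * Real.sqrt (K m m).re : ℝ)

/-- The Verblunsky coefficients `γ_{α, β}` of a measure on the sphere: the parameters of its
moment kernel, transported to `ℕ` by the shortlex order. -/
def verblunsky {d : ℕ} (μ : Measure (USphere d)) (α β : Fin d → ℕ) : ℂ :=
  schurParam (normalise fun n m => momentKernel μ (nthIndex d n) (nthIndex d m))
    (shortlexPosition α) (shortlexPosition β)

end SzegoBall

end

open SzegoBall

/-! Since `g` has no zeros, `Λ = (p/2) log (1/g)` is a holomorphic function on the ball with `|g|^p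
= |exp (-Λ)|²`. Boundedness of `1/g` bounds `Re Λ` from above, and the Hardy norm bounds the
spherical `L²` means of `exp (-Λ)` by `1`. The bounded case is contained in the case `p = 2`. Both
sides of the formula turn out to be `exp (-2 Re Λ(0))`.

The product is an extremal value. The normalised moment kernel is the Gram matrix of the normalised
monomials in `L²(μ)`, and its Schur parameters are the partial correlations of that sequence
(`schurParam_eq_corr`). Each factor `1 - |γ|²` is the loss of squared distance from the constant `1`
to the span of the later monomials when one more monomial is admitted
(`prod_one_sub_norm_schurParam_sq`). Hence the whole product is the infimum of `∫ |q|² dμ` over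
polynomials with `q(0) = 1` (`hasProd_verblunsky`).

That infimum is computed in `isGLB_lintegral_polyFun`. The mean value property of `q exp (-Λ)` and
the Cauchy–Schwarz inequality give the lower bound. The extremal function would be `exp (Λ - Λ(0))`,
which is bounded and holomorphic, so its dilations are uniform limits of polynomials
(`exists_mvPolynomial_approx`). The discrete part costs nothing: polynomials that vanish at an atom,
equal `1` at the origin, stay bounded on the sphere and tend to `1` off the atom remove the atoms
(`exists_poly_avoid_countable`).

For the integral of `log w`, the mean of `Re Λ` over every sphere is `Re Λ(0)`, and an `L²` bound
allows passage to the boundary (`integrable_log_boundary`).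

The boundary values come from Korányi's theorem for the bounded function `exp Λ`
(`ae_exists_kLimit`); Fatou's lemma for `|exp (-Λ)|²` excludes the limit `0`. Korányi's theorem
itself is reduced to Fatou's theorem on discs (`exists_radial_limit_disc`). Almost every point of
the sphere is a density point, for nonisotropic balls, of a set on which the radial oscillation is
uniformly small, and a mean value inequality over nonisotropic boxes carries this smallness into the
Korányi regions. -/

noncomputable section
namespace SzegoBall

/-! ### Schur parameters as partial correlations -/

section Levinson

variable {H : Type*} [NormedAddCommGroup H] [InnerProductSpace ℂ H]

/-- The forward and backward innovations of a sequence of vectors: `(levinson e n k).1` is the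
normalised component of `e k` orthogonal to `e (k+1), …, e (k+n)`, and `(levinson e n k).2` that of
`e (k+n)` orthogonal to `e k, …, e (k+n-1)`. -/
def levinson (e : ℕ → H) : ℕ → ℕ → H × H
  | 0 => fun k => (e k, e k)
  | n + 1 => fun k =>
      let c : ℂ := inner ℂ (levinson e n (k + 1)).2 (levinson e n k).1
      (((defect c : ℂ)⁻¹) • ((levinson e n k).1 - c • (levinson e n (k + 1)).2),
        ((defect c : ℂ)⁻¹) • ((levinson e n (k + 1)).2 - conj c • (levinson e n k).1))

/-- The forward innovation. -/
def fwd (e : ℕ → H) (n k : ℕ) : H := (levinson e n k).1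

/-- The backward innovation. -/
def bwd (e : ℕ → H) (n k : ℕ) : H := (levinson e n k).2

/-- The partial correlation of `e k` and `e (k+n+1)`. -/
def corr (e : ℕ → H) (n k : ℕ) : ℂ := inner ℂ (bwd e n (k + 1)) (fwd e n k)

variable {e : ℕ → H}

lemma fwd_zero (k : ℕ) : fwd e 0 k = e k := rfl

lemma bwd_zero (k : ℕ) : bwd e 0 k = e k := rfl

lemma fwd_succ (n k : ℕ) : fwd e (n + 1) k =
    ((defect (corr e n k) : ℂ)⁻¹) • (fwd e n k - corr e n k • bwd e n (k + 1)) := rfl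

lemma bwd_succ (n k : ℕ) : bwd e (n + 1) k =
    ((defect (corr e n k) : ℂ)⁻¹) • (bwd e n (k + 1) - conj (corr e n k) • fwd e n k) := rfl

lemma defect_pos {c : ℂ} (hc : ‖c‖ < 1) : 0 < defect c := by
  unfold defect
  apply Real.sqrt_pos.2
  nlinarith [norm_nonneg c]

lemma defect_sq {c : ℂ} (hc : ‖c‖ < 1) : defect c ^ 2 = 1 - ‖c‖ ^ 2 := by
  unfold defect
  apply Real.sq_sqrt
  nlinarith [norm_nonneg c]

lemma defect_sq' {c : ℂ} (hc : ‖c‖ < 1) : (defect c : ℂ) * defect c = 1 - c * conj c := by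
  rw [Complex.mul_conj, Complex.normSq_eq_norm_sq, ← Complex.ofReal_mul, ← sq, defect_sq hc]
  push_cast
  ring

lemma fwd_eq {n k : ℕ} (h : ‖corr e n k‖ < 1) : fwd e n k =
    (defect (corr e n k) : ℂ) • fwd e (n + 1) k + corr e n k • bwd e n (k + 1) := by
  have hd : (defect (corr e n k) : ℂ) ≠ 0 := by exact_mod_cast (defect_pos h).ne'
  rw [fwd_succ, smul_smul, mul_inv_cancel₀ hd, one_smul, sub_add_cancel]

lemma bwd_eq {n k : ℕ} (h : ‖corr e n k‖ < 1) : bwd e n (k + 1) =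
    (defect (corr e n k) : ℂ) • bwd e (n + 1) k + conj (corr e n k) • fwd e n k := by
  have hd : (defect (corr e n k) : ℂ) ≠ 0 := by exact_mod_cast (defect_pos h).ne'
  rw [bwd_succ, smul_smul, mul_inv_cancel₀ hd, one_smul, sub_add_cancel]

/-- The old backward and the new forward innovation form an orthonormal pair, and so do the old
forward and the new backward one. `fwd_eq` and this identity are the two rows of the matrix in `rot`
that relates the pairs. -/
lemma bwd_succ' {n k : ℕ} (h : ‖corr e n k‖ < 1) : bwd e (n + 1) k =
    (defect (corr e n k) : ℂ) • bwd e n (k + 1) - conj (corr e n k) • fwd e (n + 1) k := by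
  have hd : (defect (corr e n k) : ℂ) ≠ 0 := by exact_mod_cast (defect_pos h).ne'
  rw [fwd_succ, bwd_succ]
  have h2 := defect_sq' h
  generalize corr e n k = c at *
  generalize fwd e n k = f at *
  generalize bwd e n (k+1) = b at *
  generalize (defect c : ℂ) = d at *
  have h3 : d = d⁻¹ * (1 - c * conj c) := by rw [← h2]; field_simp
  rw [eq_sub_iff_add_eq]
  nth_rewrite 3 [h3]
  module

/-- The span of `e a, …, e (b-1)`. -/
def winSpan (e : ℕ → H) (a b : ℕ) : Submodule ℂ H := Submodule.span ℂ (e '' Set.Ico a b)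

lemma mem_winSpan {a b i : ℕ} (h1 : a ≤ i) (h2 : i < b) : e i ∈ winSpan e a b :=
  Submodule.subset_span ⟨i, ⟨h1, h2⟩, rfl⟩

lemma winSpan_mono {a b a' b' : ℕ} (h1 : a' ≤ a) (h2 : b ≤ b') :
    winSpan e a b ≤ winSpan e a' b' :=
  Submodule.span_mono (Set.image_mono (Set.Ico_subset_Ico h1 h2))

/-- The product of the forward defects. -/
def fwdDefect (e : ℕ → H) (n k : ℕ) : ℝ := ∏ l ∈ Finset.range n, defect (corr e l k)

/-- The product of the backward defects; the right endpoint of the window is `k + n`. -/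
def bwdDefect (e : ℕ → H) : ℕ → ℕ → ℝ
  | 0, _ => 1
  | n + 1, k => bwdDefect e n (k + 1) * defect (corr e n k)

/-- The properties that characterise the innovations of a window. -/
structure Innovation (e : ℕ → H) (n k : ℕ) : Prop where
  normF : ‖fwd e n k‖ = 1
  normB : ‖bwd e n k‖ = 1
  posF : 0 < fwdDefect e n k
  posB : 0 < bwdDefect e n k
  memF : e k - (fwdDefect e n k : ℂ) • fwd e n k ∈ winSpan e (k + 1) (k + n + 1)
  memB : e (k + n) - (bwdDefect e n k : ℂ) • bwd e n k ∈ winSpan e k (k + n)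
  orthF : ∀ v ∈ winSpan e (k + 1) (k + n + 1), inner ℂ v (fwd e n k) = 0
  orthB : ∀ v ∈ winSpan e k (k + n), inner ℂ v (bwd e n k) = 0

lemma Innovation.memF' {n k : ℕ} (h : Innovation e n k) : fwd e n k ∈ winSpan e k (k + n + 1) := by
  have h1 := winSpan_mono (e := e) (Nat.le_succ k) le_rfl h.memF
  have h2 := sub_mem (mem_winSpan (e := e) (le_refl k) (by omega : k < k + n + 1)) h1
  rw [sub_sub_cancel] at h2
  have hp : (fwdDefect e n k : ℂ) ≠ 0 := by exact_mod_cast h.posF.ne'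
  have h3 := (winSpan e k (k + n + 1)).smul_mem (fwdDefect e n k : ℂ)⁻¹ h2
  rwa [smul_smul, inv_mul_cancel₀ hp, one_smul] at h3

lemma Innovation.memB' {n k : ℕ} (h : Innovation e n k) : bwd e n k ∈ winSpan e k (k + n + 1) := by
  have h1 := winSpan_mono (e := e) le_rfl (Nat.le_succ _) h.memB
  have h2 := sub_mem (mem_winSpan (e := e) (by omega : k ≤ k + n) (by omega : k + n < k + n + 1)) h1
  rw [sub_sub_cancel] at h2
  have hp : (bwdDefect e n k : ℂ) ≠ 0 := by exact_mod_cast h.posB.ne'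
  have h3 := (winSpan e k (k + n + 1)).smul_mem (bwdDefect e n k : ℂ)⁻¹ h2
  rwa [smul_smul, inv_mul_cancel₀ hp, one_smul] at h3

/-- Equality in the Cauchy–Schwarz inequality would make the two innovations parallel and put `e k`
into the span of `e (k+1), …, e (k+n+1)`. -/
lemma corr_norm_lt (hl : LinearIndependent ℂ e) {n k : ℕ} (h1 : Innovation e n k)
    (h2 : Innovation e n (k + 1)) : ‖corr e n k‖ < 1 := by
  have hle : ‖corr e n k‖ ≤ 1 := by
    have := norm_inner_le_norm (𝕜 := ℂ) (bwd e n (k + 1)) (fwd e n k)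
    rwa [h2.normB, h1.normF, one_mul] at this
  refine lt_of_le_of_ne hle fun hc => ?_
  have hF : fwd e n k = corr e n k • bwd e n (k + 1) := by
    have h0 : ‖fwd e n k - corr e n k • bwd e n (k + 1)‖ ^ 2 = 0 := by
      rw [norm_sub_sq (𝕜 := ℂ), norm_smul, h1.normF, h2.normB, hc, inner_smul_right,
        ← inner_conj_symm]
      change _ - 2 * RCLike.re (corr e n k * conj (corr e n k)) + _ = _
      rw [RCLike.mul_conj, hc]
      norm_num
    exact sub_eq_zero.1 (norm_eq_zero.1 (pow_eq_zero_iff two_ne_zero |>.1 h0))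
  have h3 : e k ∈ winSpan e (k + 1) (k + n + 2) := by
    have h4 := winSpan_mono (e := e) le_rfl (by omega : k + n + 1 ≤ k + n + 2) h1.memF
    have h5 : fwd e n k ∈ winSpan e (k + 1) (k + n + 2) := by
      rw [hF]
      have := h2.memB'
      rw [show k + 1 + n + 1 = k + n + 2 by ring] at this
      exact Submodule.smul_mem _ _ this
    simpa using add_mem h4 (Submodule.smul_mem _ (fwdDefect e n k : ℂ) h5)
  refine hl.notMem_span_image (s := Set.Ico (k + 1) (k + n + 2)) (x := k) (by simp) h3

/-- Induction on the length of the window. Both old innovations are unit vectors orthogonal to the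
interior `e (k+1), …, e (k+n)`. Each is made orthogonal to the other, and division by the defect
restores the norm. -/
lemma innovation (hl : LinearIndependent ℂ e) (hu : ∀ n, ‖e n‖ = 1) (n : ℕ) :
    ∀ k, Innovation e n k := by
  induction n with
  | zero =>
    intro k
    refine ⟨hu k, hu k, by simp [fwdDefect], by simp [bwdDefect], ?_, ?_, ?_, ?_⟩ <;>
      simp [fwdDefect, bwdDefect, fwd_zero, bwd_zero, winSpan]
  | succ n ih =>
    intro k
    have h1 := ih k
    have h2 := ih (k + 1)
    have hc := corr_norm_lt hl h1 h2
    have hd := defect_pos hc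
    have hd' : (defect (corr e n k) : ℂ) ≠ 0 := by exact_mod_cast hd.ne'
    have hF := fwd_eq hc
    have hB := bwd_eq hc
    have e1 : k + 1 + n = k + (n + 1) := by ring
    have hcc : inner ℂ (bwd e n (k + 1)) (fwd e n k) = corr e n k := rfl
    have hcc' : inner ℂ (fwd e n k) (bwd e n (k + 1)) = conj (corr e n k) := by
      rw [← hcc, inner_conj_symm]
    have hpF : fwdDefect e (n + 1) k = fwdDefect e n k * defect (corr e n k) := by
      simp [fwdDefect, Finset.prod_range_succ]
    have hpB : bwdDefect e (n + 1) k = bwdDefect e n (k + 1) * defect (corr e n k) := rfl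
    have hnF : ‖fwd e n k - corr e n k • bwd e n (k + 1)‖ ^ 2 = defect (corr e n k) ^ 2 := by
      rw [norm_sub_sq (𝕜 := ℂ), norm_smul, h1.normF, h2.normB, inner_smul_right, hcc',
        RCLike.mul_conj, defect_sq hc]
      norm_cast
      ring
    have hnB : ‖bwd e n (k + 1) - conj (corr e n k) • fwd e n k‖ ^ 2 = defect (corr e n k) ^ 2 := by
      rw [norm_sub_sq (𝕜 := ℂ), norm_smul, h1.normF, h2.normB, inner_smul_right, hcc,
        RCLike.conj_mul, defect_sq hc, RCLike.norm_conj]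
      norm_cast
      ring
    rw [sq_eq_sq₀ (norm_nonneg _) hd.le] at hnF hnB
    refine ⟨?_, ?_, ?_, ?_, ?_, ?_, ?_, ?_⟩
    · rw [fwd_succ, norm_smul, hnF, norm_inv, Complex.norm_real, Real.norm_of_nonneg hd.le,
        inv_mul_cancel₀ hd.ne']
    · rw [bwd_succ, norm_smul, hnB, norm_inv, Complex.norm_real, Real.norm_of_nonneg hd.le,
        inv_mul_cancel₀ hd.ne']
    · rw [hpF]; exact mul_pos h1.posF hd
    · rw [hpB]; exact mul_pos h2.posB hd
    · have h3 := winSpan_mono (e := e) le_rfl (by omega : k + n + 1 ≤ k + (n + 1) + 1) h1.memF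
      have h4 := h2.memB'
      rw [e1] at h4
      have h5 := add_mem h3 (Submodule.smul_mem _ ((fwdDefect e n k : ℂ) * corr e n k) h4)
      convert h5 using 1
      rw [hpF]
      push_cast
      linear_combination (norm := module) (fwdDefect e n k : ℂ) • hF
    · have h3 := winSpan_mono (e := e) (Nat.le_succ k) le_rfl h2.memB
      have h4 := h1.memF'
      rw [e1] at h3
      have h5 := add_mem h3 (Submodule.smul_mem _
        ((bwdDefect e n (k + 1) : ℂ) * conj (corr e n k)) h4)
      convert h5 using 1
      rw [hpB]
      push_cast
      linear_combination (norm := module) (bwdDefect e n (k + 1) : ℂ) • hB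
    · intro v hv
      induction hv using Submodule.span_induction with
      | zero => simp
      | add x y _ _ hx hy => rw [inner_add_left, hx, hy, add_zero]
      | smul a x _ hx => rw [inner_smul_left, hx, mul_zero]
      | mem x hx =>
        obtain ⟨i, ⟨hi1, hi2⟩, rfl⟩ := hx
        rw [fwd_succ, inner_smul_right, inner_sub_right, inner_smul_right]
        rcases Nat.lt_or_ge i (k + n + 1) with hi | hi
        · rw [h1.orthF _ (mem_winSpan hi1 hi), h2.orthB _ (mem_winSpan hi1 (by omega))]
          simp
        -- The right endpoint is the only new generator. Modulo interior vectors it is a multiple of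
        -- `bwd e n (k+1)`, to which the new forward innovation is orthogonal.
        · obtain rfl : i = k + 1 + n := by omega
          have h3 : e (k + 1 + n) = (bwdDefect e n (k + 1) : ℂ) • bwd e n (k + 1) +
            (e (k + 1 + n) - (bwdDefect e n (k + 1) : ℂ) • bwd e n (k + 1)) := by abel
          have h4 := h2.memB
          rw [h3, inner_add_left, inner_add_left, h2.orthB _ h4,
            h1.orthF _ (winSpan_mono le_rfl (by omega) h4), inner_smul_left, inner_smul_left, hcc,
            inner_self_eq_norm_sq_to_K, h2.normB]
          push_cast
          ring
    · intro v hv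
      induction hv using Submodule.span_induction with
      | zero => simp
      | add x y _ _ hx hy => rw [inner_add_left, hx, hy, add_zero]
      | smul a x _ hx => rw [inner_smul_left, hx, mul_zero]
      | mem x hx =>
        obtain ⟨i, ⟨hi1, hi2⟩, rfl⟩ := hx
        rw [bwd_succ, inner_smul_right, inner_sub_right, inner_smul_right]
        rcases Nat.lt_or_ge k i with hi | hi
        · rw [h1.orthF _ (mem_winSpan hi (by omega)), h2.orthB _ (mem_winSpan hi (by omega))]
          simp
        · obtain rfl : i = k := by omega
          have h3 : e i = (fwdDefect e n i : ℂ) • fwd e n i +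
            (e i - (fwdDefect e n i : ℂ) • fwd e n i) := by abel
          have h4 := h1.memF
          rw [h3, inner_add_left, inner_add_left, h1.orthF _ h4,
            h2.orthB _ (winSpan_mono le_rfl (by omega) h4), inner_smul_left, inner_smul_left, hcc',
            inner_self_eq_norm_sq_to_K, h1.normF]
          push_cast
          ring

/-! ### Generalised rotations as changes of orthonormal bases -/

lemma rot_apply_left (l : ℕ) (c : ℂ) (v : ℕ → ℂ) :
    rot l c v l = c * v l + defect c * v (l + 1) := by simp [rot]

lemma rot_apply_right (l : ℕ) (c : ℂ) (v : ℕ → ℂ) :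
    rot l c v (l + 1) = defect c * v l - conj c * v (l + 1) := by simp [rot]

lemma rot_apply_of_ne {l i : ℕ} (c : ℂ) (v : ℕ → ℂ) (h1 : i ≠ l) (h2 : i ≠ l + 1) :
    rot l c v i = v i := by simp [rot, h1, h2]

/-- `rotChain` passes from the basis adapted to the window `[k+1, k+m]`, completed by the forward
innovation at `k`, to the basis of backward innovations of `[k, k+m]`. -/
lemma rotChain_inner (hc : ∀ n k, ‖corr e n k‖ < 1) (γ : ℕ → ℕ → ℂ) (x : H) (k m : ℕ) :
    ∀ v : ℕ → ℂ, (∀ l < m, γ k (k + l + 1) = corr e l k) →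
      (∀ l < m, v l = inner ℂ x (bwd e l (k + 1))) → v m = inner ℂ x (fwd e m k) →
      (∀ l ≤ m, rotChain γ k m v l = inner ℂ x (bwd e l k)) ∧
        ∀ l, m < l → rotChain γ k m v l = v l := by
  induction m with
  | zero =>
    intro v _ _ hv
    refine ⟨fun l hl => ?_, fun l _ => rfl⟩
    obtain rfl : l = 0 := by omega
    exact hv
  | succ m ih =>
    intro v hγ hb hf
    have hcm := hγ m (by omega)
    -- The first row of the rotation turns the coordinate on `fwd e (m+1) k` into the one on `fwd e
    -- m k`, which is the input of the shorter chain. The second row produces the final coordinate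
    -- on `bwd e (m+1) k`.
    have h1 : rot m (γ k (k + m + 1)) v m = inner ℂ x (fwd e m k) := by
      rw [rot_apply_left, hcm, hb m (by omega), hf, fwd_eq (hc m k), inner_add_right,
        inner_smul_right, inner_smul_right]
      ring
    have h2 : rot m (γ k (k + m + 1)) v (m + 1) = inner ℂ x (bwd e (m + 1) k) := by
      rw [rot_apply_right, hcm, hb m (by omega), hf, bwd_succ' (hc m k), inner_sub_right,
        inner_smul_right, inner_smul_right]
    have h3 := ih (rot m (γ k (k + m + 1)) v) (fun l hl => hγ l (by omega))
      (fun l hl => by rw [rot_apply_of_ne _ _ (by omega) (by omega), hb l (by omega)]) h1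
    refine ⟨fun l hl => ?_, fun l hl => ?_⟩
    · rcases Nat.lt_or_ge m l with h | h
      · obtain rfl : l = m + 1 := by omega
        exact (h3.2 _ h).trans h2
      · exact h3.1 l h
    · exact (h3.2 l (by omega)).trans (rot_apply_of_ne _ _ (by omega) (by omega))

/-- `genRot` passes from the forward to the backward innovations of a window. -/
lemma genRot_inner (hc : ∀ n k, ‖corr e n k‖ < 1) (γ : ℕ → ℕ → ℂ) (x : H) (n : ℕ) :
    ∀ (k : ℕ) (v : ℕ → ℂ), (∀ k' l, l < n → γ k' (k' + l + 1) = corr e l k') →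
      (∀ i ≤ n, v i = inner ℂ x (fwd e i (k + n - i))) →
      (∀ l ≤ n, genRot γ k n v l = inner ℂ x (bwd e l k)) ∧
        ∀ l, n < l → genRot γ k n v l = v l := by
  induction n with
  | zero =>
    intro k v _ hv
    refine ⟨fun l hl => ?_, fun l _ => rfl⟩
    obtain rfl : l = 0 := by omega
    exact hv 0 le_rfl
  | succ n ih =>
    intro k v hγ hv
    have h1 := ih (k + 1) v (fun k' l hl => hγ k' l (by omega)) (fun i hi => by
      rw [hv i (by omega), show k + (n + 1) - i = k + 1 + n - i by omega])
    -- The shorter rotation leaves the coordinate `n + 1` alone, so it still holds the forward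
    -- innovation of the full window, as the chain requires.
    have h2 := rotChain_inner hc γ x k (n + 1) (genRot γ (k + 1) n v)
      (fun l hl => hγ k l hl) (fun l hl => h1.1 l (by omega)) (by
        rw [h1.2 _ (by omega), hv _ le_rfl, show k + (n + 1) - (n + 1) = k by omega])
    exact ⟨h2.1, fun l hl => (h2.2 l hl).trans (h1.2 l (by omega))⟩

/-- `fwd_eq` telescopes. This expands the predicted part of `e k` in backward innovations, and the
coefficients are those of `rowEntry`. -/
lemma sum_bwd (hc : ∀ n k, ‖corr e n k‖ < 1) (n k : ℕ) :
    ∑ l ∈ Finset.range n, ((fwdDefect e l k : ℂ) * corr e l k) • bwd e l (k + 1) =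
      e k - (fwdDefect e n k : ℂ) • fwd e n k := by
  induction n with
  | zero => simp [fwdDefect, fwd_zero]
  | succ n ih =>
    have hp : fwdDefect e (n + 1) k = fwdDefect e n k * defect (corr e n k) := by
      simp [fwdDefect, Finset.prod_range_succ]
    rw [Finset.sum_range_succ, ih, hp]
    push_cast
    linear_combination (norm := module) (-(fwdDefect e n k : ℂ)) • fwd_eq (hc n k)

/-- The recursion fixes the right endpoint of the window and moves the left one; this is the order
of the factors in `colEntry`. -/
lemma bwdDefect_eq_prod (n : ℕ) : ∀ k, bwdDefect e n k =
    ∏ l ∈ Finset.range n, defect (corr e l (k + n - 1 - l)) := by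
  induction n with
  | zero => intro k; simp [bwdDefect]
  | succ n ih =>
    intro k
    rw [Finset.prod_range_succ, bwdDefect, ih (k + 1)]
    congr 1
    · apply Finset.prod_congr rfl
      intro l _
      rw [show k + 1 + n - 1 - l = k + (n + 1) - 1 - l by omega]
    · rw [show k + (n + 1) - 1 - n = k by omega]

/-- Split `e k` into its projection onto the vectors strictly between the two indices and a multiple
of the forward innovation. The row gives the projection in backward innovations, the column gives `e
(k+n+1)` in forward innovations, and the generalised rotation matches the two bases, so the
projection contributes the central value. The remainder contributes the defects times the
correlation. -/
lemma inner_eq_central_add (hl : LinearIndependent ℂ e) (hu : ∀ n, ‖e n‖ = 1)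
    {γ : ℕ → ℕ → ℂ} {n : ℕ} (hγ : ∀ k l, l < n → γ k (k + l + 1) = corr e l k) (k : ℕ) :
    inner ℂ (e (k + n + 1)) (e k) = centralValue γ k n + defectProduct γ k n * corr e n k ∧
      defectProduct γ k n ≠ 0 := by
  have hI := innovation hl hu
  have hc : ∀ n k, ‖corr e n k‖ < 1 := fun n k => corr_norm_lt hl (hI n k) (hI n (k + 1))
  set x := e (k + n + 1) with hx
  have hγ' : ∀ k' l j, l < n → j = k' + l + 1 → γ k' j = corr e l k' := by
    rintro k' l j h rfl; exact hγ k' l h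
  have hrow : ∀ i < n, rowEntry γ k i = (fwdDefect e i k : ℂ) * corr e i k := by
    intro i hi
    rw [rowEntry, fwdDefect, hγ' k i _ hi (by ring)]
    push_cast
    congr 1
    apply Finset.prod_congr rfl
    intro l hl
    rw [hγ' k l _ (by have := Finset.mem_range.1 hl; omega) (by ring)]
  have hbd : ∀ i ≤ n, (∏ l ∈ Finset.range i, (defect (γ (k + n - l) (k + n + 1)) : ℂ)) =
      bwdDefect e i (k + n + 1 - i) := by
    intro i hi
    rw [bwdDefect_eq_prod]
    push_cast
    apply Finset.prod_congr rfl
    intro l hl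
    have := Finset.mem_range.1 hl
    rw [hγ' (k + n - l) l _ (by omega) (by omega),
      show k + n + 1 - i + i - 1 - l = k + n - l by omega]
  -- Up to a vector orthogonal to this forward innovation, `x` is a multiple of a backward
  -- innovation.
  have hinner : ∀ i ≤ n, inner ℂ x (fwd e i (k + n - i)) =
      (bwdDefect e i (k + n + 1 - i) : ℂ) * corr e i (k + n - i) := by
    intro i hi
    have h1 := hI i (k + n + 1 - i)
    have h2 := hI i (k + n - i)
    have h3 := h1.memB
    rw [show k + n + 1 - i + i = k + n + 1 by omega, ← hx] at h3
    have h4 := h2.orthF _ (by convert h3 using 2 <;> omega)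
    rw [inner_sub_left, inner_smul_left, Complex.conj_ofReal, sub_eq_zero] at h4
    rw [h4, corr, show k + n + 1 - i = k + n - i + 1 by omega]
  have hcol : ∀ i < n, colEntry γ (k + n + 1) i = inner ℂ x (fwd e i (k + n - i)) := by
    intro i hi
    rw [colEntry, show k + n + 1 - 1 = k + n by omega, hbd i hi.le, hinner i hi.le,
      hγ' (k + n - i) i _ hi (by omega), mul_comm]
  have hcentral : centralValue γ k n = inner ℂ x (e k - (fwdDefect e n k : ℂ) • fwd e n k) := by
    rw [centralValue, ← sum_bwd hc, inner_sum]
    apply Finset.sum_congr rfl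
    intro l hl
    have hl' := Finset.mem_range.1 hl
    rw [inner_smul_right, hrow l hl']
    congr 1
    refine (genRot_inner hc γ x (n - 1) (k + 1) _ (fun k' l h => hγ k' l (by omega)) ?_).1 l
      (by omega)
    intro i hi
    rw [if_pos (by omega), hcol i (by omega), show k + 1 + (n - 1) - i = k + n - i by omega]
  have hprod : defectProduct γ k n = (fwdDefect e n k : ℂ) * bwdDefect e n (k + 1) := by
    rw [defectProduct, fwdDefect]
    push_cast
    congr 1
    · apply Finset.prod_congr rfl
      intro l hl
      rw [hγ' k l _ (Finset.mem_range.1 hl) (by ring)]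
    · have h1 := hbd n le_rfl
      rw [show k + n + 1 - n = k + 1 by omega] at h1
      rw [← h1, ← Finset.prod_range_reflect]
      apply Finset.prod_congr rfl
      intro l hl
      have := Finset.mem_range.1 hl
      rw [show k + 1 + (n - 1 - l) = k + n - l by omega]
  constructor
  · have h1 := hinner n le_rfl
    rw [show k + n - n = k by omega, show k + n + 1 - n = k + 1 by omega] at h1
    rw [hcentral, hprod, inner_sub_right, inner_smul_right, h1]
    ring
  · rw [hprod]
    exact_mod_cast (mul_pos (hI n k).posF (hI n (k + 1)).posB).ne'

/-- The Schur parameters of a Gram matrix are the partial correlations. -/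
lemma schurParam_eq_corr (hl : LinearIndependent ℂ e) (hu : ∀ n, ‖e n‖ = 1) {K : ℕ → ℕ → ℂ}
    (hK : ∀ n m, K n m = inner ℂ (e m) (e n)) (k n : ℕ) :
    schurParam K k (k + n + 1) = corr e n k := by
  -- Stage `l + 1` determines the parameters at distance `l + 1`, and later stages keep them. The
  -- division is legitimate because the defect product does not vanish.
  have h : ∀ N k l, l < N → schurStage K N k (k + l + 1) = corr e l k := by
    intro N
    induction N with
    | zero => intro k l hl; omega
    | succ N ih =>
      intro k l hlN
      simp only [schurStage]
      split_ifs with h1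
      · obtain rfl : l = N := by omega
        obtain ⟨h2, h3⟩ := inner_eq_central_add hl hu ih k
        rw [hK, h2]
        field_simp
        ring
      · exact ih k l (by omega)
  rw [schurParam]
  exact h _ k n (by omega)

lemma prod_defect_sq (hl : LinearIndependent ℂ e) (hu : ∀ n, ‖e n‖ = 1) {K : ℕ → ℕ → ℂ}
    (hK : ∀ n m, K n m = inner ℂ (e m) (e n)) (N : ℕ) :
    ∏ l ∈ Finset.range N, (1 - ‖schurParam K 0 (l + 1)‖ ^ 2) = fwdDefect e N 0 ^ 2 := by
  have hI := innovation hl hu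
  rw [fwdDefect, ← Finset.prod_pow]
  apply Finset.prod_congr rfl
  intro l _
  have h := schurParam_eq_corr hl hu hK 0 l
  rw [zero_add] at h
  rw [h, defect_sq (corr_norm_lt hl (hI l 0) (hI l 1))]

/-- Verblunsky's formula: the product of the defects of the first row is the squared distance of
the first vector to the span of the following ones. -/
theorem prod_one_sub_norm_schurParam_sq (hl : LinearIndependent ℂ e) (hu : ∀ n, ‖e n‖ = 1)
    {K : ℕ → ℕ → ℂ} (hK : ∀ n m, K n m = inner ℂ (e m) (e n)) (N : ℕ) :
    IsLeast ((fun v => ‖e 0 - v‖ ^ 2) '' (winSpan e 1 (N + 1) : Set H))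
      (∏ l ∈ Finset.range N, (1 - ‖schurParam K 0 (l + 1)‖ ^ 2)) := by
  have hI := innovation hl hu N 0
  have hm := hI.memF
  simp only [zero_add] at hm
  rw [prod_defect_sq hl hu hK]
  constructor
  · refine ⟨_, hm, ?_⟩
    simp only [sub_sub_cancel, norm_smul, hI.normF, Complex.norm_real, mul_one]
    rw [Real.norm_of_nonneg hI.posF.le]
  -- Competitors differ from the optimal one by vectors orthogonal to the innovation, so all have
  -- the same inner product with that unit vector, and this bounds their norm from below.
  · rintro _ ⟨v, hv, rfl⟩
    have h1 := hI.orthF (v - (e 0 - (fwdDefect e N 0 : ℂ) • fwd e N 0))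
      (by simpa only [zero_add] using sub_mem hv hm)
    have h2 : inner ℂ (e 0 - v) (fwd e N 0) = (fwdDefect e N 0 : ℂ) := by
      rw [show e 0 - v = (fwdDefect e N 0 : ℂ) • fwd e N 0 -
        (v - (e 0 - (fwdDefect e N 0 : ℂ) • fwd e N 0)) by abel, inner_sub_left, h1,
        inner_smul_left, inner_self_eq_norm_sq_to_K, hI.normF]
      simp
    have h3 := norm_inner_le_norm (𝕜 := ℂ) (e 0 - v) (fwd e N 0)
    rw [h2, hI.normF, mul_one, Complex.norm_real, Real.norm_of_nonneg hI.posF.le] at h3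
    exact pow_le_pow_left₀ hI.posF.le h3 2

lemma one_sub_norm_schurParam_sq_mem (hl : LinearIndependent ℂ e) (hu : ∀ n, ‖e n‖ = 1)
    {K : ℕ → ℕ → ℂ} (hK : ∀ n m, K n m = inner ℂ (e m) (e n)) (n : ℕ) :
    0 < 1 - ‖schurParam K 0 n‖ ^ 2 ∧ 1 - ‖schurParam K 0 n‖ ^ 2 ≤ 1 := by
  refine ⟨?_, by nlinarith [norm_nonneg (schurParam K 0 n)]⟩
  cases n with
  | zero => simp [schurParam, schurStage]
  | succ n =>
    have hI := innovation hl hu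
    have h := schurParam_eq_corr hl hu hK 0 n
    rw [zero_add] at h
    have h1 := corr_norm_lt hl (hI n 0) (hI n 1)
    rw [h]
    nlinarith [norm_nonneg (corr e n 0)]

end Levinson

end SzegoBall
end

noncomputable section
namespace SzegoBall

/-! ### The enumeration of the multi-indices -/

/-- In an infinite type with a strict total order with finite initial segments, counting the
predecessors is a bijection onto `ℕ`. -/
lemma bijective_ncard_initialSegment {X : Type*} [Infinite X] (r : X → X → Prop)
    (hirr : ∀ x, ¬ r x x) (htr : ∀ x y z, r x y → r y z → r x z)
    (htot : ∀ x y, r x y ∨ x = y ∨ r y x) (hfin : ∀ x, {y | r y x}.Finite) :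
    Function.Bijective fun x => {y | r y x}.ncard := by
  have hmono : ∀ x y, r x y → {z | r z x}.ncard < {z | r z y}.ncard := by
    intro x y hxy
    refine Set.ncard_lt_ncard ⟨fun z hz => htr _ _ _ hz hxy, fun h => hirr x (h hxy)⟩ (hfin y)
  have hinj : Function.Injective fun x => {y | r y x}.ncard := by
    intro x y hxy
    rcases htot x y with h | h | h
    · exact absurd hxy (hmono _ _ h).ne
    · exact h
    · exact absurd hxy.symm (hmono _ _ h).ne
  refine ⟨hinj, fun n => ?_⟩
  obtain ⟨x, hx⟩ : ∃ x, n < {y | r y x}.ncard := by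
    by_contra! h
    exact Set.infinite_range_of_injective hinj
      ((Set.finite_Iic n).subset (Set.range_subset_iff.2 fun x => h x))
  -- The predecessors of `x` have distinct counts below the count of `x`, and there are as many of
  -- them as there are smaller numbers, so every smaller number occurs.
  have himg : (fun x => {y | r y x}.ncard) '' {y | r y x} = Set.Iio {y | r y x}.ncard := by
    refine Set.eq_of_subset_of_ncard_le ?_ ?_ (Set.finite_Iio _)
    · rintro _ ⟨y, hy, rfl⟩
      exact hmono _ _ hy
    · rw [Set.ncard_image_of_injective _ hinj]
      simp [Set.ncard_eq_toFinset_card']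
  obtain ⟨y, -, hy⟩ := himg.symm.subset hx
  exact ⟨y, hy⟩

/-! ### The shortlex order is a strict total order with finite initial segments -/

lemma precedes_irrefl {d : ℕ} (α : Fin d → ℕ) : ¬ Precedes α α := by
  rintro (h | ⟨-, i, -, h⟩) <;> exact lt_irrefl _ h

lemma precedes_trans {d : ℕ} (α β γ : Fin d → ℕ) (h1 : Precedes α β) (h2 : Precedes β γ) :
    Precedes α γ := by
  rcases h1 with h1 | ⟨h1, i, hi, hi'⟩ <;> rcases h2 with h2 | ⟨h2, j, hj, hj'⟩
  · exact Or.inl (h1.trans h2)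
  · exact Or.inl (h2 ▸ h1)
  · exact Or.inl (h1 ▸ h2)
  · refine Or.inr ⟨h1.trans h2, ?_⟩
    rcases lt_trichotomy i j with h | h | h
    · exact ⟨i, fun k hk => (hi k hk).trans (hj k (hk.trans h)), hj i h ▸ hi'⟩
    · subst h
      exact ⟨i, fun k hk => (hi k hk).trans (hj k hk), hj'.trans hi'⟩
    · exact ⟨j, fun k hk => (hi k (hk.trans h)).trans (hj k hk), (hi j h).symm ▸ hj'⟩

lemma precedes_total {d : ℕ} (α β : Fin d → ℕ) : Precedes α β ∨ α = β ∨ Precedes β α := by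
  rcases lt_trichotomy (multiLength α) (multiLength β) with h | h | h
  · exact Or.inl (Or.inl h)
  · by_cases hne : α = β
    · exact Or.inr (Or.inl hne)
    · obtain ⟨i, hi, hmin⟩ := WellFounded.has_min (wellFounded_lt (α := Fin d))
        {i | α i ≠ β i} (Function.ne_iff.1 hne)
      have hlt : ∀ j < i, α j = β j := fun j hj => by
        by_contra hc
        exact hmin j hc hj
      rcases lt_or_gt_of_ne hi with h' | h'
      · exact Or.inr (Or.inr (Or.inr ⟨h.symm, i, fun j hj => (hlt j hj).symm, h'⟩))
      · exact Or.inl (Or.inr ⟨h, i, hlt, h'⟩)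
  · exact Or.inr (Or.inr (Or.inl h))

lemma finite_precedes {d : ℕ} (α : Fin d → ℕ) : {β | Precedes β α}.Finite := by
  refine (Set.Finite.pi' fun _ : Fin d => Set.finite_Iic (multiLength α)).subset ?_
  intro β hβ i
  have h1 : multiLength β ≤ multiLength α := by
    rcases hβ with h | h
    · exact h.le
    · exact h.1.le
  exact (Finset.single_le_sum (f := β) (fun _ _ => Nat.zero_le _) (Finset.mem_univ i)).trans h1

lemma shortlexPosition_bijective {d : ℕ} (hd : 1 ≤ d) :
    Function.Bijective (shortlexPosition (d := d)) := by
  have : Nonempty (Fin d) := ⟨⟨0, hd⟩⟩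
  exact bijective_ncard_initialSegment _ precedes_irrefl precedes_trans precedes_total
    finite_precedes

/-- The shortlex enumeration as an equivalence. -/
def shortlexEquiv {d : ℕ} (hd : 1 ≤ d) : (Fin d → ℕ) ≃ ℕ :=
  Equiv.ofBijective _ (shortlexPosition_bijective hd)

lemma shortlexEquiv_apply {d : ℕ} (hd : 1 ≤ d) (α : Fin d → ℕ) :
    shortlexEquiv hd α = shortlexPosition α := rfl

lemma nthIndex_eq {d : ℕ} (hd : 1 ≤ d) (n : ℕ) : nthIndex d n = (shortlexEquiv hd).symm n := by
  apply (shortlexEquiv hd).injective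
  rw [Equiv.apply_symm_apply]
  exact Function.invFun_eq ((shortlexPosition_bijective hd).2 n)

lemma shortlexPosition_zero {d : ℕ} : shortlexPosition (0 : Fin d → ℕ) = 0 := by
  rw [shortlexPosition, Set.ncard_eq_zero (finite_precedes _), Set.eq_empty_iff_forall_notMem]
  rintro β (h | ⟨h0, i, -, h⟩)
  · simp [multiLength] at h
  · change (0 : ℕ) < _ at h
    simp only [multiLength, Pi.zero_apply, Finset.sum_const_zero, Finset.sum_eq_zero_iff,
      Finset.mem_univ, true_implies] at h0
    simp [h0] at h

/-- An infinite product of factors in `[0, 1]` converges unconditionally, to the limit of its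
partial products along any enumeration. -/
lemma hasProd_of_antitone {ι : Type*} (σ : ι ≃ ℕ) {a : ι → ℝ} (h0 : ∀ i, 0 ≤ a i)
    (h1 : ∀ i, a i ≤ 1) {L : ℝ}
    (h : Tendsto (fun N => ∏ n ∈ Finset.range N, a (σ.symm n)) atTop (𝓝 L)) : HasProd a L := by
  rw [← σ.symm.hasProd_iff]
  have hanti : Antitone fun s : Finset ℕ => ∏ n ∈ s, (a ∘ σ.symm) n := by
    intro s t hst
    dsimp only
    rw [← Finset.prod_sdiff hst]
    exact mul_le_of_le_one_left (Finset.prod_nonneg fun _ _ => h0 _)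
      (Finset.prod_le_one (fun _ _ => h0 _) fun _ _ => h1 _)
  have hb : BddBelow (Set.range fun s : Finset ℕ => ∏ n ∈ s, (a ∘ σ.symm) n) :=
    ⟨0, by rintro _ ⟨s, rfl⟩; exact Finset.prod_nonneg fun _ _ => h0 _⟩
  have hlim := tendsto_atTop_ciInf hanti hb
  have h2 := hlim.comp tendsto_finset_range
  rw [tendsto_nhds_unique h h2]
  exact hlim

end SzegoBall
end

noncomputable section
namespace SzegoBall

/-! ### The surface measure -/

section Surface

open scoped Pointwise

variable {d : ℕ}

lemma finrank_Cn (d : ℕ) : Module.finrank ℝ (Cn d) = 2 * d := by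
  rw [finrank_real_of_complex, finrank_euclideanSpace_fin]

instance [NeZero d] : Nontrivial (Cn d) :=
  inferInstanceAs (Nontrivial (EuclideanSpace ℂ (Fin d)))

instance [NeZero d] : IsProbabilityMeasure (sigma d) := by
  refine ⟨?_⟩
  rw [sigma, Measure.smul_apply, smul_eq_mul]
  refine ENNReal.inv_mul_cancel ?_ (measure_ne_top _ _)
  rw [Ne, Measure.measure_univ_eq_zero]
  exact Measure.toSphere_ne_zero _

/-- The part `s ≤ |z| < t` of the cone over a subset of the sphere. -/
def shell (A : Set (USphere d)) (s t : ℝ) : Set (Cn d) := Set.Ico s t • (Subtype.val '' A)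

lemma mem_shell {A : Set (USphere d)} {s t : ℝ} {z : Cn d} :
    z ∈ shell A s t ↔ ∃ r ∈ Set.Ico s t, ∃ η ∈ A, r • (η : Cn d) = z := by
  simp [shell, Set.mem_smul]

/-- In polar coordinates the cone is a measurable rectangle. -/
lemma measurableSet_cone {A : Set (USphere d)} (hA : MeasurableSet A) :
    MeasurableSet (Set.Ioo (0 : ℝ) 1 • (Subtype.val '' A) : Set (Cn d)) := by
  have h : (Set.Ioo (0 : ℝ) 1 • (Subtype.val '' A) : Set (Cn d)) =
      (↑) '' (homeomorphUnitSphereProd (Cn d) ⁻¹' A ×ˢ Set.Iio ⟨1, Set.mem_Ioi.2 one_pos⟩) := by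
    rw [← Set.image2_smul, Set.image2_image_right, ← Homeomorph.image_symm, Set.image_image]
    ext z
    simp only [Set.mem_image2, Set.mem_image, Set.mem_prod, Prod.exists]
    constructor
    · rintro ⟨r, hr, η, hη, rfl⟩
      exact ⟨η, ⟨r, hr.1⟩, ⟨hη, hr.2⟩, rfl⟩
    · rintro ⟨η, r, ⟨hη, hr⟩, rfl⟩
      exact ⟨r, ⟨r.2, hr⟩, η, hη, rfl⟩
  rw [h]
  refine (MeasurableEmbedding.subtype_coe (measurableSet_singleton _).compl).measurableSet_image' ?_
  exact (homeomorphUnitSphereProd (Cn d)).measurable (hA.prod measurableSet_Iio)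

/-- The dimension factor of the surface measure cancels in the normalisation, so `sigma` is
normalised cone volume. In this form facts about Lebesgue measure pass to the sphere. -/
lemma volume_cone [NeZero d] {A : Set (USphere d)} (hA : MeasurableSet A) :
    volume (Set.Ioo (0 : ℝ) 1 • (Subtype.val '' A) : Set (Cn d)) =
      volume (unitBall d) * sigma d A := by
  have h1 := Measure.toSphere_apply' (volume : Measure (Cn d)) hA
  rw [sigma, Measure.smul_apply, smul_eq_mul, h1, Measure.toSphere_apply_univ]
  have h2 : ((Module.finrank ℝ (Cn d) : ℕ) : ℝ≥0∞) ≠ 0 := by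
    exact_mod_cast Module.finrank_pos.ne'
  have h3 : volume (unitBall d) ≠ 0 := (Metric.measure_ball_pos _ _ one_pos).ne'
  have h4 : volume (unitBall d) ≠ ∞ := measure_ball_lt_top.ne
  have h5 : ((Module.finrank ℝ (Cn d) : ℕ) : ℝ≥0∞) ≠ ∞ := ENNReal.natCast_ne_top _
  set V := volume (Set.Ioo (0 : ℝ) 1 • (Subtype.val '' A) : Set (Cn d))
  rw [ENNReal.mul_inv (Or.inl h2) (Or.inl h5)]
  calc V = (volume (unitBall d) * (volume (unitBall d))⁻¹) *
        ((Module.finrank ℝ (Cn d) : ℕ) * ((Module.finrank ℝ (Cn d) : ℕ) : ℝ≥0∞)⁻¹) * V := by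
        rw [ENNReal.mul_inv_cancel h2 h5, ENNReal.mul_inv_cancel h3 h4, one_mul, one_mul]
    _ = _ := by ring

lemma Ioo_smul_eq {A : Set (USphere d)} {t : ℝ} (ht : 0 < t) :
    (Set.Ioo 0 t • (Subtype.val '' A) : Set (Cn d)) =
      t • (Set.Ioo (0 : ℝ) 1 • (Subtype.val '' A) : Set (Cn d)) := by
  rw [← smul_assoc]
  simp [LinearOrderedField.smul_Ioo ht]

lemma volume_shell [NeZero d] {A : Set (USphere d)} (hA : MeasurableSet A) {s t : ℝ}
    (hs : 0 < s) (hst : s ≤ t) :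
    volume (shell A s t) =
      ENNReal.ofReal (t ^ (2 * d) - s ^ (2 * d)) * (volume (unitBall d) * sigma d A) := by
  have ht := hs.trans_le hst
  have hv : ∀ t : ℝ, 0 < t → volume (Set.Ioo 0 t • (Subtype.val '' A) : Set (Cn d)) =
      ENNReal.ofReal (t ^ (2 * d)) * (volume (unitBall d) * sigma d A) := by
    intro t ht
    rw [Ioo_smul_eq ht, Measure.addHaar_smul_of_nonneg _ ht.le, volume_cone hA, finrank_Cn]
  have hm : MeasurableSet (Set.Ioo 0 s • (Subtype.val '' A) : Set (Cn d)) := by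
    rw [Ioo_smul_eq hs]
    exact (measurableSet_cone hA).const_smul₀ s
  have hu : (Set.Ioo 0 t • (Subtype.val '' A) : Set (Cn d)) =
      Set.Ioo 0 s • (Subtype.val '' A) ∪ shell A s t := by
    rw [shell, ← Set.union_smul, Set.Ioo_union_Ico_eq_Ioo hs hst]
  have hdis : Disjoint (Set.Ioo 0 s • (Subtype.val '' A) : Set (Cn d)) (shell A s t) := by
    rw [Set.disjoint_left]
    intro z hz hz'
    obtain ⟨r, hr, η, hη, rfl⟩ := mem_shell.1 hz'
    obtain ⟨r', hr', _, ⟨η', hη', rfl⟩, h⟩ := Set.mem_smul.1 hz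
    have h1 := congrArg norm h
    simp only [norm_smul, norm_eq_of_mem_sphere, mul_one, Real.norm_eq_abs, abs_of_pos hr'.1, abs_of_nonneg (hs.le.trans hr.1)] at h1
    exact absurd (h1 ▸ hr'.2) (not_lt.2 hr.1)
  have h1 := measure_union' (μ := (volume : Measure (Cn d))) hdis hm
  rw [← hu, hv t ht, hv s hs] at h1
  have hfin : ENNReal.ofReal (s ^ (2 * d)) * (volume (unitBall d) * sigma d A) ≠ ∞ :=
    ENNReal.mul_ne_top ENNReal.ofReal_ne_top
      (ENNReal.mul_ne_top measure_ball_lt_top.ne (measure_ne_top _ _))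
  rw [ENNReal.ofReal_sub _ (by positivity), ENNReal.sub_mul (fun _ _ =>
    ENNReal.mul_ne_top measure_ball_lt_top.ne (measure_ne_top _ _)), h1,
    ENNReal.add_sub_cancel_left hfin]

/-- The map of the sphere induced by a linear isometry. -/
def sphereMap (L : Cn d ≃ₗᵢ[ℝ] Cn d) (ζ : USphere d) : USphere d :=
  ⟨L ζ, by simp⟩

lemma continuous_sphereMap (L : Cn d ≃ₗᵢ[ℝ] Cn d) : Continuous (sphereMap L) :=
  (L.continuous.comp continuous_subtype_val).subtype_mk _

/-- A linear isometry maps cones to cones and preserves their volume. -/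
lemma measurePreserving_sphereMap [NeZero d] (L : Cn d ≃ₗᵢ[ℝ] Cn d) :
    MeasurePreserving (sphereMap L) (sigma d) (sigma d) := by
  refine ⟨(continuous_sphereMap L).measurable, ?_⟩
  ext A hA
  rw [Measure.map_apply (continuous_sphereMap L).measurable hA]
  have hA' := (continuous_sphereMap L).measurable hA
  have h : (Set.Ioo (0 : ℝ) 1 • (Subtype.val '' (sphereMap L ⁻¹' A)) : Set (Cn d)) =
      L ⁻¹' (Set.Ioo (0 : ℝ) 1 • (Subtype.val '' A)) := by
    ext z
    simp only [Set.mem_smul, Set.mem_image, Set.mem_preimage]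
    constructor
    · rintro ⟨r, hr, _, ⟨η, hη, rfl⟩, rfl⟩
      exact ⟨r, hr, _, ⟨_, hη, rfl⟩, (map_smul L r (η : Cn d)).symm⟩
    · rintro ⟨r, hr, _, ⟨η, hη, rfl⟩, h⟩
      refine ⟨r, hr, _, ⟨sphereMap L.symm η, ?_, rfl⟩, ?_⟩
      · simpa [sphereMap] using hη
      · rw [← L.symm_apply_apply z, ← h, map_smul]
        rfl
  have h1 := volume_cone hA'
  rw [h, L.measurePreserving.measure_preimage (measurableSet_cone hA).nullMeasurableSet,
    volume_cone hA] at h1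
  exact ((ENNReal.mul_right_inj (Metric.measure_ball_pos _ _ one_pos).ne'
    measure_ball_lt_top.ne).1 h1).symm

/-- The diagonal unitary map with given entries. -/
def diagIsometry (u : Fin d → Circle) : Cn d ≃ₗᵢ[ℝ] Cn d :=
  LinearIsometryEquiv.piLpCongrRight 2 fun i => rotation (u i)

lemma diagIsometry_apply (u : Fin d → Circle) (z : Cn d) (i : Fin d) :
    diagIsometry u z i = u i * z i := by
  simp [diagIsometry]

lemma diagIsometry_const (u : Circle) (z : Cn d) :
    diagIsometry (fun _ => u) z = (u : ℂ) • z := by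
  ext i
  simp [diagIsometry_apply]

/-- The action of the circle group on the sphere. -/
def circleAct (θ : ℝ) (η : USphere d) : USphere d :=
  sphereMap (diagIsometry fun _ => Circle.exp θ) η

lemma coe_circleAct (θ : ℝ) (η : USphere d) :
    (circleAct θ η : Cn d) = Complex.exp (θ * Complex.I) • (η : Cn d) := by
  simp [circleAct, sphereMap, diagIsometry_const]

lemma continuous_circleAct : Continuous fun p : USphere d × ℝ => circleAct p.2 p.1 := by
  refine Continuous.subtype_mk ?_ _
  simp only [diagIsometry_const]
  fun_prop

lemma continuous_circleAct' : Continuous fun p : ℝ × USphere d => circleAct p.1 p.2 := by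
  refine Continuous.subtype_mk ?_ _
  simp only [diagIsometry_const]
  fun_prop

lemma measurePreserving_circleAct [NeZero d] (θ : ℝ) :
    MeasurePreserving (circleAct θ) (sigma d) (sigma d) :=
  measurePreserving_sphereMap _

lemma integral_comp_of_measurePreserving {X Y : Type*} [TopologicalSpace Y]
    [MeasurableSpace X] [MeasurableSpace Y] [OpensMeasurableSpace Y] {μ : Measure X}
    {ν : Measure Y} {T : X → Y} (hT : MeasurePreserving T μ ν) {f : Y → ℂ} (hf : Continuous f) :
    ∫ x, f (T x) ∂μ = ∫ y, f y ∂ν := by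
  rw [← hT.map_eq]
  exact (integral_map hT.measurable.aemeasurable hf.measurable.aestronglyMeasurable).symm

/-- A measurable set whose preimages under almost all members of a family of measure preserving
maps have null fibres is null. -/
lemma measure_eq_zero_of_fibres {X : Type*} [MeasurableSpace X] {μ : Measure X} [SFinite μ]
    {ν : Measure ℝ} [SFinite ν] (hν : ν Set.univ ≠ 0) {T : X × ℝ → X} (hT : Measurable T)
    (hmp : ∀ θ, MeasurePreserving (fun x => T (x, θ)) μ μ) {B : Set X} (hB : MeasurableSet B)
    (h : ∀ x, ∀ᵐ θ ∂ν, T (x, θ) ∉ B) : μ B = 0 := by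
  have hm : MeasurableSet (T ⁻¹' B) := hT hB
  have h1 : (μ.prod ν) (T ⁻¹' B) = 0 := by
    rw [Measure.measure_prod_null hm]
    refine Eventually.of_forall fun x => ?_
    have h2 := h x
    rw [ae_iff] at h2
    simp only [not_not] at h2
    exact h2
  -- In the other order of integration every section has the measure of `B`.
  rw [Measure.prod_apply_symm hm] at h1
  have h2 : ∀ θ, μ ((fun x => (x, θ)) ⁻¹' (T ⁻¹' B)) = μ B := fun θ =>
    (hmp θ).measure_preimage hB.nullMeasurableSet
  simp only [h2, lintegral_const, mul_eq_zero] at h1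
  exact h1.resolve_right hν

/-- A measurable set whose intersection with every circle `{e^{iθ} η}` is null is null. -/
lemma sigma_eq_zero_of_slices [NeZero d] {B : Set (USphere d)} (hB : MeasurableSet B)
    (h : ∀ η : USphere d, ∀ᵐ θ : ℝ, circleAct θ η ∉ B) : sigma d B = 0 :=
  measure_eq_zero_of_fibres (ν := volume) (T := fun p : USphere d × ℝ => circleAct p.2 p.1)
    (by simp) continuous_circleAct.measurable measurePreserving_circleAct hB h

/-- Fubini's theorem and invariance under the circle action write the spherical mean as a mean of
circle means, which one-variable theory evaluates. -/
lemma two_pi_smul_integral_eq [NeZero d] {φ : USphere d → ℂ} (hφ : Continuous φ) :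
    (2 * Real.pi) • ∫ ζ, φ ζ ∂sigma d =
      ∫ ζ, (∫ θ in (0 : ℝ)..2 * Real.pi, φ (circleAct θ ζ)) ∂sigma d := by
  have hc : Continuous fun p : ℝ × USphere d => φ (circleAct p.1 p.2) :=
    hφ.comp continuous_circleAct'
  rw [← intervalIntegral_integral_swap]
  · have hrot : ∀ θ, ∫ ζ, φ (circleAct θ ζ) ∂sigma d = ∫ ζ, φ ζ ∂sigma d := fun θ =>
      integral_comp_of_measurePreserving (measurePreserving_circleAct θ) hφ
    simp only [hrot, intervalIntegral.integral_const, sub_zero]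
  · rw [Set.uIoc_of_le Real.two_pi_pos.le, ← Measure.restrict_univ (μ := sigma d),
      Measure.prod_restrict]
    refine (hc.continuousOn.integrableOn_compact
      ((isCompact_Icc (a := 0) (b := 2 * Real.pi)).prod (isCompact_univ (X := USphere d)))).mono_set ?_
    exact Set.prod_mono Set.Ioc_subset_Icc_self subset_rfl

/-- The mean value property on spheres. -/
lemma integral_sphere_eq [NeZero d] {h : Cn d → ℂ} (hh : DifferentiableOn ℂ h (unitBall d)) {r : ℝ}
    (hr0 : 0 ≤ r) (hr : r < 1) : ∫ ζ : USphere d, h (r • (ζ : Cn d)) ∂sigma d = h 0 := by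
  have hmem : ∀ ζ : USphere d, r • (ζ : Cn d) ∈ unitBall d := fun ζ => by
    simp [norm_smul, abs_of_nonneg hr0, hr]
  have hcont : Continuous fun ζ : USphere d => h (r • (ζ : Cn d)) := by
    rw [← continuousOn_univ]
    exact hh.continuousOn.comp (by fun_prop) fun ζ _ => hmem ζ
  have hcirc : ∀ ζ : USphere d, ∫ θ in (0 : ℝ)..2 * Real.pi, h (r • (circleAct θ ζ : Cn d)) =
      (2 * Real.pi) • h 0 := by
    intro ζ
    have h1 : Real.circleAverage (fun w : ℂ => h (r • w • (ζ : Cn d))) 0 1 = h 0 := by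
      rw [DiffContOnCl.circleAverage]
      · simp
      · rw [abs_one]
        apply DifferentiableOn.diffContOnCl
        rw [closure_ball _ one_ne_zero]
        refine hh.comp (by fun_prop) fun w hw => ?_
        rw [mem_closedBall_zero_iff] at hw
        rw [mem_ball_zero_iff, norm_smul, norm_smul, norm_eq_of_mem_sphere, mul_one,
          Real.norm_of_nonneg hr0]
        exact (mul_le_of_le_one_right hr0 hw).trans_lt hr
    rw [Real.circleAverage] at h1
    rw [← h1, smul_smul, mul_inv_cancel₀ (by positivity), one_smul]
    congr 1
    ext θ
    simp only [coe_circleAct, circleMap, Complex.ofReal_one, one_mul, zero_add]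
  have h2 := two_pi_smul_integral_eq hcont
  simp only [hcirc, integral_const, probReal_univ, one_smul] at h2
  exact smul_right_injective ℂ (by positivity : (2 * Real.pi) ≠ 0) h2

end Surface

end SzegoBall
end

noncomputable section
namespace SzegoBall

/-! ### Radial limits of bounded holomorphic functions on the disc -/

/-- If `G` is Lipschitz, holomorphic in the disc, and `o(|w - ζ|)` along the circle, then it is
`o(|z - ζ|)` in the disc. -/
lemma isLittleO_disc_of_circle {G : ℂ → ℂ} {M : ℝ} {ζ : ℂ} (hζ : ‖ζ‖ = 1)
    (hd : DiffContOnCl ℂ G (Metric.ball 0 1)) (hM : ∀ w, ‖G w‖ ≤ M * ‖w - ζ‖) {ε ρ : ℝ}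
    (hε : 0 < ε) (hρ : 0 < ρ) (h : ∀ w, ‖w‖ = 1 → ‖w - ζ‖ < ρ → ‖G w‖ ≤ ε * ‖w - ζ‖) :
    ∃ δ > 0, ∀ z ∈ Metric.ball (0 : ℂ) 1, ‖z - ζ‖ < δ → ‖G z‖ ≤ 2 * ε * ‖z - ζ‖ := by
  have hM0 : 0 ≤ M := by
    have h1 := (norm_nonneg _).trans (hM 0)
    rwa [zero_sub, norm_neg, hζ, mul_one] at h1
  -- The function `(ζ + w) / 2` peaks at `ζ`; the parallelogram law measures its decay away from
  -- `ζ`.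
  have hpar : ∀ w : ℂ, ‖w‖ ≤ 1 → ‖(ζ + w) / 2‖ ^ 2 ≤ 1 - ‖w - ζ‖ ^ 2 / 4 := by
    intro w hw
    have h1 := parallelogram_law_with_norm ℝ ζ w
    rw [norm_sub_rev] at h1
    rw [norm_div, Complex.norm_two]
    nlinarith [norm_nonneg w]
  -- A high power of the peak function beats the Lipschitz constant where `‖w - ζ‖ ≥ ρ`. If `1 - ρ²
  -- / 4 < 0`, no point of the circle is that far from `ζ`.
  obtain ⟨N, hN⟩ : ∃ N : ℕ, M * (1 - ρ ^ 2 / 4) ^ N ≤ ε ∨ 1 - ρ ^ 2 / 4 < 0 := by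
    by_cases hq : 1 - ρ ^ 2 / 4 < 0
    · exact ⟨0, Or.inr hq⟩
    · have h1 := (tendsto_pow_atTop_nhds_zero_of_lt_one (not_lt.1 hq)
        (by nlinarith [sq_pos_of_pos hρ] : 1 - ρ ^ 2 / 4 < 1)).const_mul M
      rw [mul_zero] at h1
      obtain ⟨N, hN⟩ := (h1.eventually (gt_mem_nhds hε)).exists
      exact ⟨N, Or.inl hN.le⟩
  have hshift : ∀ w : ℂ, ‖w‖ ≤ 1 → ∀ τ : ℝ, 0 ≤ τ → ‖w - ζ‖ ≤ ‖w - (1 + τ : ℝ) * ζ‖ := by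
    intro w hw τ hτ
    have h1 : w - (1 + τ : ℝ) * ζ = (w - ζ) - (τ : ℝ) • ζ := by
      rw [Complex.real_smul]; push_cast; ring
    rw [h1]
    refine pow_le_pow_iff_left₀ (norm_nonneg _) (norm_nonneg _) two_ne_zero |>.1 ?_
    rw [norm_sub_sq_real (w - ζ), inner_smul_right, inner_sub_left, real_inner_self_eq_norm_sq, hζ]
    have h2 : inner ℝ w ζ ≤ 1 := (real_inner_le_norm _ _).trans (by rw [hζ, mul_one]; exact hw)
    nlinarith [sq_nonneg ‖τ • ζ‖, mul_nonneg hτ (sub_nonneg.2 h2)]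
  -- Maximum principle for `G(w) / (w - (1 + τ) ζ)` times the power of the peak function. The pole
  -- is moved outside the closed disc to keep the quotient continuous up to the boundary; `τ` tends
  -- to `0` afterwards.
  have key : ∀ τ : ℝ, 0 < τ → ∀ z ∈ Metric.ball (0 : ℂ) 1,
      ‖G z‖ * ‖(ζ + z) / 2‖ ^ (2 * N) ≤ ε * ‖z - (1 + τ : ℝ) * ζ‖ := by
    intro τ hτ z hz
    have hne : ∀ w : ℂ, ‖w‖ ≤ 1 → w - (1 + τ : ℝ) * ζ ≠ 0 := by
      intro w hw h0
      have h1 := congrArg norm (sub_eq_zero.1 h0)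
      rw [norm_mul, hζ, Complex.norm_real, mul_one, Real.norm_of_nonneg (by linarith)] at h1
      linarith
    have hd' : DiffContOnCl ℂ (fun w => G w * (w - (1 + τ : ℝ) * ζ)⁻¹ * ((ζ + w) / 2) ^ (2 * N))
        (Metric.ball 0 1) := by
      have h1 : DiffContOnCl ℂ (fun w => (w - (1 + τ : ℝ) * ζ)⁻¹) (Metric.ball 0 1) := by
        refine DiffContOnCl.inv ?_ fun w hw => hne w ?_
        · exact Differentiable.diffContOnCl (by fun_prop)
        · rw [closure_ball _ one_ne_zero] at hw
          simpa using hw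
      have h2 : DiffContOnCl ℂ (fun w => ((ζ + w) / 2) ^ (2 * N)) (Metric.ball 0 1) :=
        Differentiable.diffContOnCl (by fun_prop)
      simpa only [smul_eq_mul, mul_assoc] using hd.smul (h1.smul h2)
    have hmax := Complex.norm_le_of_forall_mem_frontier_norm_le Metric.isBounded_ball hd'
      (C := ε) (fun w hw => ?_) (subset_closure hz)
    · rw [norm_mul, norm_mul, norm_inv, norm_pow] at hmax
      have hz' : ‖z‖ ≤ 1 := by simpa using (mem_ball_zero_iff.1 hz).le
      have hpos := norm_pos_iff.2 (hne z hz')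
      rw [mul_right_comm, ← div_eq_mul_inv, div_le_iff₀ hpos] at hmax
      exact hmax
    · rw [frontier_ball _ one_ne_zero, mem_sphere_zero_iff_norm] at hw
      have hpos := norm_pos_iff.2 (hne w hw.le)
      rw [norm_mul, norm_mul, norm_inv, norm_pow, mul_right_comm, ← div_eq_mul_inv,
        div_le_iff₀ hpos, pow_mul]
      have h2 := hpar w hw.le
      have h3 := hshift w hw.le τ hτ.le
      have h4 : (‖(ζ + w) / 2‖ ^ 2) ^ N ≤ 1 := pow_le_one₀ (by positivity) (by
        nlinarith [norm_nonneg (w - ζ)])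
      rcases lt_or_ge ‖w - ζ‖ ρ with hlt | hge
      · calc ‖G w‖ * (‖(ζ + w) / 2‖ ^ 2) ^ N ≤ ‖G w‖ * 1 := by gcongr
          _ ≤ ε * ‖w - ζ‖ := by rw [mul_one]; exact h w hw hlt
          _ ≤ _ := by gcongr
      · have h5 : ‖(ζ + w) / 2‖ ^ 2 ≤ 1 - ρ ^ 2 / 4 := h2.trans (by gcongr)
        rcases hN with hN | hN
        · calc ‖G w‖ * (‖(ζ + w) / 2‖ ^ 2) ^ N
              ≤ (M * ‖w - ζ‖) * (1 - ρ ^ 2 / 4) ^ N := by gcongr; exact hM w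
            _ = M * (1 - ρ ^ 2 / 4) ^ N * ‖w - ζ‖ := by ring
            _ ≤ ε * ‖w - (1 + τ : ℝ) * ζ‖ := by gcongr
        · exact absurd (h5.trans_lt hN) (not_lt.2 (sq_nonneg _))
  have key' : ∀ z ∈ Metric.ball (0 : ℂ) 1, ‖G z‖ * ‖(ζ + z) / 2‖ ^ (2 * N) ≤ ε * ‖z - ζ‖ := by
    intro z hz
    have hc : Continuous fun τ : ℝ => ε * ‖z - (1 + τ : ℝ) * ζ‖ := by fun_prop
    have h1 := (hc.tendsto 0).mono_left (nhdsWithin_le_nhds (s := Set.Ioi 0))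
    simp only [add_zero, Complex.ofReal_one, one_mul] at h1
    exact ge_of_tendsto h1 (eventually_nhdsWithin_of_forall fun τ hτ => key τ hτ z hz)
  -- Near `ζ` the peak factor exceeds `1/2`, whence the factor `2` in the conclusion.
  have hc : Continuous fun z : ℂ => ‖(ζ + z) / 2‖ ^ (2 * N) := by fun_prop
  have h1 := hc.tendsto ζ
  rw [add_self_div_two, hζ, one_pow] at h1
  obtain ⟨δ, hδ, hδ'⟩ := Metric.eventually_nhds_iff.1
    (h1.eventually (lt_mem_nhds (by norm_num : (1 / 2 : ℝ) < 1)))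
  refine ⟨δ, hδ, fun z hz hzd => ?_⟩
  have h2 := hδ' (by rwa [dist_eq_norm] : dist z ζ < δ)
  have h3 := key' z hz
  nlinarith [norm_nonneg (G z)]

/-- Turns a derivative in the angle into a bound by the chord: `θ + Im log (w / ζ)` is a local
inverse of `circleMap` on the circle, and it differs from `θ` by `O(|w - ζ|)`. -/
lemma isLittleO_circle_of_hasDerivAt {G : ℂ → ℂ} {θ : ℝ}
    (h0 : G (circleMap 0 1 θ) = 0) (h : HasDerivAt (fun t => G (circleMap 0 1 t)) 0 θ) {ε : ℝ}
    (hε : 0 < ε) : ∃ ρ > 0, ∀ w, ‖w‖ = 1 → ‖w - circleMap 0 1 θ‖ < ρ →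
      ‖G w‖ ≤ ε * ‖w - circleMap 0 1 θ‖ := by
  set ζ := circleMap 0 1 θ with hζdef
  have hζ : ‖ζ‖ = 1 := by simp [ζ]
  have hζ0 : ζ ≠ 0 := norm_ne_zero_iff.1 (by rw [hζ]; norm_num)
  have hlog : HasDerivAt (fun w : ℂ => Complex.log (w / ζ)) (1 / ζ) ζ := by
    have h1 : HasDerivAt (fun w : ℂ => w / ζ) (1 / ζ) ζ := (hasDerivAt_id ζ).div_const ζ
    have h2 := h1.clog (by rw [div_self hζ0]; exact Complex.one_mem_slitPlane)
    simpa [div_self hζ0] using h2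
  have hO : (fun w => θ + (Complex.log (w / ζ)).im - θ) =O[𝓝 ζ] fun w => w - ζ := by
    have h1 := hlog.isBigO_sub
    simp only [div_self hζ0, Complex.log_one, sub_zero] at h1
    refine (Asymptotics.isBigO_of_le _ fun w => ?_).trans h1
    rw [add_sub_cancel_left]
    exact Complex.abs_im_le_norm _
  have ht : Tendsto (fun w => θ + (Complex.log (w / ζ)).im) (𝓝 ζ) (𝓝 θ) := by
    have h1 := (Complex.continuous_im.tendsto _).comp hlog.continuousAt.tendsto
    simpa [div_self hζ0] using h1.const_add θ
  have ho := h.isLittleO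
  simp only [← hζdef, h0, smul_zero, sub_zero] at ho
  have h1 := ((ho.comp_tendsto ht).trans_isBigO hO).def hε
  obtain ⟨ρ, hρ, h2⟩ := Metric.eventually_nhds_iff.1 h1
  refine ⟨ρ, hρ, fun w hw hwd => ?_⟩
  have h3 := h2 (by rwa [dist_eq_norm] : dist w ζ < ρ)
  have hw0 : w ≠ 0 := norm_ne_zero_iff.1 (by rw [hw]; norm_num)
  have h4 : circleMap 0 1 (θ + (Complex.log (w / ζ)).im) = w := by
    have h5 : ((Complex.log (w / ζ)).im : ℂ) * Complex.I = Complex.log (w / ζ) := by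
      apply Complex.ext <;> simp [Complex.log_re, hw, hζ]
    have h6 : circleMap 0 1 (θ + (Complex.log (w / ζ)).im) =
        ζ * Complex.exp ((Complex.log (w / ζ)).im * Complex.I) := by
      simp only [ζ, circleMap, Complex.ofReal_one, one_mul, zero_add, Complex.ofReal_add, add_mul,
        Complex.exp_add]
    rw [h6, h5, Complex.exp_log (div_ne_zero hw0 hζ0), mul_div_cancel₀ _ hζ0]
  simpa only [Function.comp_apply, h4] using h3

/-- **Fatou's theorem**: a bounded holomorphic function on the disc has radial limits almost
everywhere. -/
theorem exists_radial_limit_disc {f : ℂ → ℂ} (hf : DifferentiableOn ℂ f (Metric.ball 0 1)) {M : ℝ}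
    (hM : ∀ z ∈ Metric.ball (0 : ℂ) 1, ‖f z‖ ≤ M) :
    ∀ᵐ θ : ℝ, ∃ l, Tendsto (fun r : ℝ => f (r * circleMap 0 1 θ)) (𝓝[<] 1) (𝓝 l) := by
  -- A primitive of a bounded function is Lipschitz. Its extension to the plane is therefore
  -- differentiable along the circle at almost every angle, by Rademacher's theorem.
  obtain ⟨F₀, hF₀⟩ : ∃ F, ∀ z ∈ Metric.ball (0 : ℂ) 1, HasDerivAt F (f z) z :=
    hf.isExactOn_ball
  have hM0 : 0 ≤ M := (norm_nonneg _).trans (hM 0 (by simp))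
  lift M to NNReal using hM0
  have hL : LipschitzOnWith M F₀ (Metric.ball 0 1) :=
    (convex_ball (0 : ℂ) 1).lipschitzOnWith_of_nnnorm_hasDerivWithin_le
      (fun z hz => (hF₀ z hz).hasDerivWithinAt) fun z hz => hM z hz
  obtain ⟨F, hFL, hF⟩ := hL.extend_finite_dimension
  set K := lipschitzExtensionConstant ℂ * M with hK
  have hFd : ∀ z ∈ Metric.ball (0 : ℂ) 1, HasDerivAt F (f z) z := fun z hz =>
    (hF₀ z hz).congr_of_eventuallyEq
      (hF.symm.eventuallyEq_of_mem (Metric.isOpen_ball.mem_nhds hz))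
  have hlip := hFL.comp (lipschitzWith_circleMap 0 1)
  filter_upwards [hlip.ae_differentiableAt (μ := volume)] with θ hθ
  set ζ := circleMap 0 1 θ with hζdef
  have hζ : ‖ζ‖ = 1 := by simp [ζ]
  have hζ0 : ζ ≠ 0 := norm_ne_zero_iff.1 (by rw [hζ]; norm_num)
  -- The candidate for the radial limit is the derivative of the primitive along the circle divided
  -- by `dζ/dθ = iζ`.
  set A := deriv (F ∘ circleMap 0 1) θ / (ζ * Complex.I)
  refine ⟨A, ?_⟩
  set G : ℂ → ℂ := fun w => F w - F ζ - A * (w - ζ)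
  have hGderiv : HasDerivAt (fun t => G (circleMap 0 1 t)) 0 θ := by
    have h1 := (hθ.hasDerivAt.sub_const (F ζ)).fun_sub
      (((hasDerivAt_circleMap 0 1 θ).sub_const ζ).const_mul A)
    refine h1.congr_deriv ?_
    rw [← hζdef]
    simp only [A]
    rw [div_mul_cancel₀ _ (mul_ne_zero hζ0 Complex.I_ne_zero), sub_self]
  have hGd : ∀ z ∈ Metric.ball (0 : ℂ) 1, HasDerivAt G (f z - A) z := by
    intro z hz
    have h1 := ((hFd z hz).sub_const (F ζ)).fun_sub (((hasDerivAt_id z).sub_const ζ).const_mul A)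
    simpa using h1
  have hGc : DiffContOnCl ℂ G (Metric.ball 0 1) := by
    refine ⟨fun z hz => (hGd z hz).differentiableAt.differentiableWithinAt, ?_⟩
    have := hFL.continuous
    exact Continuous.continuousOn (by fun_prop)
  have hGM : ∀ w, ‖G w‖ ≤ (K + ‖A‖) * ‖w - ζ‖ := by
    intro w
    have h1 := hFL.dist_le_mul w ζ
    rw [dist_eq_norm, dist_eq_norm] at h1
    calc ‖G w‖ ≤ ‖F w - F ζ‖ + ‖A * (w - ζ)‖ := norm_sub_le _ _
      _ ≤ K * ‖w - ζ‖ + ‖A‖ * ‖w - ζ‖ := by rw [norm_mul]; gcongr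
      _ = _ := by ring
  rw [Metric.tendsto_nhds]
  intro ε hε
  -- Since `f - A = G'`, Cauchy's estimate applies on the disc of radius `(1 - r) / 2` about `rζ`.
  -- There `|w - ζ| ≤ (3/2)(1 - r)`, so with `ε / 7` the estimate gives `6ε / 7`.
  obtain ⟨ρ, hρ, h1⟩ := isLittleO_circle_of_hasDerivAt (by simp [G, ζ]) hGderiv
    (by positivity : 0 < ε / 7)
  obtain ⟨δ, hδ, h2⟩ := isLittleO_disc_of_circle hζ hGc hGM (by positivity) hρ h1
  have h3 : ∀ᶠ r : ℝ in 𝓝[<] 1, r ∈ Set.Ioo (max 0 (1 - δ / 2)) 1 :=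
    Ioo_mem_nhdsLT (max_lt one_pos (by linarith))
  filter_upwards [h3] with r hr
  have hr0 : 0 < r := (le_max_left _ _).trans_lt hr.1
  have hr1 : 1 - δ / 2 < r := (le_max_right _ _).trans_lt hr.1
  have hr2 := hr.2
  have hz : (r * ζ : ℂ) ∈ Metric.ball (0 : ℂ) 1 := by
    simp [hζ, abs_of_pos hr0, hr2]
  have hzζ : ‖r * ζ - ζ‖ = 1 - r := by
    rw [← sub_one_mul, norm_mul, hζ, mul_one, ← Complex.ofReal_one, ← Complex.ofReal_sub,
      Complex.norm_real, Real.norm_of_nonpos (by linarith)]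
    ring
  have hsub : Metric.closedBall (r * ζ : ℂ) ((1 - r) / 2) ⊆ Metric.ball 0 1 := by
    refine Metric.closedBall_subset_ball' ?_
    rw [dist_zero_right, norm_mul, hζ, Complex.norm_real, Real.norm_of_nonneg hr0.le]
    linarith
  have hcauchy := Complex.norm_deriv_le_of_forall_mem_sphere_norm_le (f := G) (c := r * ζ)
    (R := (1 - r) / 2) (C := 2 * (ε / 7) * (3 / 2 * (1 - r))) (by linarith)
    ((hGc.differentiableOn.mono hsub).diffContOnCl_ball subset_rfl) (fun w hw => ?_)
  · rw [(hGd _ hz).deriv] at hcauchy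
    rw [dist_eq_norm]
    refine hcauchy.trans_lt ?_
    rw [div_lt_iff₀ (by linarith)]
    nlinarith
  · have hw1 : ‖w - ζ‖ ≤ 3 / 2 * (1 - r) := by
      rw [mem_sphere_iff_norm] at hw
      calc ‖w - ζ‖ = ‖(w - r * ζ) + (r * ζ - ζ)‖ := by ring_nf
        _ ≤ ‖w - r * ζ‖ + ‖r * ζ - ζ‖ := norm_add_le _ _
        _ = 3 / 2 * (1 - r) := by rw [hw, hzζ]; ring
    refine (h2 w (hsub (Metric.sphere_subset_closedBall hw)) (by linarith)).trans ?_
    gcongr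

end SzegoBall
end

noncomputable section
namespace SzegoBall

/-! ### The nonisotropic metric on the sphere -/

section Nonisotropic

variable {d : ℕ}

lemma norm_one_sub_inner_comm {E : Type*} [NormedAddCommGroup E] [InnerProductSpace ℂ E] (x y : E) :
    ‖1 - inner ℂ x y‖ = ‖1 - inner ℂ y x‖ := by
  rw [← inner_conj_symm, ← RCLike.norm_conj]
  simp

lemma norm_sub_inner_smul_sq {E : Type*} [NormedAddCommGroup E] [InnerProductSpace ℂ E] {y : E}
    (hy : ‖y‖ = 1) (x : E) : ‖x - inner ℂ y x • y‖ ^ 2 = ‖x‖ ^ 2 - ‖inner ℂ y x‖ ^ 2 := by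
  rw [norm_sub_sq (𝕜 := ℂ), inner_smul_right, norm_smul, hy, ← inner_conj_symm x y,
    RCLike.mul_conj]
  norm_cast
  ring

lemma norm_sub_inner_smul_sq_le {E : Type*} [NormedAddCommGroup E] [InnerProductSpace ℂ E] {x y : E}
    (hx : ‖x‖ = 1) (hy : ‖y‖ = 1) :
    ‖x - inner ℂ y x • y‖ ^ 2 ≤ 2 * ‖1 - inner ℂ y x‖ := by
  rw [norm_sub_inner_smul_sq hy, hx]
  have h1 : ‖inner ℂ y x‖ ≤ 1 := by
    have := norm_inner_le_norm (𝕜 := ℂ) y x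
    rwa [hx, hy, one_mul] at this
  have h2 : 1 - ‖inner ℂ y x‖ ≤ ‖1 - inner ℂ y x‖ := by
    have := norm_sub_norm_le (1 : ℂ) (inner ℂ y x)
    rwa [norm_one] at this
  nlinarith [norm_nonneg (inner ℂ y x)]

/-- Decompose `x` and `z` along `y`. If `s` and `t` are the two roots on the right, the components
orthogonal to `y` have squared norms at most `2s²` and `2t²`, so the cross term is at most `2st` and
the total at most `(s + t)²`. -/
lemma sqrt_norm_one_sub_inner_triangle {E : Type*} [NormedAddCommGroup E] [InnerProductSpace ℂ E]
    {x y z : E} (hx : ‖x‖ = 1) (hy : ‖y‖ = 1) (hz : ‖z‖ = 1) :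
    √‖1 - inner ℂ x z‖ ≤ √‖1 - inner ℂ x y‖ + √‖1 - inner ℂ y z‖ := by
  rw [norm_one_sub_inner_comm x y]
  set a := inner ℂ y x with ha
  set b := inner ℂ y z with hb
  have h1 := norm_sub_inner_smul_sq_le hx hy
  have h2 := norm_sub_inner_smul_sq_le hz hy
  rw [← ha] at h1
  rw [← hb] at h2
  have hdecomp : 1 - inner ℂ x z = (1 - conj a) + conj a * (1 - b) -
      inner ℂ (x - a • y) (z - b • y) := by
    rw [inner_sub_left, inner_sub_right, inner_sub_right, inner_smul_left, inner_smul_left,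
      inner_smul_right, inner_smul_right, inner_self_eq_norm_sq_to_K, hy, ← hb,
      ← inner_conj_symm x y, ← ha]
    push_cast
    ring
  have ha1 : ‖a‖ ≤ 1 := by
    have := norm_inner_le_norm (𝕜 := ℂ) y x
    rwa [hx, hy, one_mul] at this
  set s := √‖1 - a‖
  set t := √‖1 - b‖
  have hs : s ^ 2 = ‖1 - a‖ := Real.sq_sqrt (norm_nonneg _)
  have ht : t ^ 2 = ‖1 - b‖ := Real.sq_sqrt (norm_nonneg _)
  have hs0 : 0 ≤ s := Real.sqrt_nonneg _
  have ht0 : 0 ≤ t := Real.sqrt_nonneg _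
  have h3 : ‖inner ℂ (x - a • y) (z - b • y)‖ ≤ 2 * (s * t) := by
    refine (norm_inner_le_norm _ _).trans (abs_le_of_sq_le_sq' ?_ (by positivity)).2
    rw [mul_pow, mul_pow, mul_pow, hs, ht]
    calc _ ≤ (2 * ‖1 - a‖) * (2 * ‖1 - b‖) := by gcongr
      _ = _ := by ring
  have h4 : ‖(1 : ℂ) - conj a‖ = ‖1 - a‖ := by
    rw [← RCLike.norm_conj (1 - a)]; simp
  apply Real.sqrt_le_iff.2 ⟨by positivity, ?_⟩
  calc ‖1 - inner ℂ x z‖ ≤ ‖(1 : ℂ) - conj a‖ + ‖conj a * (1 - b)‖ +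
        ‖inner ℂ (x - a • y) (z - b • y)‖ := by
        rw [hdecomp]
        exact (norm_sub_le _ _).trans (by gcongr; exact norm_add_le _ _)
    _ ≤ ‖1 - a‖ + 1 * ‖1 - b‖ + 2 * (s * t) := by
        rw [h4, norm_mul, RCLike.norm_conj]
        gcongr
    _ = (s + t) ^ 2 := by rw [← hs, ← ht]; ring

/-- The sphere with the nonisotropic metric `|1 - ⟨x, y⟩|^{1/2}`. -/
def NSphere (d : ℕ) : Type := USphere d

/-- The identity map to the sphere with the nonisotropic metric. -/
def toN : USphere d ≃ NSphere d := Equiv.refl _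

instance : PseudoMetricSpace (NSphere d) where
  dist x y := √‖1 - inner ℂ (toN.symm x : Cn d) (toN.symm y : Cn d)‖
  dist_self x := by simp [inner_self_eq_norm_sq_to_K]
  dist_comm x y := by rw [norm_one_sub_inner_comm]
  dist_triangle x y z := sqrt_norm_one_sub_inner_triangle (norm_eq_of_mem_sphere _)
    (norm_eq_of_mem_sphere _) (norm_eq_of_mem_sphere _)

instance : MeasurableSpace (NSphere d) := borel _

instance : BorelSpace (NSphere d) := ⟨rfl⟩

lemma dist_toN (x y : USphere d) : dist (toN x) (toN y) = √‖1 - inner ℂ (x : Cn d) (y : Cn d)‖ := rfl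

lemma dist_toN_sq_le (x y : USphere d) : dist (toN x) (toN y) ^ 2 ≤ dist x y := by
  rw [dist_toN, Real.sq_sqrt (norm_nonneg _)]
  have h : (1 : ℂ) - inner ℂ (x : Cn d) (y : Cn d) = inner ℂ (x : Cn d) ((x : Cn d) - y) := by
    rw [inner_sub_right, inner_self_eq_norm_sq_to_K, norm_eq_of_mem_sphere]
    simp
  rw [h, Subtype.dist_eq, dist_eq_norm]
  refine (norm_inner_le_norm _ _).trans ?_
  rw [norm_eq_of_mem_sphere, one_mul]

lemma dist_sq_le_toN (x y : USphere d) : dist x y ^ 2 ≤ 2 * dist (toN x) (toN y) ^ 2 := by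
  rw [dist_toN, Real.sq_sqrt (norm_nonneg _), Subtype.dist_eq, dist_eq_norm,
    norm_sub_sq (𝕜 := ℂ), norm_eq_of_mem_sphere, norm_eq_of_mem_sphere]
  have h := Complex.re_le_norm (1 - inner ℂ (x : Cn d) (y : Cn d))
  rw [Complex.sub_re, Complex.one_re] at h
  change 1 ^ 2 - 2 * (inner ℂ (x : Cn d) (y : Cn d)).re + 1 ^ 2 ≤ _
  linarith

/-- The two metrics on the sphere induce the same topology. -/
def homeoN : USphere d ≃ₜ NSphere d where
  toEquiv := toN
  continuous_toFun := by
    rw [Metric.continuous_iff]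
    intro x ε hε
    refine ⟨ε ^ 2, by positivity, fun y hy => ?_⟩
    exact lt_of_pow_lt_pow_left₀ 2 hε.le ((dist_toN_sq_le y x).trans_lt hy)
  continuous_invFun := by
    rw [Metric.continuous_iff]
    intro x ε hε
    refine ⟨ε / 2, by positivity, fun y hy => ?_⟩
    refine lt_of_pow_lt_pow_left₀ 2 hε.le ((dist_sq_le_toN (toN.symm y) (toN.symm x)).trans_lt ?_)
    simp only [Equiv.apply_symm_apply]
    nlinarith [dist_nonneg (x := y) (y := x)]

instance : SecondCountableTopology (NSphere d) := homeoN.symm.secondCountableTopology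

/-- The surface measure on the sphere with the nonisotropic metric. -/
def sigmaN (d : ℕ) : Measure (NSphere d) := (sigma d).map toN

lemma measurableEmbedding_toN : MeasurableEmbedding (toN : USphere d → NSphere d) :=
  homeoN.measurableEmbedding

lemma sigmaN_apply (A : Set (NSphere d)) : sigmaN d A = sigma d (toN ⁻¹' A) :=
  measurableEmbedding_toN.map_apply _ _

instance [NeZero d] : IsProbabilityMeasure (sigmaN d) :=
  Measure.isProbabilityMeasure_map measurableEmbedding_toN.measurable.aemeasurable

/-- The nonisotropic ball `{η : |1 - ⟨x, η⟩| ≤ δ²}`. -/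
def nBall (x : USphere d) (δ : ℝ) : Set (USphere d) := toN ⁻¹' Metric.closedBall (toN x) δ

lemma mem_nBall {x η : USphere d} {δ : ℝ} (hδ : 0 ≤ δ) :
    η ∈ nBall x δ ↔ ‖1 - inner ℂ (x : Cn d) (η : Cn d)‖ ≤ δ ^ 2 := by
  rw [nBall, Set.mem_preimage, Metric.mem_closedBall, dist_comm, dist_toN, Real.sqrt_le_left hδ]

lemma measurableSet_nBall (x : USphere d) (δ : ℝ) : MeasurableSet (nBall x δ) :=
  measurableEmbedding_toN.measurable Metric.isClosed_closedBall.measurableSet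

/-- The nonisotropic box around a point of the sphere. -/
def box (x : USphere d) (δ : ℝ) : Set (Cn d) :=
  {z | ‖inner ℂ (x : Cn d) z - 1‖ < δ ^ 2 ∧ ‖z - inner ℂ (x : Cn d) z • (x : Cn d)‖ < δ}

/-- Doubling `δ` stretches the box by `4` in the direction of `x` and by `2` orthogonally to it. The
homothety of ratio `4` about `x` covers both, at the price `4^(2d) = 16^d`. -/
lemma volume_box_two_mul_le (x : USphere d) (δ : ℝ) :
    volume (box x (2 * δ)) ≤ ENNReal.ofReal (16 ^ d) * volume (box x δ) := by
  have hx : inner ℂ (x : Cn d) (x : Cn d) = 1 := by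
    rw [inner_self_eq_norm_sq_to_K, norm_eq_of_mem_sphere]; simp
  have h : box x (2 * δ) ⊆ AffineMap.homothety (x : Cn d) (4 : ℝ) '' box x δ := by
    rintro z ⟨h1, h2⟩
    refine ⟨AffineMap.homothety (x : Cn d) (4⁻¹ : ℝ) z, ?_, ?_⟩
    · have h3 : AffineMap.homothety (x : Cn d) (4⁻¹ : ℝ) z = (4⁻¹ : ℂ) • (z - x) + x := by
        rw [AffineMap.homothety_apply, vsub_eq_sub, vadd_eq_add, ← Complex.coe_smul]
        norm_num
      have h4 : inner ℂ (x : Cn d) ((4⁻¹ : ℂ) • (z - x) + x) - 1 =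
          (4⁻¹ : ℂ) * (inner ℂ (x : Cn d) z - 1) := by
        rw [inner_add_right, inner_smul_right, inner_sub_right, hx]; ring
      have h5 : (4⁻¹ : ℂ) • (z - x) + x -
          inner ℂ (x : Cn d) ((4⁻¹ : ℂ) • (z - x) + x) • (x : Cn d) =
          (4⁻¹ : ℂ) • (z - inner ℂ (x : Cn d) z • (x : Cn d)) := by
        rw [inner_add_right, inner_smul_right, inner_sub_right, hx]; module
      rw [h3]
      refine ⟨?_, ?_⟩
      · rw [h4, norm_mul, norm_inv, Complex.norm_ofNat]
        linarith
      · rw [h5, norm_smul, norm_inv, Complex.norm_ofNat]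
        linarith [norm_nonneg (z - inner ℂ (x : Cn d) z • (x : Cn d))]
    · simp [AffineMap.homothety_apply, smul_smul]
  refine (measure_mono h).trans ?_
  rw [Measure.addHaar_image_homothety, finrank_Cn, pow_mul]
  norm_num

lemma volume_box_mul_le (x : USphere d) (δ : ℝ) (k : ℕ) :
    volume (box x (2 ^ k * δ)) ≤ ENNReal.ofReal (16 ^ d) ^ k * volume (box x δ) := by
  induction k with
  | zero => simp
  | succ k ih =>
    rw [pow_succ', mul_assoc, pow_succ', mul_assoc]
    exact (volume_box_two_mul_le x _).trans (by gcongr)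

/-! ### Boxes, nonisotropic balls and the doubling property -/

lemma norm_sq_eq_inner_add {x : Cn d} (hx : ‖x‖ = 1) (z : Cn d) :
    ‖z‖ ^ 2 = ‖inner ℂ x z‖ ^ 2 + ‖z - inner ℂ x z • x‖ ^ 2 := by
  rw [norm_sub_inner_smul_sq hx]; ring

/-- The direction of a nonzero vector. -/
def direction (z : Cn d) (hz : z ≠ 0) : USphere d :=
  ⟨‖z‖⁻¹ • z, by
    rw [mem_sphere_zero_iff_norm, norm_smul, norm_inv, norm_norm,
      inv_mul_cancel₀ (norm_ne_zero_iff.2 hz)]⟩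

lemma norm_smul_direction (z : Cn d) (hz : z ≠ 0) : ‖z‖ • (direction z hz : Cn d) = z := by
  rw [direction, smul_smul, mul_inv_cancel₀ (norm_ne_zero_iff.2 hz), one_smul]

lemma norm_one_sub_inner_direction (x : Cn d) (z : Cn d) (hz : z ≠ 0) :
    ‖z‖ * ‖1 - inner ℂ x (direction z hz : Cn d)‖ = ‖(‖z‖ : ℂ) - inner ℂ x z‖ := by
  nth_rewrite 4 [← norm_smul_direction z hz]
  rw [← Complex.coe_smul, inner_smul_right, ← mul_one_sub, norm_mul, Complex.norm_real, norm_norm]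

/-- A point of the small box has norm within `δ² / 8` of `1`, so its direction stays close to `x`.
Together with `shell_subset_box` this traps the shell over a nonisotropic ball between boxes of
comparable size. -/
lemma box_subset_shell (x : USphere d) {δ : ℝ} (hδ0 : 0 < δ) (hδ : δ ≤ 1) :
    box x (δ / 4) ⊆ shell (nBall x δ) (1 - δ ^ 2) (1 + δ ^ 2) := by
  rintro z ⟨h1, h2⟩
  have hn := norm_sq_eq_inner_add (norm_eq_of_mem_sphere x) z
  set t := inner ℂ (x : Cn d) z
  have ht1 : ‖t‖ ≤ 1 + δ ^ 2 / 16 := by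
    have := norm_add_le (t - 1) 1
    rw [sub_add_cancel, norm_one] at this
    nlinarith
  have ht2 : 1 - δ ^ 2 / 16 ≤ ‖t‖ := by
    have := norm_sub_norm_le 1 (1 - t)
    rw [norm_one, sub_sub_cancel, norm_sub_rev] at this
    nlinarith
  have hδ2 : δ ^ 2 ≤ 1 := by nlinarith
  have hz1 : 1 - δ ^ 2 / 16 ≤ ‖z‖ := by
    refine ht2.trans (abs_le_of_sq_le_sq' ?_ (norm_nonneg _)).2
    rw [hn]; nlinarith [sq_nonneg ‖z - t • (x : Cn d)‖]
  have hz2 : ‖z‖ ≤ 1 + δ ^ 2 / 8 := by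
    refine (abs_le_of_sq_le_sq' ?_ (by positivity)).2
    rw [hn]
    have h3 : ‖z - t • (x : Cn d)‖ ^ 2 ≤ (δ / 4) ^ 2 := by gcongr
    have h4 : ‖t‖ ^ 2 ≤ (1 + δ ^ 2 / 16) ^ 2 := by gcongr
    nlinarith
  have hz0 : z ≠ 0 := norm_pos_iff.1 (by linarith)
  refine mem_shell.2 ⟨‖z‖, ⟨by nlinarith, by nlinarith [sq_pos_of_pos hδ0]⟩, direction z hz0, ?_,
    norm_smul_direction z hz0⟩
  rw [mem_nBall hδ0.le]
  have h5 := norm_one_sub_inner_direction (x : Cn d) z hz0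
  have h6 : ‖(‖z‖ : ℂ) - t‖ ≤ δ ^ 2 / 4 := by
    calc ‖(‖z‖ : ℂ) - t‖ = ‖((‖z‖ - 1 : ℝ) : ℂ) - (t - 1)‖ := by push_cast; ring_nf
      _ ≤ |‖z‖ - 1| + ‖t - 1‖ := by
        refine (norm_sub_le _ _).trans ?_
        rw [Complex.norm_real, Real.norm_eq_abs]
      _ ≤ δ ^ 2 / 8 + (δ / 4) ^ 2 := by
        gcongr
        rw [abs_le]; constructor <;> nlinarith [sq_nonneg δ]
      _ ≤ δ ^ 2 / 4 := by nlinarith [sq_nonneg δ]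
  rw [← h5] at h6
  nlinarith [norm_nonneg (1 - inner ℂ (x : Cn d) (direction z hz0 : Cn d))]

lemma shell_subset_box (x : USphere d) {δ : ℝ} (hδ0 : 0 < δ) (hδ : δ ≤ 1) :
    shell (nBall x δ) (1 - δ ^ 2) (1 + δ ^ 2) ⊆ box x (3 * δ) := by
  intro z hz
  obtain ⟨r, ⟨hr1, hr2⟩, η, hη, rfl⟩ := mem_shell.1 hz
  rw [mem_nBall hδ0.le] at hη
  have hδ2 : δ ^ 2 ≤ 1 := by nlinarith
  have hr0 : 0 ≤ r := by linarith
  have h1 := norm_sub_inner_smul_sq_le (norm_eq_of_mem_sphere η) (norm_eq_of_mem_sphere x)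
  have h2 : inner ℂ (x : Cn d) (r • (η : Cn d)) = r * inner ℂ (x : Cn d) (η : Cn d) := by
    rw [← Complex.coe_smul, inner_smul_right]
  have hpos := sq_pos_of_pos hδ0
  constructor
  · rw [h2]
    calc ‖(r : ℂ) * inner ℂ (x : Cn d) (η : Cn d) - 1‖
        = ‖((r - 1 : ℝ) : ℂ) - r * (1 - inner ℂ (x : Cn d) (η : Cn d))‖ := by push_cast; ring_nf
      _ ≤ |r - 1| + r * ‖1 - inner ℂ (x : Cn d) (η : Cn d)‖ := by
        refine (norm_sub_le _ _).trans ?_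
        rw [Complex.norm_real, Real.norm_eq_abs, norm_mul, Complex.norm_real,
          Real.norm_of_nonneg hr0]
      _ ≤ δ ^ 2 + 2 * δ ^ 2 := by
        gcongr
        · rw [abs_le]; constructor <;> linarith
        · linarith
      _ < (3 * δ) ^ 2 := by nlinarith
  · rw [h2, ← Complex.coe_smul, mul_smul, ← smul_sub, norm_smul, Complex.norm_real,
      Real.norm_of_nonneg hr0]
    refine lt_of_pow_lt_pow_left₀ 2 (by positivity) ?_
    rw [mul_pow]
    have h3 : r ^ 2 ≤ 2 ^ 2 := by gcongr; linarith
    calc _ ≤ 2 ^ 2 * (2 * δ ^ 2) := by gcongr; linarith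
      _ < (3 * δ) ^ 2 := by nlinarith

/-- Five doublings suffice because `3δ ≤ 2⁵ · δ / 8`. -/
lemma volume_shell_nBall_le (x : USphere d) {δ : ℝ} (hδ0 : 0 < δ) (hδ : δ ≤ 1) :
    volume (shell (nBall x δ) (1 - δ ^ 2) (1 + δ ^ 2)) ≤
      ENNReal.ofReal (16 ^ d) ^ 5 * volume (box x (δ / 8)) := by
  refine (measure_mono ((shell_subset_box x hδ0 hδ).trans ?_)).trans (volume_box_mul_le x (δ / 8) 5)
  rintro z ⟨h1, h2⟩
  exact ⟨h1.trans_le (by nlinarith), h2.trans_le (by linarith)⟩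

lemma sigma_nBall_two_mul_le [NeZero d] (x : USphere d) {δ : ℝ} (hδ0 : 0 < δ) (hδ : δ < 1 / 2) :
    sigma d (nBall x (2 * δ)) ≤ ENNReal.ofReal (16 ^ d) ^ 5 * sigma d (nBall x δ) := by
  have h1 := volume_shell_nBall_le x (by positivity : 0 < 2 * δ) (by linarith)
  have h2 := measure_mono (μ := volume) (box_subset_shell x hδ0 (by linarith))
  rw [volume_shell (measurableSet_nBall _ _) (by nlinarith) (by nlinarith)] at h1 h2
  set V := volume (unitBall d)
  have hV0 : V ≠ 0 := (Metric.measure_ball_pos _ _ one_pos).ne'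
  have hVt : V ≠ ∞ := measure_ball_lt_top.ne
  set m := ENNReal.ofReal ((1 + δ ^ 2) ^ (2 * d) - (1 - δ ^ 2) ^ (2 * d))
  -- The shell belonging to `2δ` is thicker than the one belonging to `δ`, so its thickness may be
  -- replaced by `m` on the smaller side of the estimate.
  have hm : m ≤ ENNReal.ofReal ((1 + (2 * δ) ^ 2) ^ (2 * d) - (1 - (2 * δ) ^ 2) ^ (2 * d)) := by
    apply ENNReal.ofReal_le_ofReal
    gcongr <;> nlinarith
  have hm0 : m ≠ 0 := by
    rw [Ne, ENNReal.ofReal_eq_zero, not_le, sub_pos]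
    exact pow_lt_pow_left₀ (by nlinarith) (by nlinarith) (by simp [NeZero.ne d])
  have h3 : m * V * sigma d (nBall x (2 * δ)) ≤
      m * V * (ENNReal.ofReal (16 ^ d) ^ 5 * sigma d (nBall x δ)) := by
    calc m * V * sigma d (nBall x (2 * δ)) = m * (V * sigma d (nBall x (2 * δ))) := by ring
      _ ≤ _ := (by gcongr : m * (V * sigma d (nBall x (2 * δ))) ≤ _ * (V * _)).trans h1
      _ ≤ ENNReal.ofReal (16 ^ d) ^ 5 * (m * (V * sigma d (nBall x δ))) := by
        rw [show 2 * δ / 8 = δ / 4 by ring]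
        gcongr
      _ = _ := by ring
  exact (ENNReal.mul_le_mul_iff_right (mul_ne_zero hm0 hV0)
    (ENNReal.mul_ne_top ENNReal.ofReal_ne_top hVt)).1 h3

instance [NeZero d] : IsUnifLocDoublingMeasure (sigmaN d) := by
  refine ⟨⟨Real.toNNReal (16 ^ d) ^ 5, ?_⟩⟩
  filter_upwards [Ioo_mem_nhdsGT (by norm_num : (0 : ℝ) < 1 / 2)] with δ hδ x
  rw [sigmaN_apply, sigmaN_apply]
  exact sigma_nBall_two_mul_le (toN.symm x) hδ.1 hδ.2

end Nonisotropic

end SzegoBall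
end

noncomputable section
namespace SzegoBall

/-! ### K-limits of bounded holomorphic functions -/

section KLimits

variable {d : ℕ}

/-- The mean value inequality over balanced sets. -/
lemma enorm_mul_volume_le {h : Cn d → ℂ} {U : Set (Cn d)} (hh : DifferentiableOn ℂ h U)
    {B : Set (Cn d)} (hB : MeasurableSet B) (hbal : ∀ c : ℂ, ‖c‖ ≤ 1 → ∀ u ∈ B, c • u ∈ B)
    {z : Cn d} (hz : ∀ u ∈ B, z + u ∈ U) {Φ : Cn d → ℝ≥0∞} (hΦ : Measurable Φ)
    (hle : ∀ u ∈ B, ‖h (z + u)‖ₑ ≤ Φ (z + u)) :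
    ‖h z‖ₑ * volume B ≤ ∫⁻ u in B, Φ (z + u) := by
  set I : Set ℝ := Set.Ioc 0 (2 * Real.pi)
  have hI : volume I = ENNReal.ofReal (2 * Real.pi) := by simp [I]
  have hI0 : volume I ≠ 0 := by rw [hI]; simp [Real.pi_pos]
  have hIt : volume I ≠ ∞ := by rw [hI]; exact ENNReal.ofReal_ne_top
  -- The mean value property on the disc of points `z + w u`, `|w| ≤ 1`, which stays in `U` because
  -- `B` is balanced.
  have hpt : ∀ u ∈ B, ‖h z‖ₑ * volume I ≤ ∫⁻ θ in I, Φ (z + circleMap 0 1 θ • u) := by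
    intro u hu
    have h1 : Real.circleAverage (fun w : ℂ => h (z + w • u)) 0 1 = h z := by
      rw [DiffContOnCl.circleAverage]
      · simp
      · rw [abs_one]
        apply DifferentiableOn.diffContOnCl
        rw [closure_ball _ one_ne_zero]
        refine hh.comp (by fun_prop) fun w hw => hz _ (hbal w ?_ u hu)
        simpa using hw
    rw [Real.circleAverage, intervalIntegral.integral_of_le Real.two_pi_pos.le] at h1
    have h2 : ‖h z‖ₑ * volume I = ‖∫ θ in I, h (z + circleMap 0 1 θ • u)‖ₑ := by
      rw [← h1, enorm_smul, hI, mul_right_comm, ← ofReal_norm,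
        ← ENNReal.ofReal_mul (norm_nonneg _), norm_inv, Real.norm_of_nonneg Real.two_pi_pos.le,
        inv_mul_cancel₀ Real.two_pi_pos.ne', ENNReal.ofReal_one, one_mul]
    rw [h2]
    refine (enorm_integral_le_lintegral_enorm _).trans (lintegral_mono fun θ => ?_)
    exact hle _ (hbal _ (by simp) u hu)
  have hmeas : Measurable fun p : Cn d × ℝ => Φ (z + circleMap 0 1 p.2 • p.1) := by
    refine hΦ.comp (Continuous.measurable ?_)
    have := continuous_circleMap 0 1
    fun_prop
  -- `B` is invariant under unimodular scalars, so averaging over the angle does not change the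
  -- integral over `B`.
  have hrot : ∀ θ : ℝ, ∫⁻ u in B, Φ (z + circleMap 0 1 θ • u) = ∫⁻ u in B, Φ (z + u) := by
    intro θ
    set L := diagIsometry (d := d) fun _ => Circle.exp θ
    have hL : ∀ u, L u = circleMap 0 1 θ • u := fun u => by
      simp [L, diagIsometry_const, circleMap]
    have hpre : L ⁻¹' B = B := by
      ext u
      rw [Set.mem_preimage, hL]
      constructor
      · intro hu
        have h1 := hbal (circleMap 0 1 θ)⁻¹ (by simp) _ hu
        rwa [smul_smul, inv_mul_cancel₀ (by simp), one_smul] at h1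
      · exact fun hu => hbal _ (by simp) _ hu
    have h1 := (L.measurePreserving.restrict_preimage hB).lintegral_comp
      (hΦ.comp (measurable_const_add z))
    rw [hpre] at h1
    simpa only [Function.comp_apply, hL] using h1
  have h3 : ‖h z‖ₑ * volume I * volume B ≤ volume I * ∫⁻ u in B, Φ (z + u) := by
    calc ‖h z‖ₑ * volume I * volume B = ∫⁻ _ in B, ‖h z‖ₑ * volume I := by simp
      _ ≤ ∫⁻ u in B, ∫⁻ θ in I, Φ (z + circleMap 0 1 θ • u) := setLIntegral_mono' hB hpt
      _ = ∫⁻ θ in I, ∫⁻ u in B, Φ (z + circleMap 0 1 θ • u) :=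
        lintegral_lintegral_swap hmeas.aemeasurable
      _ = _ := by simp only [hrot, lintegral_const, Measure.restrict_apply_univ, mul_comm]
  rw [mul_right_comm, mul_comm] at h3
  exact (ENNReal.mul_le_mul_iff_right hI0 hIt).1 h3

/-- The balanced box at the origin. -/
def centredBox (x : USphere d) (δ : ℝ) : Set (Cn d) :=
  {u | ‖inner ℂ (x : Cn d) u‖ < δ ^ 2 ∧ ‖u - inner ℂ (x : Cn d) u • (x : Cn d)‖ < δ}

lemma isOpen_centredBox (x : USphere d) (δ : ℝ) : IsOpen (centredBox x δ) :=
  (isOpen_lt (f := fun u : Cn d => ‖inner ℂ (x : Cn d) u‖) (by fun_prop) continuous_const).inter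
    (isOpen_lt (f := fun u : Cn d => ‖u - inner ℂ (x : Cn d) u • (x : Cn d)‖) (by fun_prop)
      continuous_const)

lemma volume_centredBox (x : USphere d) (δ : ℝ) : volume (centredBox x δ) = volume (box x δ) := by
  have hx : inner ℂ (x : Cn d) (x : Cn d) = 1 := by
    rw [inner_self_eq_norm_sq_to_K, norm_eq_of_mem_sphere]; simp
  have h : centredBox x δ = (fun u => (x : Cn d) + u) ⁻¹' box x δ := by
    ext u
    simp only [centredBox, box, Set.mem_ofPred_eq, Set.mem_preimage, inner_add_right, hx,
      add_sub_cancel_left, add_smul, one_smul, add_sub_add_left_eq_sub]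
  rw [h, measure_preimage_add]

lemma smul_mem_centredBox (x : USphere d) {δ : ℝ} (c : ℂ) (hc : ‖c‖ ≤ 1) (u : Cn d)
    (hu : u ∈ centredBox x δ) : c • u ∈ centredBox x δ := by
  obtain ⟨h1, h2⟩ := hu
  constructor
  · rw [inner_smul_right, norm_mul]
    exact (mul_le_of_le_one_left (norm_nonneg _) hc).trans_lt h1
  · rw [inner_smul_right, mul_smul, ← smul_sub, norm_smul]
    exact (mul_le_of_le_one_left (norm_nonneg _) hc).trans_lt h2

/-- The box of the size of the distance to the sphere around an interior point lies in the ball and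
in a cone over a nonisotropic ball. -/
lemma add_centredBox (x : USphere d) {δ : ℝ} (hδ0 : 0 < δ) (hδ : δ ≤ 1) {u : Cn d}
    (hu : u ∈ centredBox x (δ / 8)) :
    ∃ r ∈ Set.Ioo (1 - δ ^ 2) 1, ∃ η ∈ nBall x δ,
      r • (η : Cn d) = (1 - δ ^ 2 / 4) • (x : Cn d) + u := by
  obtain ⟨h1, h2⟩ := hu
  have hx : inner ℂ (x : Cn d) (x : Cn d) = 1 := by
    rw [inner_self_eq_norm_sq_to_K, norm_eq_of_mem_sphere]; simp
  set s : ℝ := 1 - δ ^ 2 / 4 with hs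
  set z := s • (x : Cn d) + u with hz
  have hin : inner ℂ (x : Cn d) z = s + inner ℂ (x : Cn d) u := by
    rw [hz, inner_add_right, ← Complex.coe_smul, inner_smul_right, hx, mul_one]
  have horth : z - inner ℂ (x : Cn d) z • (x : Cn d) =
      u - inner ℂ (x : Cn d) u • (x : Cn d) := by
    rw [hin, hz, add_smul, Complex.coe_smul]
    abel
  have hn := norm_sq_eq_inner_add (norm_eq_of_mem_sphere x) z
  rw [horth, hin] at hn
  set t := inner ℂ (x : Cn d) u
  have hδ2 : δ ^ 2 ≤ 1 := by nlinarith
  have hpos := sq_pos_of_pos hδ0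
  have hs0 : 0 ≤ s := by linarith
  have hst1 : ‖(s : ℂ) + t‖ ≤ s + δ ^ 2 / 64 := by
    refine (norm_add_le _ _).trans ?_
    rw [Complex.norm_real, Real.norm_of_nonneg hs0]
    linarith
  have hst2 : s - δ ^ 2 / 64 ≤ ‖(s : ℂ) + t‖ := by
    have := norm_sub_norm_le (s : ℂ) (-t)
    rw [Complex.norm_real, Real.norm_of_nonneg hs0, norm_neg, sub_neg_eq_add] at this
    linarith
  have hz1 : s - δ ^ 2 / 64 ≤ ‖z‖ := by
    refine hst2.trans (abs_le_of_sq_le_sq' ?_ (norm_nonneg _)).2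
    rw [hn]; nlinarith [sq_nonneg ‖u - t • (x : Cn d)‖]
  have hz2 : ‖z‖ < 1 := by
    refine lt_of_pow_lt_pow_left₀ 2 zero_le_one ?_
    rw [hn]
    have h3 : ‖u - t • (x : Cn d)‖ ^ 2 ≤ (δ / 8) ^ 2 := by gcongr
    have h4 : ‖(s : ℂ) + t‖ ^ 2 ≤ (s + δ ^ 2 / 64) ^ 2 := by gcongr
    nlinarith
  have hz0 : z ≠ 0 := norm_pos_iff.1 (by linarith)
  refine ⟨‖z‖, ⟨by linarith, hz2⟩, direction z hz0, ?_, norm_smul_direction z hz0⟩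
  rw [mem_nBall hδ0.le]
  have h5 := norm_one_sub_inner_direction (x : Cn d) z hz0
  rw [hin] at h5
  have h6 : ‖(‖z‖ : ℂ) - (s + t)‖ ≤ 3 / 8 * δ ^ 2 := by
    calc ‖(‖z‖ : ℂ) - (s + t)‖ = ‖((‖z‖ - s : ℝ) : ℂ) - t‖ := by push_cast; ring_nf
      _ ≤ |‖z‖ - s| + ‖t‖ := by
        refine (norm_sub_le _ _).trans ?_
        rw [Complex.norm_real, Real.norm_eq_abs]
      _ ≤ δ ^ 2 / 4 + (δ / 8) ^ 2 := by
        gcongr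
        rw [abs_le]; constructor <;> linarith
      _ ≤ _ := by nlinarith
  rw [← h5] at h6
  nlinarith [norm_nonneg (1 - inner ℂ (x : Cn d) (direction z hz0 : Cn d))]

/-- The points of the sphere at which the radial oscillation of `f` beyond `s` is at most `ε`. -/
def oscSet (f : Cn d → ℂ) (ε s : ℝ) : Set (USphere d) :=
  {η | ∀ r ∈ Set.Ico s 1, ‖f (r • (η : Cn d)) - f (s • (η : Cn d))‖ ≤ ε}

lemma continuous_radial {f : Cn d → ℂ} (hf : ContinuousOn f (unitBall d)) {r : ℝ} (hr0 : 0 ≤ r)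
    (hr : r < 1) : Continuous fun η : USphere d => f (r • (η : Cn d)) := by
  rw [← continuousOn_univ]
  refine hf.comp (by fun_prop) fun η _ => ?_
  simp [norm_smul, abs_of_nonneg hr0, hr]

lemma isClosed_oscSet {f : Cn d → ℂ} (hf : ContinuousOn f (unitBall d)) (ε : ℝ) {s : ℝ}
    (hs0 : 0 ≤ s) (hs : s < 1) : IsClosed (oscSet f ε s) := by
  have h : oscSet f ε s = ⋂ r ∈ Set.Ico s 1,
      {η : USphere d | ‖f (r • (η : Cn d)) - f (s • (η : Cn d))‖ ≤ ε} := by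
    ext η; simp [oscSet]
  rw [h]
  refine isClosed_biInter fun r hr => isClosed_le ?_ continuous_const
  exact ((continuous_radial hf (hs0.trans hr.1) hr.2).sub (continuous_radial hf hs0 hs)).norm

/-- The key estimate: near the sphere, the oscillation of a bounded holomorphic function is
controlled by the density of the complement of `oscSet`. -/
lemma enorm_sub_le_of_nBall [NeZero d] {f : Cn d → ℂ} (hf : DifferentiableOn ℂ f (unitBall d)) {M : ℝ}
    (hM : ∀ z ∈ unitBall d, ‖f z‖ ≤ M) {ε s : ℝ} (hs0 : 0 ≤ s) (hs : s < 1)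
    (x : USphere d) {δ : ℝ} (hδ0 : 0 < δ) (hδ : δ < 1) (hδs : s ≤ 1 - δ ^ 2) {c : ℂ} (hc : ‖c‖ ≤ M)
    (hosc : ∀ η ∈ nBall x δ, ‖f (s • (η : Cn d)) - c‖ ≤ ε) :
    ‖f ((1 - δ ^ 2 / 4) • (x : Cn d)) - c‖ₑ ≤ ENNReal.ofReal (2 * ε) +
      ENNReal.ofReal (2 * M) * (ENNReal.ofReal (16 ^ d) ^ 5 *
        (sigma d (nBall x δ \ oscSet f ε s) / sigma d (nBall x δ))) := by
  set Q := nBall x δ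
  set E := oscSet f ε s
  have hE : MeasurableSet E := (isClosed_oscSet hf.continuousOn ε hs0 hs).measurableSet
  have hQ : MeasurableSet Q := measurableSet_nBall x δ
  set z := (1 - δ ^ 2 / 4) • (x : Cn d)
  set B := centredBox x (δ / 8)
  set S := shell (Q \ E) (1 - δ ^ 2) (1 + δ ^ 2)
  set S' := toMeasurable volume S
  have hδ2 : δ ^ 2 < 1 := by nlinarith
  have hpos := sq_pos_of_pos hδ0
  -- On the box `|f - c|` is at most `2ε` at points whose direction lies in `E`, and at most `2M` at
  -- the others, which lie in `S`. The measurable hull of `S` makes `Φ` measurable.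
  set Φ : Cn d → ℝ≥0∞ := fun w => ENNReal.ofReal (2 * ε) +
    S'.indicator (fun _ => ENNReal.ofReal (2 * M)) w
  have hΦ : Measurable Φ := measurable_const.fun_add
    (measurable_const.indicator (measurableSet_toMeasurable _ _))
  have hball : ∀ u ∈ B, z + u ∈ unitBall d := by
    intro u hu
    obtain ⟨r, hr, η, -, h⟩ := add_centredBox x hδ0 hδ.le hu
    rw [← h, mem_ball_zero_iff, norm_smul, norm_eq_of_mem_sphere, mul_one,
      Real.norm_of_nonneg (by linarith [hr.1])]
    exact hr.2
  have hmain := enorm_mul_volume_le (h := fun w => f w - c) (hf.sub_const c)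
    (isOpen_centredBox x (δ / 8)).measurableSet (fun c hc u hu => smul_mem_centredBox x c hc u hu)
    hball hΦ (fun u hu => ?_)
  · set V := volume (unitBall d)
    have hV0 : V ≠ 0 := (Metric.measure_ball_pos _ _ one_pos).ne'
    have hVt : V ≠ ∞ := measure_ball_lt_top.ne
    set m := ENNReal.ofReal ((1 + δ ^ 2) ^ (2 * d) - (1 - δ ^ 2) ^ (2 * d))
    have hm0 : m ≠ 0 := by
      rw [Ne, ENNReal.ofReal_eq_zero, not_le, sub_pos]
      exact pow_lt_pow_left₀ (by linarith) (by linarith) (by simp [NeZero.ne d])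
    have hSv : volume S = m * (V * sigma d (Q \ E)) :=
      volume_shell (hQ.diff hE) (by linarith) (by linarith)
    have hQv : volume (shell Q (1 - δ ^ 2) (1 + δ ^ 2)) = m * (V * sigma d Q) :=
      volume_shell hQ (by linarith) (by linarith)
    have hBQ : m * (V * sigma d Q) ≤ ENNReal.ofReal (16 ^ d) ^ 5 * volume B := by
      rw [← hQv, volume_centredBox]
      exact volume_shell_nBall_le x hδ0 hδ.le
    have hB0 : volume B ≠ 0 := by
      refine (isOpen_centredBox x (δ / 8)).measure_ne_zero _ ⟨0, ?_⟩
      simp [centredBox, hδ0]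
    have hBt : volume B ≠ ∞ := by
      refine ((measure_mono ?_).trans_lt
        (measure_ball_lt_top (μ := volume) (x := (0 : Cn d)) (r := 2))).ne
      intro u hu
      have h1 := hball u hu
      rw [mem_ball_zero_iff] at h1 ⊢
      have h2 : ‖z‖ ≤ 1 := by
        rw [norm_smul, norm_eq_of_mem_sphere, mul_one, Real.norm_of_nonneg (by linarith)]
        linarith
      calc ‖u‖ = ‖(z + u) - z‖ := by rw [add_sub_cancel_left]
        _ ≤ ‖z + u‖ + ‖z‖ := norm_sub_le _ _
        _ < 2 := by linarith
    have hQ0 : sigma d Q ≠ 0 := by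
      intro h0
      have h1 := measure_mono (μ := volume) (box_subset_shell x hδ0 hδ.le)
      have h2 := volume_box_two_mul_le x (δ / 8)
      rw [hQv, h0, mul_zero, mul_zero, nonpos_iff_eq_zero] at h1
      refine hB0 (measure_mono_null ?_ (((volume_centredBox x (δ / 8)).trans ?_ : volume B = 0)))
      · exact subset_rfl
      · refine measure_mono_null ?_ h1
        rintro w ⟨h3, h4⟩
        exact ⟨h3.trans_le (by nlinarith), h4.trans_le (by linarith)⟩
    -- Shell volume is proportional to `sigma`, so the bad part of the box is controlled by the
    -- proportion of bad directions in the nonisotropic ball.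
    have hSB : volume S ≤ ENNReal.ofReal (16 ^ d) ^ 5 * (sigma d (Q \ E) / sigma d Q) * volume B := by
      calc volume S = m * (V * sigma d Q) * (sigma d (Q \ E) / sigma d Q) := by
            rw [hSv, mul_assoc, mul_assoc, ENNReal.mul_div_cancel hQ0 (measure_ne_top _ _)]
        _ ≤ ENNReal.ofReal (16 ^ d) ^ 5 * volume B * (sigma d (Q \ E) / sigma d Q) := by gcongr
        _ = _ := by ring
    have hint : ∫⁻ u in B, Φ (z + u) ≤ ENNReal.ofReal (2 * ε) * volume B +
        ENNReal.ofReal (2 * M) * volume S := by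
      simp only [Φ]
      rw [lintegral_add_left measurable_const, setLIntegral_const]
      gcongr
      calc ∫⁻ u in B, S'.indicator (fun _ => ENNReal.ofReal (2 * M)) (z + u)
          ≤ ∫⁻ u, S'.indicator (fun _ => ENNReal.ofReal (2 * M)) (z + u) := setLIntegral_le_lintegral _ _
        _ = ∫⁻ u, S'.indicator (fun _ => ENNReal.ofReal (2 * M)) u :=
          lintegral_add_left_eq_self (μ := volume) _ z
        _ = _ := by
          rw [lintegral_indicator_const (measurableSet_toMeasurable _ _), measure_toMeasurable]
    have h4 := hmain.trans (hint.trans (add_le_add_right (mul_le_mul_right hSB _) _))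
    rw [← mul_assoc, ← add_mul] at h4
    exact (ENNReal.mul_le_mul_iff_left hB0 hBt).1 h4
  · obtain ⟨r, hr, η, hη, h⟩ := add_centredBox x hδ0 hδ.le hu
    rw [← h]
    by_cases hηE : η ∈ E
    · refine le_trans ?_ le_self_add
      rw [← ofReal_norm]
      apply ENNReal.ofReal_le_ofReal
      calc ‖f (r • (η : Cn d)) - c‖
          ≤ ‖f (r • (η : Cn d)) - f (s • (η : Cn d))‖ + ‖f (s • (η : Cn d)) - c‖ :=
            norm_sub_le_norm_sub_add_norm_sub _ _ _
        _ ≤ ε + ε := add_le_add (hηE r ⟨by linarith [hr.1], hr.2⟩) (hosc η hη)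
        _ = 2 * ε := by ring
    · have hmem : r • (η : Cn d) ∈ S' := subset_toMeasurable _ _
        (mem_shell.2 ⟨r, ⟨hr.1.le, by linarith [hr.2]⟩, η, ⟨hη, hηE⟩, rfl⟩)
      simp only [Φ, Set.indicator_of_mem hmem]
      refine le_trans ?_ le_add_self
      rw [← ofReal_norm]
      apply ENNReal.ofReal_le_ofReal
      have h1 := hM _ (hball u hu)
      rw [← h] at h1
      linarith [norm_sub_le (f (r • (η : Cn d))) c]

/-- Fatou's theorem on the slices gives radial limits at almost every point of each circle, and the
Cauchy criterion puts such points into one of the sets. The sets are closed, so their union is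
measurable and the exceptional set can be tested on circles. -/
lemma ae_exists_mem_oscSet [NeZero d] {f : Cn d → ℂ} (hf : DifferentiableOn ℂ f (unitBall d))
    {M : ℝ} (hM : ∀ z ∈ unitBall d, ‖f z‖ ≤ M) {ε : ℝ} (hε : 0 < ε) :
    ∀ᵐ η : USphere d ∂sigma d, ∃ n : ℕ, η ∈ oscSet f ε (1 - 1 / ((n : ℝ) + 1)) := by
  have hs : ∀ n : ℕ, 0 ≤ 1 - 1 / ((n : ℝ) + 1) ∧ 1 - 1 / ((n : ℝ) + 1) < 1 := fun n => by
    have h1 : 1 / ((n : ℝ) + 1) ≤ 1 := by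
      rw [div_le_one (by positivity)]; linarith [n.cast_nonneg (α := ℝ)]
    have h2 : 0 < 1 / ((n : ℝ) + 1) := by positivity
    constructor <;> linarith
  have hmeas : MeasurableSet (⋃ n : ℕ, oscSet f ε (1 - 1 / ((n : ℝ) + 1))) :=
    MeasurableSet.iUnion fun n =>
      (isClosed_oscSet hf.continuousOn ε (hs n).1 (hs n).2).measurableSet
  have h := sigma_eq_zero_of_slices hmeas.compl fun η => ?_
  · rw [ae_iff]
    convert h using 2
    ext η
    simp
  · have hdisc : DifferentiableOn ℂ (fun w : ℂ => f (w • (η : Cn d))) (Metric.ball 0 1) := by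
      refine hf.comp (by fun_prop) fun w hw => ?_
      rw [mem_ball_zero_iff] at hw ⊢
      rwa [norm_smul, norm_eq_of_mem_sphere, mul_one]
    have hb : ∀ w ∈ Metric.ball (0 : ℂ) 1, ‖f (w • (η : Cn d))‖ ≤ M := fun w hw => by
      refine hM _ ?_
      rw [mem_ball_zero_iff] at hw ⊢
      rwa [norm_smul, norm_eq_of_mem_sphere, mul_one]
    filter_upwards [exists_radial_limit_disc hdisc hb] with θ ⟨l, hl⟩
    rw [Set.mem_compl_iff, not_not, Set.mem_iUnion]
    have heq : ∀ r : ℝ, f (r • (circleAct θ η : Cn d)) =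
        f ((r * circleMap 0 1 θ : ℂ) • (η : Cn d)) := fun r => by
      rw [coe_circleAct, ← Complex.coe_smul, smul_smul]
      simp [circleMap]
    have h1 := (Metric.tendsto_nhds.1 hl) (ε / 2) (by positivity)
    obtain ⟨a, ha, h2⟩ := (mem_nhdsLT_iff_exists_Ioo_subset).1 h1
    obtain ⟨n, hn⟩ := exists_nat_one_div_lt (sub_pos.2 (Set.mem_Iio.1 ha))
    refine ⟨n, fun r hr => ?_⟩
    rw [heq, heq]
    have h3 := h2 (⟨by linarith [hr.1], hr.2⟩ : r ∈ Set.Ioo a 1)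
    have h4 := h2 (⟨by linarith, (hs n).2⟩ : 1 - 1 / ((n : ℝ) + 1) ∈ Set.Ioo a 1)
    rw [← dist_eq_norm]
    refine (dist_triangle_right _ _ l).trans ?_
    have h3' := Set.mem_ofPred.1 h3
    have h4' := Set.mem_ofPred.1 h4
    linarith

/-- Lebesgue's density theorem for nonisotropic balls. -/
lemma ae_density [NeZero d] {E : Set (USphere d)} (hE : MeasurableSet E) :
    ∀ᵐ ζ ∂sigma d, ζ ∈ E → ∀ (K : ℕ) (w : Cn d → USphere d) (δ : Cn d → ℝ) (l : Filter (Cn d)),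
      Tendsto δ l (𝓝[>] 0) → (∀ᶠ z in l, ζ ∈ nBall (w z) (K * δ z)) →
      Tendsto (fun z => sigma d (nBall (w z) (δ z) \ E) / sigma d (nBall (w z) (δ z))) l (𝓝 0) := by
  set S : Set (NSphere d) := toN '' E
  have hS : MeasurableSet S := measurableEmbedding_toN.measurableSet_image' hE
  have h1 : ∀ᵐ ζ ∂sigma d, ∀ K : ℕ, toN ζ ∈ S → ∀ (w : Cn d → NSphere d) (δ : Cn d → ℝ)
      (l : Filter (Cn d)), Tendsto δ l (𝓝[>] 0) →
        (∀ᶠ z in l, toN ζ ∈ Metric.closedBall (w z) (K * δ z)) →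
          Tendsto (fun z => sigmaN d (S ∩ Metric.closedBall (w z) (δ z)) /
            sigmaN d (Metric.closedBall (w z) (δ z))) l (𝓝 1) := by
    -- The null set of the density theorem depends on `K`, and there are countably many of these.
    rw [ae_all_iff]
    intro K
    have h2 := IsUnifLocDoublingMeasure.ae_tendsto_measure_inter_div (sigmaN d) S K
    rw [ae_restrict_iff' hS] at h2
    filter_upwards [ae_of_ae_map measurableEmbedding_toN.measurable.aemeasurable h2] with ζ hζ hm w δ l
    exact hζ hm w δ
  filter_upwards [h1] with ζ hζ hmem K w δ l hδ hw
  have h2 := hζ K ⟨ζ, hmem, rfl⟩ (fun z => toN (w z)) δ l hδ hw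
  simp only [sigmaN_apply, Set.preimage_inter, S, toN.injective.preimage_image] at h2
  change Tendsto (fun z => sigma d (E ∩ nBall (w z) (δ z)) / sigma d (nBall (w z) (δ z))) l
    (𝓝 1) at h2
  have h3 := ENNReal.Tendsto.sub (tendsto_const_nhds (x := (1 : ℝ≥0∞)) (f := l)) h2
    (Or.inl ENNReal.one_ne_top)
  rw [tsub_self] at h3
  refine tendsto_of_tendsto_of_tendsto_of_le_of_le tendsto_const_nhds h3 (fun _ => zero_le)
    fun z => ?_
  have h4 : sigma d (nBall (w z) (δ z) \ E) / sigma d (nBall (w z) (δ z)) +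
      sigma d (E ∩ nBall (w z) (δ z)) / sigma d (nBall (w z) (δ z)) ≤ 1 := by
    rw [← ENNReal.add_div, Set.inter_comm, measure_sdiff_add_inter _ hE]
    exact ENNReal.div_self_le_one
  refine ENNReal.le_sub_of_add_le_right (ne_top_of_le_ne_top ENNReal.one_ne_top ?_) h4
  exact le_add_self.trans h4

/-! ### Korányi regions and the passage to K-limits -/

lemma koranyiRegion_subset {a : ℝ} (ha : 1 < a) (ζ : Cn d) : koranyiRegion a ζ ⊆ unitBall d := by
  intro z hz
  have h1 := (norm_nonneg _).trans_lt (show ‖1 - inner ℂ ζ z‖ < a / 2 * (1 - ‖z‖ ^ 2) from hz)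
  rw [mem_ball_zero_iff]
  have h2 : 0 < 1 - ‖z‖ ^ 2 := pos_of_mul_pos_right h1 (by linarith)
  nlinarith [norm_nonneg z]

lemma radial_mem_koranyiRegion {a : ℝ} (ha : 1 < a) (ζ : USphere d) :
    ∀ᶠ r : ℝ in 𝓝[<] 1, r • (ζ : Cn d) ∈ koranyiRegion a (ζ : Cn d) := by
  have h1 : max 0 (2 / a - 1) < 1 := max_lt one_pos (by
    rw [sub_lt_iff_lt_add, div_lt_iff₀ (by linarith)]; linarith)
  filter_upwards [Ioo_mem_nhdsLT h1] with r hr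
  have hr0 : 0 < r := (le_max_left _ _).trans_lt hr.1
  have hr1 : 2 / a - 1 < r := (le_max_right _ _).trans_lt hr.1
  have hr2 := hr.2
  change ‖1 - inner ℂ (ζ : Cn d) (r • (ζ : Cn d))‖ < a / 2 * (1 - ‖r • (ζ : Cn d)‖ ^ 2)
  rw [← Complex.coe_smul, inner_smul_right, inner_self_eq_norm_sq_to_K, norm_smul,
    norm_eq_of_mem_sphere, Complex.norm_real, Real.norm_of_nonneg hr0.le]
  have h2 : (1 : ℂ) - r * ((1 : ℝ) : ℂ) ^ 2 = ((1 - r : ℝ) : ℂ) := by push_cast; ring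
  change ‖(1 : ℂ) - r * ((1 : ℝ) : ℂ) ^ 2‖ < _
  rw [h2, Complex.norm_real, Real.norm_of_nonneg (by linarith)]
  rw [sub_lt_iff_lt_add, div_lt_iff₀ (by linarith)] at hr1
  nlinarith

lemma tendsto_radial_koranyiFilter (ζ : USphere d) :
    Tendsto (fun r : ℝ => r • (ζ : Cn d)) (𝓝[<] 1) (koranyiFilter (ζ : Cn d)) := by
  have h1 : Tendsto (fun r : ℝ => r • (ζ : Cn d)) (𝓝[<] 1) (𝓝 (ζ : Cn d)) := by
    have hc : Continuous fun r : ℝ => r • (ζ : Cn d) := by fun_prop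
    simpa using (hc.tendsto 1).mono_left nhdsWithin_le_nhds
  refine (tendsto_nhdsWithin_iff.2 ⟨h1, radial_mem_koranyiRegion one_lt_two ζ⟩).mono_right ?_
  exact le_iSup₂_of_le (f := fun a (_ : a ∈ Set.Ioi (1 : ℝ)) => 𝓝[koranyiRegion a (ζ : Cn d)] (ζ : Cn d))
    2 (Set.mem_Ioi.2 one_lt_two) le_rfl

instance (ζ : USphere d) : (koranyiFilter (ζ : Cn d)).NeBot :=
  (tendsto_radial_koranyiFilter ζ).neBot

lemma eventually_koranyiFilter {ζ : Cn d} {p : Cn d → Prop} :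
    (∀ᶠ z in koranyiFilter ζ, p z) ↔ ∀ a > 1, ∀ᶠ z in 𝓝[koranyiRegion a ζ] ζ, p z := by
  simp [koranyiFilter, Filter.eventually_iSup]

/-- Let `ζ` be a density point of an oscillation set. As `z` tends to `ζ` in a Korányi region, `ζ`
stays within a fixed multiple of the nonisotropic ball that is centred at the direction of `z` and
has radius comparable to `(1 - ‖z‖)^(1/2)`. The proportion of bad directions in it tends to `0`, and
`enorm_sub_le_of_nBall` leaves only the term `2ε`. -/
lemma eventually_norm_sub_le [NeZero d] {f : Cn d → ℂ} (hf : DifferentiableOn ℂ f (unitBall d))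
    {M : ℝ} (hM : ∀ z ∈ unitBall d, ‖f z‖ ≤ M) {ε : ℝ} (hε : 0 < ε) :
    ∀ᵐ ζ : USphere d ∂sigma d, ∃ c, ∀ᶠ z in koranyiFilter (ζ : Cn d), ‖f z - c‖ ≤ 3 * ε := by
  have hs : ∀ n : ℕ, 0 ≤ 1 - 1 / ((n : ℝ) + 1) ∧ 1 - 1 / ((n : ℝ) + 1) < 1 := fun n => by
    have h1 : 1 / ((n : ℝ) + 1) ≤ 1 := by
      rw [div_le_one (by positivity)]; linarith [n.cast_nonneg (α := ℝ)]
    have h2 : 0 < 1 / ((n : ℝ) + 1) := by positivity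
    constructor <;> linarith
  have hdens := ae_all_iff.2 fun n : ℕ =>
    ae_density (isClosed_oscSet hf.continuousOn ε (hs n).1 (hs n).2).measurableSet
  filter_upwards [ae_exists_mem_oscSet hf hM hε, hdens] with ζ ⟨n, hn⟩ hd
  replace hd := hd n hn
  set s := 1 - 1 / ((n : ℝ) + 1)
  obtain ⟨hs0, hs1⟩ : 0 ≤ s ∧ s < 1 := hs n
  refine ⟨f (s • (ζ : Cn d)), eventually_koranyiFilter.2 fun a ha => ?_⟩
  set l := 𝓝[koranyiRegion a (ζ : Cn d)] (ζ : Cn d)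
  set w : Cn d → USphere d := fun z => if h : z = 0 then ζ else direction z h
  -- Chosen so that `1 - δ z ^ 2 / 4 = ‖z‖`, which makes `z` the point at which the key estimate is
  -- evaluated.
  set δ : Cn d → ℝ := fun z => 2 * √(1 - ‖z‖)
  have hnorm : Tendsto (fun z : Cn d => ‖z‖) l (𝓝 1) := by
    have h1 := ((continuous_norm (E := Cn d)).tendsto (ζ : Cn d)).mono_left
      (nhdsWithin_le_nhds (s := koranyiRegion a (ζ : Cn d)))
    rwa [norm_eq_of_mem_sphere] at h1
  have hreg : ∀ᶠ z in l, z ∈ koranyiRegion a (ζ : Cn d) := eventually_mem_nhdsWithin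
  have hhalf : ∀ᶠ z in l, 1 / 2 < ‖z‖ := hnorm.eventually (lt_mem_nhds (by norm_num))
  have hsq : ∀ z : Cn d, ‖z‖ < 1 → δ z ^ 2 = 4 * (1 - ‖z‖) := fun z hz => by
    simp only [δ, mul_pow, Real.sq_sqrt (sub_nonneg.2 hz.le)]; norm_num
  have hδpos : ∀ z : Cn d, ‖z‖ < 1 → 0 < δ z := fun z hz => by
    have := Real.sqrt_pos.2 (sub_pos.2 hz)
    simp only [δ]; linarith
  have hδ0 : Tendsto δ l (𝓝 0) := by
    have h1 := ((hnorm.const_sub 1).sqrt).const_mul 2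
    simpa using h1
  have hδ : Tendsto δ l (𝓝[>] 0) := by
    refine tendsto_nhdsWithin_iff.2 ⟨hδ0, ?_⟩
    filter_upwards [hreg] with z hz
    exact hδpos z (mem_ball_zero_iff.1 (koranyiRegion_subset ha _ hz))
  set K : ℕ := ⌈a + 1⌉₊
  have hK : a + 1 ≤ K := Nat.le_ceil _
  have hw : ∀ᶠ z in l, ζ ∈ nBall (w z) (K * δ z) := by
    filter_upwards [hreg, hhalf] with z hz hz2
    have hz1 := mem_ball_zero_iff.1 (koranyiRegion_subset ha _ hz)
    have hz0 : z ≠ 0 := norm_pos_iff.1 (by linarith)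
    have hpos := hδpos z hz1
    rw [mem_nBall (by positivity), norm_one_sub_inner_comm, mul_pow, hsq z hz1]
    simp only [w, dif_neg hz0]
    have h1 := norm_one_sub_inner_direction (ζ : Cn d) z hz0
    have h2 : ‖(‖z‖ : ℂ) - inner ℂ (ζ : Cn d) z‖ ≤ (a + 1) * (1 - ‖z‖) := by
      have h3 : ‖1 - inner ℂ (ζ : Cn d) z‖ < a / 2 * (1 - ‖z‖ ^ 2) := hz
      calc ‖(‖z‖ : ℂ) - inner ℂ (ζ : Cn d) z‖
          = ‖(1 - inner ℂ (ζ : Cn d) z) - ((1 - ‖z‖ : ℝ) : ℂ)‖ := by push_cast; ring_nf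
        _ ≤ ‖1 - inner ℂ (ζ : Cn d) z‖ + (1 - ‖z‖) := by
          refine (norm_sub_le _ _).trans ?_
          rw [Complex.norm_real, Real.norm_of_nonneg (by linarith)]
        _ ≤ _ := by
          have h4 : 0 ≤ 1 - ‖z‖ := by linarith
          nlinarith [mul_nonneg (mul_nonneg (by linarith : 0 ≤ a) h4) h4]
    rw [← h1] at h2
    set y := ‖1 - inner ℂ (ζ : Cn d) (direction z hz0 : Cn d)‖
    have hy : y ≤ 2 * ((a + 1) * (1 - ‖z‖)) := by nlinarith [norm_nonneg (1 - inner ℂ (ζ : Cn d) (direction z hz0 : Cn d))]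
    have hK2 : a + 1 ≤ (K : ℝ) ^ 2 := by nlinarith
    nlinarith [mul_le_mul_of_nonneg_right hK2 (by linarith : 0 ≤ 1 - ‖z‖)]
  have hratio := hd K w δ l hδ hw
  have hlim : Tendsto (fun z => ENNReal.ofReal (2 * ε) + ENNReal.ofReal (2 * M) *
      (ENNReal.ofReal (16 ^ d) ^ 5 * (sigma d (nBall (w z) (δ z) \ oscSet f ε s) /
        sigma d (nBall (w z) (δ z))))) l (𝓝 (ENNReal.ofReal (2 * ε))) := by
    have h1 := (ENNReal.Tendsto.const_mul (a := ENNReal.ofReal (2 * M)) (ENNReal.Tendsto.const_mul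
      (a := ENNReal.ofReal (16 ^ d) ^ 5) hratio (Or.inr (by finiteness)))
      (Or.inr (by finiteness))).const_add (ENNReal.ofReal (2 * ε))
    simpa using h1
  obtain ⟨ρ, hρ, hρ'⟩ : ∃ ρ > 0, ∀ η : USphere d, dist (toN η) (toN ζ) < ρ →
      ‖f (s • (η : Cn d)) - f (s • (ζ : Cn d))‖ ≤ ε := by
    have hc : Continuous fun η : NSphere d => f (s • (homeoN.symm η : Cn d)) :=
      (continuous_radial hf.continuousOn hs0 hs1).comp homeoN.symm.continuous
    obtain ⟨ρ, hρ, h1⟩ := Metric.continuous_iff.1 hc (toN ζ) ε hε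
    exact ⟨ρ, hρ, fun η hη => by rw [← dist_eq_norm]; exact (h1 (toN η) hη).le⟩
  -- The three bounds keep the ball about `w z` within `ρ` of `ζ`, and give `δ z < 1` and `s ≤ 1 - δ
  -- z ^ 2`.
  have hsmall : ∀ᶠ z in l, δ z < min (ρ / (K + 2)) (min 1 (1 - s)) :=
    hδ0.eventually (gt_mem_nhds (by have := sub_pos.2 hs1; positivity))
  filter_upwards [hlim.eventually (gt_mem_nhds ((ENNReal.ofReal_lt_ofReal_iff (by positivity)).2
    (by linarith : 2 * ε < 3 * ε))), hreg, hhalf, hsmall, hw] with z hz1 hz2 hz3 hz4 hz5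
  have hzb := mem_ball_zero_iff.1 (koranyiRegion_subset ha _ hz2)
  have hz0 : z ≠ 0 := norm_pos_iff.1 (by linarith)
  have hpos := hδpos z hzb
  simp only [lt_min_iff] at hz4
  have hzeq : (1 - δ z ^ 2 / 4) • (w z : Cn d) = z := by
    rw [hsq z hzb]
    simp only [w, dif_neg hz0]
    nth_rewrite 3 [← norm_smul_direction z hz0]
    congr 1; ring
  have hs2 : s ≤ 1 - δ z ^ 2 := by nlinarith
  have hM0 : ‖f (s • (ζ : Cn d))‖ ≤ M := hM _ (by simp [norm_smul, abs_of_nonneg hs0, hs1])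
  have hest := enorm_sub_le_of_nBall hf hM hs0 hs1 (w z) hpos hz4.2.1 hs2 hM0 (fun η hη => hρ' η ?_)
  · rw [hzeq, ← ofReal_norm] at hest
    exact (ENNReal.ofReal_le_ofReal_iff (by positivity)).1 (hest.trans hz1.le)
  · have h1 : dist (toN η) (toN (w z)) ≤ δ z := hη
    have h2 : dist (toN ζ) (toN (w z)) ≤ K * δ z := hz5
    have h3 := dist_triangle_right (toN η) (toN ζ) (toN (w z))
    have h4 : δ z * (K + 2) < ρ := (lt_div_iff₀ (by positivity)).1 hz4.1
    nlinarith

/-- **Korányi's theorem**: a bounded holomorphic function on the ball has K-limits almost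
everywhere. -/
theorem ae_exists_kLimit [NeZero d] {f : Cn d → ℂ} (hf : DifferentiableOn ℂ f (unitBall d))
    {M : ℝ} (hM : ∀ z ∈ unitBall d, ‖f z‖ ≤ M) :
    ∀ᵐ ζ : USphere d ∂sigma d, ∃ c, Tendsto f (koranyiFilter (ζ : Cn d)) (𝓝 c) := by
  have h := ae_all_iff.2 fun n : ℕ =>
    eventually_norm_sub_le hf hM (by positivity : 0 < 1 / ((n : ℝ) + 1))
  filter_upwards [h] with ζ hζ
  apply cauchy_map_iff_exists_tendsto.1
  rw [Metric.cauchy_iff]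
  refine ⟨inferInstance, fun ε hε => ?_⟩
  obtain ⟨n, hn⟩ := exists_nat_one_div_lt (by positivity : 0 < ε / 7)
  obtain ⟨c, hc⟩ := hζ n
  refine ⟨_, image_mem_map hc, ?_⟩
  rintro _ ⟨x, hx, rfl⟩ _ ⟨y, hy, rfl⟩
  have h1 : ‖f x - c‖ ≤ 3 * (1 / ((n : ℝ) + 1)) := hx
  have h2 : ‖f y - c‖ ≤ 3 * (1 / ((n : ℝ) + 1)) := hy
  refine (dist_triangle_right _ _ c).trans_lt ?_
  rw [dist_eq_norm, dist_eq_norm]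
  linarith

end KLimits

end SzegoBall
end

noncomputable section
namespace SzegoBall

/-! ### Polynomial approximation of holomorphic functions on the ball -/

section Approximation

/-- The `k`-th Taylor coefficient at the origin. -/
def taylorCoeff (g : ℂ → ℂ) (k : ℕ) : ℂ := ((k.factorial : ℂ))⁻¹ * iteratedDeriv k g 0

lemma norm_taylorCoeff_le {g : ℂ → ℂ} {R₀ R M : ℝ}
    (hg : DifferentiableOn ℂ g (Metric.ball 0 R₀)) (hM : ∀ w ∈ Metric.ball (0 : ℂ) R₀, ‖g w‖ ≤ M)
    (hR : 0 < R) (hRR : R < R₀) (k : ℕ) : ‖taylorCoeff g k‖ ≤ M / R ^ k := by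
  have hsub : Metric.closedBall (0 : ℂ) R ⊆ Metric.ball 0 R₀ := Metric.closedBall_subset_ball hRR
  have h := Complex.norm_iteratedDeriv_le_of_forall_mem_sphere_norm_le k hR
    ((hg.mono hsub).diffContOnCl_ball subset_rfl)
    (fun z hz => hM z (hsub (Metric.sphere_subset_closedBall hz)))
  rw [taylorCoeff, norm_mul, norm_inv, Complex.norm_natCast, inv_mul_le_iff₀ (by positivity)]
  rwa [mul_div_assoc] at h

lemma norm_sub_taylor_le {g : ℂ → ℂ} {R₀ R M : ℝ}
    (hg : DifferentiableOn ℂ g (Metric.ball 0 R₀)) (hM : ∀ w ∈ Metric.ball (0 : ℂ) R₀, ‖g w‖ ≤ M)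
    (hR : 0 < R) (hRR : R < R₀) {w : ℂ} (hw : ‖w‖ < R) (n : ℕ) :
    ‖g w - ∑ k ∈ Finset.range n, w ^ k * taylorCoeff g k‖ ≤
      M * (‖w‖ / R) ^ n / (1 - ‖w‖ / R) := by
  have hsum := Complex.hasSum_taylorSeries_on_ball hg
    (z := w) (by rw [mem_ball_zero_iff]; linarith)
  have hsum' : HasSum (fun k => w ^ k * taylorCoeff g k) (g w) := by
    have h : (fun k => w ^ k * taylorCoeff g k) =
        fun k => ((k.factorial : ℂ))⁻¹ • (w - 0) ^ k • iteratedDeriv k g 0 := by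
      ext k
      simp only [taylorCoeff, sub_zero, smul_eq_mul]
      ring
    rwa [h]
  rw [norm_sub_rev]
  refine norm_sub_le_of_geometric_bound_of_hasSum (by rwa [div_lt_one hR]) (fun k => ?_) hsum' n
  rw [norm_mul, norm_pow, div_pow, mul_div_assoc']
  calc ‖w‖ ^ k * ‖taylorCoeff g k‖ ≤ ‖w‖ ^ k * (M / R ^ k) := by
        gcongr; exact norm_taylorCoeff_le hg hM hR hRR k
    _ = _ := by ring

/-- An entire function of polynomial growth is a polynomial. -/
lemma exists_polynomial_of_growth {g : ℂ → ℂ} (hg : Differentiable ℂ g) {C : ℝ} {k : ℕ}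
    (hC : ∀ t, ‖g t‖ ≤ C * (1 + ‖t‖) ^ k) :
    ∃ p : Polynomial ℂ, p.degree < (k + 1 : ℕ) ∧ ∀ t, g t = p.eval t := by
  refine ⟨∑ j ∈ Finset.range (k + 1), Polynomial.C (taylorCoeff g j) * Polynomial.X ^ j, ?_, ?_⟩
  · refine (Polynomial.degree_sum_le _ _).trans_lt ((Finset.sup_lt_iff (WithBot.bot_lt_coe _)).2 ?_)
    intro j hj
    refine (Polynomial.degree_C_mul_X_pow_le _ _).trans_lt ?_
    exact_mod_cast Finset.mem_range.1 hj
  · intro t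
    have hC0 : 0 ≤ C := by
      have := (norm_nonneg _).trans (hC 0)
      simpa using this
    rw [Polynomial.eval_finsetSum]
    simp only [Polynomial.eval_mul, Polynomial.eval_C, Polynomial.eval_pow, Polynomial.eval_X]
    rw [← sub_eq_zero, ← norm_le_zero_iff]
    -- On the disc of radius `2R` the function is at most `C (1 + 2R)^k`, so the Taylor remainder of
    -- order `k + 1` at the fixed point `t` is `O(1/R)`.
    have hbound : ∀ R : ℝ, 2 * ‖t‖ + 2 ≤ R →
        ‖g t - ∑ j ∈ Finset.range (k + 1), taylorCoeff g j * t ^ j‖ ≤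
          C * 4 ^ k * ‖t‖ ^ (k + 1) * 2 / R := by
      intro R hR
      have hR0 : 0 < R := by linarith [norm_nonneg t]
      have h1 := norm_sub_taylor_le (g := g) (R₀ := 2 * R) (R := R) (M := C * (1 + 2 * R) ^ k)
        hg.differentiableOn (fun w hw => (hC w).trans (by
          have := (mem_ball_zero_iff.1 hw).le
          gcongr)) hR0 (by linarith) (by linarith [norm_nonneg t]) (k + 1) (w := t)
      simp only [mul_comm (t ^ _)] at h1
      refine h1.trans ?_
      have h2 : ‖t‖ / R ≤ 1 / 2 := by rw [div_le_iff₀ hR0]; linarith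
      have h3 : 1 + 2 * R ≤ 4 * R := by linarith [norm_nonneg t]
      rw [div_le_iff₀ (by linarith)]
      calc C * (1 + 2 * R) ^ k * (‖t‖ / R) ^ (k + 1) ≤ C * (4 * R) ^ k * (‖t‖ / R) ^ (k + 1) := by
            gcongr
        _ = C * 4 ^ k * ‖t‖ ^ (k + 1) * 2 / R * (1 / 2) := by
            rw [mul_pow, div_pow]; field_simp; ring
        _ ≤ _ := by gcongr; linarith
    have hlim : Tendsto (fun R : ℝ => C * 4 ^ k * ‖t‖ ^ (k + 1) * 2 / R) atTop (𝓝 0) :=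
      tendsto_const_nhds.div_atTop tendsto_id
    exact ge_of_tendsto hlim ((eventually_ge_atTop _).mono hbound)

/-- A function on `ℂᵈ` that is a polynomial of bounded degree in every variable is a polynomial. -/
lemma exists_mvPolynomial_of_separately {d k : ℕ} {h : (Fin d → ℂ) → ℂ}
    (hp : ∀ (j : Fin d) (y : Fin d → ℂ), ∃ p : Polynomial ℂ, p.degree < (k + 1 : ℕ) ∧
      ∀ t, h (Function.update y j t) = p.eval t) :
    ∃ q : MvPolynomial (Fin d) ℂ, ∀ y, h y = MvPolynomial.eval y q := by
  -- Induction on the set of free variables, with the others frozen at `y₀`. A new variable is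
  -- released by Lagrange interpolation at the nodes `0, …, k`.
  have claim : ∀ (S : Finset (Fin d)) (y₀ : Fin d → ℂ), ∃ q : MvPolynomial (Fin d) ℂ,
      ∀ y, (∀ j ∉ S, y j = y₀ j) → h y = MvPolynomial.eval y q := by
    intro S
    induction S using Finset.induction_on with
    | empty =>
      intro y₀
      refine ⟨MvPolynomial.C (h y₀), fun y hy => ?_⟩
      rw [MvPolynomial.eval_C, funext fun j => hy j (Finset.notMem_empty j)]
    | insert j S hj ih =>
      intro y₀
      choose q hq using fun i : ℕ => ih (Function.update y₀ j (i : ℂ))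
      set v : ℕ → ℂ := fun i => (i : ℂ)
      refine ⟨∑ i ∈ Finset.range (k + 1),
        MvPolynomial.bind₁ (Function.update MvPolynomial.X j (MvPolynomial.C (i : ℂ))) (q i) *
          Polynomial.aeval (MvPolynomial.X j) (Lagrange.basis (Finset.range (k + 1)) v i),
        fun y hy => ?_⟩
      obtain ⟨p, hdeg, hp⟩ := hp j y
      have h1 := Lagrange.eq_interpolate_of_eval_eq (s := Finset.range (k + 1)) (v := v)
        (fun i => h (Function.update y j (i : ℂ))) (f := p)
        (fun a _ b _ hab => Nat.cast_injective hab) (by rwa [Finset.card_range])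
        (fun i _ => (hp i).symm)
      have h2 := hp (y j)
      rw [Function.update_eq_self] at h2
      rw [h2, h1, Lagrange.interpolate_apply, Polynomial.eval_finsetSum, map_sum]
      refine Finset.sum_congr rfl fun i _ => ?_
      have h3 : MvPolynomial.eval y (Polynomial.aeval (MvPolynomial.X j)
          (Lagrange.basis (Finset.range (k + 1)) v i)) =
          (Lagrange.basis (Finset.range (k + 1)) v i).eval (y j) := by
        have h6 : (MvPolynomial.eval y).comp MvPolynomial.C = RingHom.id ℂ := by ext; simp
        rw [Polynomial.aeval_def, Polynomial.hom_eval₂, MvPolynomial.algebraMap_eq, h6,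
          MvPolynomial.eval_X, Polynomial.eval₂_id]
      have h4 : MvPolynomial.eval y (MvPolynomial.bind₁
          (Function.update MvPolynomial.X j (MvPolynomial.C (i : ℂ))) (q i)) =
          MvPolynomial.eval (Function.update y j (i : ℂ)) (q i) := by
        have h5 : Function.update y j (i : ℂ) = fun l => MvPolynomial.eval y
            (Function.update MvPolynomial.X j (MvPolynomial.C (i : ℂ)) l) := by
          ext l
          by_cases hl : l = j
          · subst hl; simp
          · simp [hl]
        rw [h5]
        exact MvPolynomial.eval₂Hom_bind₁ (RingHom.id ℂ) y _ _
      rw [Polynomial.eval_mul, Polynomial.eval_C, map_mul, h3, h4, hq i]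
      intro l hl
      by_cases hlj : l = j
      · subst hlj; simp
      · simp only [Function.update_of_ne hlj]
        exact hy l (by simp [hl, hlj])
  obtain ⟨q, hq⟩ := claim Finset.univ 0
  exact ⟨q, fun y => hq y fun j hj => absurd (Finset.mem_univ j) hj⟩

/-! ### Homogeneous Taylor expansion on the ball -/

variable {d : ℕ}

/-- The homogeneous Taylor polynomial of degree `k`. -/
def taylorForm (F : Cn d → ℂ) (k : ℕ) (z : Cn d) : ℂ := taylorCoeff (fun w : ℂ => F (w • z)) k

variable {F : Cn d → ℂ} {M : ℝ}

lemma differentiableOn_slice (hF : DifferentiableOn ℂ F (unitBall d)) {z : Cn d} {R : ℝ}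
    (hz : R * ‖z‖ ≤ 1) :
    DifferentiableOn ℂ (fun w : ℂ => F (w • z)) (Metric.ball 0 R) ∧
      ∀ w ∈ Metric.ball (0 : ℂ) R, w • z ∈ unitBall d := by
  have h : ∀ w ∈ Metric.ball (0 : ℂ) R, w • z ∈ unitBall d := by
    intro w hw
    rw [mem_ball_zero_iff] at hw ⊢
    rw [norm_smul]
    rcases (norm_nonneg z).eq_or_lt with h0 | h0
    · rw [← h0]; simp
    · exact (mul_lt_mul_of_pos_right hw h0).trans_le hz
  exact ⟨hF.comp (by fun_prop) h, h⟩

lemma norm_taylorForm_le (hF : DifferentiableOn ℂ F (unitBall d)) (hM : ∀ z ∈ unitBall d, ‖F z‖ ≤ M)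
    (k : ℕ) (z : Cn d) : ‖taylorForm F k z‖ ≤ M * (2 * (1 + ‖z‖)) ^ k := by
  have hz := norm_nonneg z
  obtain ⟨h1, h2⟩ := differentiableOn_slice hF (z := z) (R := (1 + ‖z‖)⁻¹) (by
    rw [inv_mul_le_iff₀ (by positivity)]; linarith)
  refine (norm_taylorCoeff_le h1 (fun w hw => hM _ (h2 w hw)) (R := (2 * (1 + ‖z‖))⁻¹)
    (by positivity) (by gcongr; linarith) k).trans_eq ?_
  rw [inv_pow, div_inv_eq_mul]

/-- Slices through points of norm at most `ρ` are all bounded by `M` on the disc of radius `1 / (1 +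
ρ)`; half of this radius serves in the remainder estimate, which is thereby uniform in `z`. -/
lemma norm_sub_taylorForm_le (hF : DifferentiableOn ℂ F (unitBall d))
    (hM : ∀ z ∈ unitBall d, ‖F z‖ ≤ M) {z : Cn d} {ρ : ℝ} (hz : ‖z‖ ≤ ρ) {w : ℂ}
    (hw : ‖w‖ * (2 * (1 + ρ)) ≤ 1 / 2) (n : ℕ) :
    ‖F (w • z) - ∑ k ∈ Finset.range n, w ^ k * taylorForm F k z‖ ≤
      2 * M * (‖w‖ * (2 * (1 + ρ))) ^ n := by
  have hz0 := (norm_nonneg z).trans hz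
  have hM0 : 0 ≤ M := (norm_nonneg _).trans (hM 0 (by simp))
  obtain ⟨h1, h2⟩ := differentiableOn_slice hF (z := z) (R := (1 + ρ)⁻¹) (by
    rw [inv_mul_le_iff₀ (by positivity)]; linarith)
  have h3 := norm_sub_taylor_le h1 (fun w hw => hM _ (h2 w hw)) (R := (2 * (1 + ρ))⁻¹) (w := w)
    (by positivity) (by gcongr; linarith) (by
      rw [← one_div, lt_div_iff₀ (by positivity)]; linarith) n
  rw [div_inv_eq_mul] at h3
  refine h3.trans ?_
  rw [div_le_iff₀ (by linarith)]
  have : 0 ≤ M * (‖w‖ * (2 * (1 + ρ))) ^ n := by positivity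
  nlinarith

/-- The form of degree `k` is the locally uniform limit of `λ^(-k) (F(λz) - ∑_{j<k} λ^j F_j(z))` as
`λ → 0`, where the forms `F_j` of lower degree are holomorphic along lines by induction. -/
lemma differentiable_taylorForm (hF : DifferentiableOn ℂ F (unitBall d))
    (hM : ∀ z ∈ unitBall d, ‖F z‖ ≤ M) (z v : Cn d) (k : ℕ) :
    Differentiable ℂ fun t : ℂ => taylorForm F k (z + t • v) := by
  induction k using Nat.strong_induction_on with
  | _ k ih =>
    have hM0 : 0 ≤ M := (norm_nonneg _).trans (hM 0 (by simp))
    suffices h : ∀ T : ℝ, 0 < T →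
        DifferentiableOn ℂ (fun t : ℂ => taylorForm F k (z + t • v)) (Metric.ball 0 T) by
      intro t
      exact (h (‖t‖ + 1) (by positivity)).differentiableAt
        (Metric.isOpen_ball.mem_nhds (by simp))
    intro T hT
    set ρ := ‖z‖ + T * ‖v‖
    have hρ : ∀ t ∈ Metric.ball (0 : ℂ) T, ‖z + t • v‖ ≤ ρ := by
      intro t ht
      rw [mem_ball_zero_iff] at ht
      refine (norm_add_le _ _).trans ?_
      rw [norm_smul]
      simp only [ρ]
      gcongr
    have hρ0 : 0 ≤ ρ := by positivity
    set lam : ℕ → ℂ := fun n => ((n : ℂ) + 1)⁻¹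
    have hlam0 : ∀ n, lam n ≠ 0 := fun n => inv_ne_zero (Nat.cast_add_one_ne_zero n)
    have hlamn : ∀ n, ‖lam n‖ = 1 / ((n : ℝ) + 1) := fun n => by
      simp only [lam, norm_inv, one_div]
      congr 1
      exact_mod_cast Complex.norm_natCast (n + 1)
    have hlam : Tendsto (fun n => ‖lam n‖) atTop (𝓝 0) := by
      simp only [hlamn]
      exact tendsto_one_div_add_atTop_nhds_zero_nat
    have hsmall : ∀ᶠ n in atTop, ‖lam n‖ * (2 * (1 + ρ)) ≤ 1 / 2 := by
      have h1 := hlam.mul_const (2 * (1 + ρ))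
      rw [zero_mul] at h1
      exact (h1.eventually (gt_mem_nhds (by norm_num : (0 : ℝ) < 1 / 2))).mono fun _ h => h.le
    set ψ : ℕ → ℂ → ℂ := fun n t => (lam n ^ k)⁻¹ * (F (lam n • (z + t • v)) -
      ∑ j ∈ Finset.range k, lam n ^ j * taylorForm F j (z + t • v))
    have hunif : TendstoUniformlyOn ψ (fun t => taylorForm F k (z + t • v)) atTop
        (Metric.ball 0 T) := by
      rw [Metric.tendstoUniformlyOn_iff]
      intro ε hε
      have h1 := hlam.const_mul (2 * M * (2 * (1 + ρ)) ^ (k + 1))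
      rw [mul_zero] at h1
      filter_upwards [hsmall, h1.eventually (gt_mem_nhds hε)] with n hn hn2 t ht
      have h2 := norm_sub_taylorForm_le hF hM (hρ t ht) hn (k + 1)
      rw [Finset.sum_range_succ, ← sub_sub] at h2
      rw [dist_comm, dist_eq_norm]
      have h3 : ψ n t - taylorForm F k (z + t • v) = (lam n ^ k)⁻¹ *
          (F (lam n • (z + t • v)) - ∑ j ∈ Finset.range k, lam n ^ j * taylorForm F j (z + t • v) -
            lam n ^ k * taylorForm F k (z + t • v)) := by
        rw [mul_sub, inv_mul_cancel_left₀ (pow_ne_zero _ (hlam0 n))]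
      rw [h3, norm_mul, norm_inv, norm_pow]
      have h4 : 0 < ‖lam n‖ := norm_pos_iff.2 (hlam0 n)
      refine lt_of_le_of_lt ?_ hn2
      rw [inv_mul_le_iff₀ (by positivity)]
      refine h2.trans_eq ?_
      rw [mul_pow]
      ring
    refine hunif.tendstoLocallyUniformlyOn.differentiableOn ?_ Metric.isOpen_ball
    filter_upwards [hsmall] with n hn
    refine DifferentiableOn.const_mul (DifferentiableOn.sub ?_ ?_) _
    · refine hF.comp (by fun_prop) fun t ht => ?_
      rw [mem_ball_zero_iff, norm_smul]
      have h1 := hρ t ht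
      have h2 := norm_nonneg (lam n)
      nlinarith
    · exact DifferentiableOn.fun_sum fun j hj =>
        ((ih j (Finset.mem_range.1 hj)).differentiableOn).const_mul _

/-- In each variable the form is entire and grows at most like the `k`-th power, hence is a
polynomial of degree at most `k`. -/
lemma exists_mvPolynomial_taylorForm (hF : DifferentiableOn ℂ F (unitBall d))
    (hM : ∀ z ∈ unitBall d, ‖F z‖ ≤ M) (k : ℕ) :
    ∃ q : MvPolynomial (Fin d) ℂ, ∀ z : Cn d, taylorForm F k z = MvPolynomial.eval (fun i => z i) q := by
  have hM0 : 0 ≤ M := (norm_nonneg _).trans (hM 0 (by simp))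
  suffices h : ∀ (j : Fin d) (y : Fin d → ℂ), ∃ p : Polynomial ℂ, p.degree < (k + 1 : ℕ) ∧
      ∀ t, taylorForm F k (WithLp.toLp 2 (Function.update y j t)) = p.eval t by
    obtain ⟨q, hq⟩ := exists_mvPolynomial_of_separately
      (h := fun y : Fin d → ℂ => taylorForm F k (WithLp.toLp 2 y)) h
    exact ⟨q, fun z => hq (fun i => z i)⟩
  · intro j y
    have hupd : ∀ t, WithLp.toLp 2 (Function.update y j t) =
        WithLp.toLp 2 (Function.update y j 0) + t • EuclideanSpace.single j (1 : ℂ) := by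
      intro t
      ext i
      by_cases hi : i = j
      · subst hi; simp
      · simp [hi]
    suffices hg : ∀ t : ℂ, ‖taylorForm F k (WithLp.toLp 2 (Function.update y j 0) +
        t • EuclideanSpace.single j (1 : ℂ))‖ ≤
        M * (2 * (1 + ‖(WithLp.toLp 2 (Function.update y j 0) : Cn d)‖)) ^ k * (1 + ‖t‖) ^ k by
      obtain ⟨p, hp, hp'⟩ :=
        exists_polynomial_of_growth (differentiable_taylorForm hF hM _ _ k) hg
      exact ⟨p, hp, fun t => by rw [hupd t]; exact hp' t⟩
    intro t
    refine (norm_taylorForm_le hF hM k _).trans ?_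
    rw [mul_assoc, ← mul_pow]
    gcongr ?_ * ?_ ^ k
    have h1 := norm_add_le (WithLp.toLp 2 (Function.update y j 0) : Cn d)
      (t • EuclideanSpace.single j (1 : ℂ))
    rw [norm_smul, PiLp.norm_single, norm_one, mul_one] at h1
    nlinarith [norm_nonneg t, norm_nonneg (WithLp.toLp 2 (Function.update y j 0) : Cn d)]

/-- Dilations of bounded holomorphic functions are uniform limits of polynomials on the closed
ball. -/
theorem exists_mvPolynomial_approx (hF : DifferentiableOn ℂ F (unitBall d))
    (hM : ∀ z ∈ unitBall d, ‖F z‖ ≤ M) {r : ℝ} (hr0 : 0 ≤ r) (hr : r < 1) {ε : ℝ} (hε : 0 < ε) :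
    ∃ q : MvPolynomial (Fin d) ℂ, MvPolynomial.eval 0 q = F 0 ∧
      ∀ z : Cn d, ‖z‖ ≤ 1 → ‖F (r • z) - MvPolynomial.eval (fun i => z i) q‖ ≤ ε := by
  choose Q hQ using exists_mvPolynomial_taylorForm hF hM
  -- A radius strictly between `r` and `1` makes the expansion converge geometrically, uniformly in
  -- `z`.
  set R := (1 + r) / 2
  have hR : 0 < R := by positivity
  have hrR : r < R := by simp only [R]; linarith
  have hR1 : R < 1 := by simp only [R]; linarith
  have hlim : Tendsto (fun n => M * (r / R) ^ n / (1 - r / R)) atTop (𝓝 0) := by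
    have h1 := ((tendsto_pow_atTop_nhds_zero_of_lt_one (by positivity)
      ((div_lt_one hR).2 hrR)).const_mul M).div_const (1 - r / R)
    simpa using h1
  obtain ⟨n, hn⟩ := (hlim.eventually (gt_mem_nhds (half_pos hε))).exists
  set q₀ : MvPolynomial (Fin d) ℂ := ∑ k ∈ Finset.range n, MvPolynomial.C ((r : ℂ) ^ k) * Q k
  have hq₀ : ∀ z : Cn d, ‖z‖ ≤ 1 → ‖F (r • z) - MvPolynomial.eval (fun i => z i) q₀‖ ≤ ε / 2 := by
    intro z hz
    obtain ⟨h1, h2⟩ := differentiableOn_slice hF (z := z) (R := 1) (by linarith)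
    have hrn : ‖(r : ℂ)‖ = r := by rw [Complex.norm_real, Real.norm_of_nonneg hr0]
    have h3 := norm_sub_taylor_le h1 (fun w hw => hM _ (h2 w hw)) hR hR1 (w := (r : ℂ))
      (by rwa [hrn]) n
    rw [hrn, Complex.coe_smul] at h3
    have h4 : MvPolynomial.eval (fun i => z i) q₀ =
        ∑ k ∈ Finset.range n, (r : ℂ) ^ k * taylorCoeff (fun w : ℂ => F (w • z)) k := by
      simp only [q₀, map_sum, map_mul, MvPolynomial.eval_C]
      exact Finset.sum_congr rfl fun k _ => by rw [← hQ]; rfl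
    rw [h4]
    exact h3.trans hn.le
  -- Correcting the constant term makes the value at the origin exact and costs the second `ε / 2`.
  refine ⟨q₀ + MvPolynomial.C (F 0 - MvPolynomial.eval 0 q₀), by simp, fun z hz => ?_⟩
  have h0 := hq₀ 0 (by simp)
  rw [smul_zero] at h0
  rw [map_add, MvPolynomial.eval_C, ← sub_sub]
  refine (norm_sub_le _ _).trans ?_
  have h1 := hq₀ z hz
  have h2 : ‖F 0 - MvPolynomial.eval 0 q₀‖ ≤ ε / 2 := h0
  linarith

end Approximation

end SzegoBall
end

noncomputable section
namespace SzegoBall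

/-! ### Holomorphic logarithms and a convergence theorem -/

lemma isSimplyConnected_ball {E : Type*} [NormedAddCommGroup E] [NormedSpace ℝ E] (x : E) {r : ℝ}
    (hr : 0 < r) : IsSimplyConnected (Metric.ball x r) := by
  have h : ContractibleSpace (Metric.ball x r) :=
    (convex_ball x r).contractibleSpace ⟨x, Metric.mem_ball_self hr⟩
  exact SimplyConnectedSpace.ofContractible _

/-- Simple connectedness gives a continuous logarithm. Near `z` it is a constant plus the principal
logarithm of `f(u) / f(z)`, hence holomorphic. -/
lemma exists_holomorphic_log {d : ℕ} {f : Cn d → ℂ} (hf : DifferentiableOn ℂ f (unitBall d))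
    (h0 : ∀ z ∈ unitBall d, f z ≠ 0) :
    ∃ Λ : Cn d → ℂ, DifferentiableOn ℂ Λ (unitBall d) ∧
      ∀ z ∈ unitBall d, Complex.exp (Λ z) = f z := by
  obtain ⟨Λ, hc, he⟩ := Complex.exists_continuousOn_eqOn_exp_comp
    (isSimplyConnected_ball (0 : Cn d) one_pos) Metric.isOpen_ball hf.continuousOn
    (by rintro ⟨z, hz, h⟩; exact h0 z hz h)
  refine ⟨Λ, fun z hz => ?_, he⟩
  have hU : unitBall d ∈ 𝓝 z := Metric.isOpen_ball.mem_nhds hz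
  have hcz : ContinuousAt Λ z := hc.continuousAt hU
  have hfz : DifferentiableAt ℂ f z := hf.differentiableAt hU
  have hev : Λ =ᶠ[𝓝 z] fun u => Λ z + Complex.log (f u * (f z)⁻¹) := by
    have h1 : ∀ᶠ u in 𝓝 z, ‖Λ u - Λ z‖ < 1 := by
      have : Tendsto (fun u => ‖Λ u - Λ z‖) (𝓝 z) (𝓝 0) := by
        have := (hcz.tendsto.sub_const (Λ z)).norm
        simpa using this
      exact this.eventually_lt_const one_pos
    filter_upwards [h1, hU] with u hu huU
    have him : |(Λ u - Λ z).im| < 1 := (Complex.abs_im_le_norm _).trans_lt hu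
    have hπ := Real.pi_gt_three
    rw [← he huU, ← he hz]
    simp only [Function.comp_apply]
    rw [← div_eq_mul_inv, ← Complex.exp_sub, Complex.log_exp]
    · ring
    · linarith [(abs_lt.1 him).1]
    · linarith [(abs_lt.1 him).2]
  refine (DifferentiableAt.congr_of_eventuallyEq ?_ hev).differentiableWithinAt
  have hz0 := h0 z hz
  refine (DifferentiableAt.clog (hfz.mul_const _) ?_).const_add _
  simp [mul_inv_cancel₀ hz0]

/-- Almost everywhere convergence and an `L²` bound give convergence of the integrals. -/
lemma integrable_tendsto_integral_of_sq_bound {Ω E : Type*} [MeasurableSpace Ω] {μ : Measure Ω}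
    [IsProbabilityMeasure μ] [NormedAddCommGroup E] [NormedSpace ℝ E]
    {X : ℕ → Ω → E} {Y : Ω → E} {B : ℝ≥0∞}
    (hm : ∀ n, AEStronglyMeasurable (X n) μ)
    (hl : ∀ᵐ ω ∂μ, Tendsto (fun n => X n ω) atTop (𝓝 (Y ω)))
    (hB : B ≠ ∞) (hb : ∀ n, ∫⁻ ω, ‖X n ω‖ₑ ^ 2 ∂μ ≤ B) :
    Integrable Y μ ∧ (∫⁻ ω, ‖Y ω‖ₑ ^ 2 ∂μ ≤ B) ∧
      Tendsto (fun n => ∫ ω, X n ω ∂μ) atTop (𝓝 (∫ ω, Y ω ∂μ)) := by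
  have hY : AEStronglyMeasurable Y μ := aestronglyMeasurable_of_tendsto_ae atTop hm hl
  have hYb : ∫⁻ ω, ‖Y ω‖ₑ ^ 2 ∂μ ≤ B := by
    have h1 : ∫⁻ ω, ‖Y ω‖ₑ ^ 2 ∂μ = ∫⁻ ω, liminf (fun n => ‖X n ω‖ₑ ^ 2) atTop ∂μ := by
      refine lintegral_congr_ae ?_
      filter_upwards [hl] with ω hω
      have : Tendsto (fun n => ‖X n ω‖ₑ ^ 2) atTop (𝓝 (‖Y ω‖ₑ ^ 2)) :=
        ENNReal.Tendsto.pow hω.enorm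
      exact this.liminf_eq.symm
    rw [h1]
    refine (lintegral_liminf_le' fun n => (hm n).enorm.pow_const 2).trans ?_
    refine (liminf_le_liminf (Eventually.of_forall hb)).trans ?_
    simp
  have int_of : ∀ {Z : Ω → E}, AEStronglyMeasurable Z μ → ∫⁻ ω, ‖Z ω‖ₑ ^ 2 ∂μ ≤ B →
      Integrable Z μ := by
    intro Z hZ hZb
    have h2 : MemLp Z 2 μ := by
      refine ⟨hZ, ?_⟩
      rw [eLpNorm_lt_top_iff_lintegral_rpow_enorm_lt_top (by norm_num) (by norm_num)]
      have : ∫⁻ ω, ‖Z ω‖ₑ ^ (2 : ℝ≥0∞).toReal ∂μ = ∫⁻ ω, ‖Z ω‖ₑ ^ 2 ∂μ := by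
        simp
      rw [this]
      exact hZb.trans_lt hB.lt_top
    exact h2.integrable (by norm_num)
  have hYi := int_of hY hYb
  refine ⟨hYi, hYb, ?_⟩
  have hXi : ∀ n, Integrable (X n) μ := fun n => int_of (hm n) (hb n)
  refine tendsto_integral_of_L1 Y hYi.1 (Eventually.of_forall hXi) ?_
  -- truncation
  have hD : ∀ n, ∫⁻ ω, ‖X n ω - Y ω‖ₑ ^ 2 ∂μ ≤ 4 * B := by
    intro n
    have h1 : ∀ ω, ‖X n ω - Y ω‖ₑ ^ 2 ≤ 2 * ‖X n ω‖ₑ ^ 2 + 2 * ‖Y ω‖ₑ ^ 2 := by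
      intro ω
      refine (pow_le_pow_left' enorm_sub_le 2).trans ?_
      have := ENNReal.rpow_add_le_mul_rpow_add_rpow ‖X n ω‖ₑ ‖Y ω‖ₑ (p := 2) (by norm_num)
      norm_num at this
      rw [mul_add] at this
      exact this
    calc _ ≤ ∫⁻ ω, (2 * ‖X n ω‖ₑ ^ 2 + 2 * ‖Y ω‖ₑ ^ 2) ∂μ := lintegral_mono h1
      _ = 2 * ∫⁻ ω, ‖X n ω‖ₑ ^ 2 ∂μ + 2 * ∫⁻ ω, ‖Y ω‖ₑ ^ 2 ∂μ := by
        rw [lintegral_add_left' (((hm n).enorm.pow_const 2).const_mul 2),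
          lintegral_const_mul' _ _ (by norm_num), lintegral_const_mul' _ _ (by norm_num)]
      _ ≤ 2 * B + 2 * B := by gcongr; exact hb n
      _ = 4 * B := by ring
  rw [ENNReal.tendsto_atTop_zero]
  intro ε hε
  wlog hεt : ε ≠ ∞ generalizing ε
  · push Not at hεt
    obtain ⟨N, hN⟩ := this 1 one_pos (by simp)
    exact ⟨N, fun n hn => by simp [hεt]⟩
  -- choose the truncation level
  obtain ⟨M, hM0, hM⟩ : ∃ M : ℝ≥0∞, M ≠ ∞ ∧ M ≠ 0 ∧ 4 * B / M ≤ ε / 2 := by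
    refine ⟨4 * B / (ε / 2) + 1, ?_, by simp, ?_⟩
    · refine ENNReal.add_ne_top.2 ⟨ENNReal.div_ne_top (ENNReal.mul_ne_top (by simp) hB) ?_, by simp⟩
      simp [hε.ne']
    · refine ENNReal.div_le_of_le_mul ?_
      rw [mul_add, ENNReal.mul_div_cancel (by simp [hε.ne'])
        (ENNReal.div_ne_top hεt (by simp))]
      exact le_self_add
  have hT : Tendsto (fun n => ∫⁻ ω, min ‖X n ω - Y ω‖ₑ M ∂μ) atTop (𝓝 0) := by
    have := tendsto_lintegral_of_dominated_convergence' (μ := μ)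
      (F := fun n ω => min ‖X n ω - Y ω‖ₑ M) (f := fun _ => 0) (fun _ => M)
      (fun n => (((hm n).sub hY).enorm).min aemeasurable_const)
      (fun n => Eventually.of_forall fun ω => min_le_right _ _) (by simpa using hM0) ?_
    · simpa using this
    · filter_upwards [hl] with ω hω
      have h1 : Tendsto (fun n => ‖X n ω - Y ω‖ₑ) atTop (𝓝 0) := by
        have := (hω.sub_const (Y ω)).enorm
        simpa using this
      have := h1.min (tendsto_const_nhds (x := M))
      simpa using this
  rw [ENNReal.tendsto_atTop_zero] at hT
  obtain ⟨N, hN⟩ := hT (ε / 2) (by simpa using hε.ne')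
  refine ⟨N, fun n hn => ?_⟩
  -- Above the level `M` the difference is at most its square divided by `M`, so the `L²` bound
  -- controls that part.
  have hp : ∀ ω, ‖X n ω - Y ω‖ₑ ≤ min ‖X n ω - Y ω‖ₑ M + M⁻¹ * ‖X n ω - Y ω‖ₑ ^ 2 := by
    intro ω
    rcases le_total ‖X n ω - Y ω‖ₑ M with h | h
    · rw [min_eq_left h]; exact le_self_add
    · refine le_add_left ?_
      calc ‖X n ω - Y ω‖ₑ = M⁻¹ * M * ‖X n ω - Y ω‖ₑ := by
            rw [ENNReal.inv_mul_cancel hM.1 hM0, one_mul]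
        _ ≤ M⁻¹ * ‖X n ω - Y ω‖ₑ * ‖X n ω - Y ω‖ₑ := by gcongr
        _ = _ := by ring
  calc _ ≤ ∫⁻ ω, (min ‖X n ω - Y ω‖ₑ M + M⁻¹ * ‖X n ω - Y ω‖ₑ ^ 2) ∂μ := lintegral_mono hp
    _ = ∫⁻ ω, min ‖X n ω - Y ω‖ₑ M ∂μ + M⁻¹ * ∫⁻ ω, ‖X n ω - Y ω‖ₑ ^ 2 ∂μ := by
      have hmeas : AEMeasurable (fun ω => min ‖X n ω - Y ω‖ₑ M) μ :=
        ((hm n).sub hY).enorm.min aemeasurable_const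
      rw [lintegral_add_left' hmeas,
        lintegral_const_mul' _ _ (by simpa using hM.1)]
    _ ≤ ε / 2 + ε / 2 := by
      gcongr
      · exact hN n hn
      · refine le_trans ?_ hM.2
        rw [ENNReal.div_eq_inv_mul]
        gcongr
        exact hD n
    _ = ε := ENNReal.add_halves ε

end SzegoBall
end

noncomputable section
namespace SzegoBall

/-! ### Polynomials on the sphere -/

/-- The values of a polynomial on `ℂᵈ`. -/
def polyFun {d : ℕ} (q : MvPolynomial (Fin d) ℂ) (z : Cn d) : ℂ :=
  MvPolynomial.eval (fun i => z i) q

variable {d : ℕ}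

lemma continuous_polyFun (q : MvPolynomial (Fin d) ℂ) : Continuous (polyFun q) :=
  (MvPolynomial.continuous_eval q).comp (by fun_prop)

lemma differentiable_polyFun (q : MvPolynomial (Fin d) ℂ) : Differentiable ℂ (polyFun q) := by
  induction q using MvPolynomial.induction_on with
  | C a =>
    have : polyFun (MvPolynomial.C a) = fun _ : Cn d => a := by
      funext z; simp [polyFun]
    rw [this]; exact differentiable_const a
  | add p q hp hq =>
    have : polyFun (p + q) = fun z => polyFun p z + polyFun q z := by
      funext z; simp [polyFun]
    rw [this]; exact hp.add hq
  | mul_X p i hp =>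
    have : polyFun (p * MvPolynomial.X i) = fun z => polyFun p z * z i := by
      funext z; simp [polyFun]
    rw [this]
    exact hp.mul (by fun_prop)

lemma polyFun_zero (q : MvPolynomial (Fin d) ℂ) : polyFun q 0 = MvPolynomial.eval 0 q := rfl

lemma exists_norm_polyFun_le (q : MvPolynomial (Fin d) ℂ) :
    ∃ M : ℝ, 0 ≤ M ∧ ∀ z : Cn d, ‖z‖ ≤ 1 → ‖polyFun q z‖ ≤ M := by
  obtain ⟨M, hM⟩ := (isCompact_closedBall (0 : Cn d) 1).exists_bound_of_continuousOn
    (continuous_polyFun q).continuousOn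
  exact ⟨max M 0, le_max_right _ _, fun z hz => (hM z (by simpa using hz)).trans (le_max_left _ _)⟩

/-! ### Removing atoms -/

/-- A polynomial with value `1` at the origin which vanishes at `a` and is close to `1` elsewhere on
the sphere. -/
def peakPoly (a : Cn d) (m : ℕ) : MvPolynomial (Fin d) ℂ :=
  MvPolynomial.C (1 - (1 / 2 : ℂ) ^ m)⁻¹ * (1 - (MvPolynomial.C (1 / 2) *
    (1 + ∑ i, MvPolynomial.C (conj (a i)) * MvPolynomial.X i)) ^ m)

lemma polyFun_peakPoly (a : Cn d) (m : ℕ) (z : Cn d) :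
    polyFun (peakPoly a m) z = (1 - (1 / 2 : ℂ) ^ m)⁻¹ * (1 - (1 / 2 * (1 + inner ℂ a z)) ^ m) := by
  have : inner ℂ a z = ∑ i, conj (a i) * z i := by
    rw [PiLp.inner_apply]
    exact Finset.sum_congr rfl fun i _ => by rw [RCLike.inner_apply, mul_comm]
  rw [this]
  simp [polyFun, peakPoly, map_sum]

lemma one_sub_half_pow_ne_zero {m : ℕ} (hm : m ≠ 0) : (1 - (1 / 2 : ℂ) ^ m) ≠ 0 := by
  intro h
  have h1 : ‖(1 / 2 : ℂ) ^ m‖ = 1 := by rw [← sub_eq_zero.1 h]; simp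
  rw [norm_pow] at h1
  have h2 : ‖(1 / 2 : ℂ)‖ ^ m < 1 := pow_lt_one₀ (norm_nonneg _) (by norm_num) hm
  linarith

lemma eval_zero_peakPoly (a : Cn d) {m : ℕ} (hm : m ≠ 0) :
    MvPolynomial.eval 0 (peakPoly a m) = 1 := by
  rw [← polyFun_zero, polyFun_peakPoly, inner_zero_right, add_zero, mul_one,
    inv_mul_cancel₀ (one_sub_half_pow_ne_zero hm)]

lemma polyFun_peakPoly_self {a : Cn d} (ha : ‖a‖ = 1) (m : ℕ) : polyFun (peakPoly a m) a = 0 := by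
  rw [polyFun_peakPoly, inner_self_eq_norm_sq_to_K, ha]
  norm_num

lemma norm_half_le {a z : Cn d} (ha : ‖a‖ = 1) (hz : ‖z‖ = 1) :
    ‖(1 / 2 * (1 + inner ℂ a z) : ℂ)‖ ≤ 1 := by
  have h := norm_inner_le_norm (𝕜 := ℂ) a z
  have h1 := norm_add_le (1 : ℂ) (inner ℂ a z)
  rw [ha, hz] at h
  rw [norm_mul]
  norm_num at h1 ⊢
  linarith

/-- `|1 + ⟨a, z⟩| = 2` with `|⟨a, z⟩| ≤ 1` forces `Re ⟨a, z⟩ = 1`, and for unit vectors this means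
`z = a`. -/
lemma norm_half_lt {a z : Cn d} (ha : ‖a‖ = 1) (hz : ‖z‖ = 1) (hne : z ≠ a) :
    ‖(1 / 2 * (1 + inner ℂ a z) : ℂ)‖ < 1 := by
  refine lt_of_le_of_ne (norm_half_le ha hz) fun h => hne ?_
  have h0 := norm_inner_le_norm (𝕜 := ℂ) a z
  rw [ha, hz, mul_one] at h0
  have h1 : ‖(1 + inner ℂ a z : ℂ)‖ = 2 := by
    rw [norm_mul] at h; norm_num at h; linarith
  have h2 : ‖(1 + inner ℂ a z : ℂ)‖ ^ 2 = 1 + 2 * (inner ℂ a z).re + ‖inner ℂ a z‖ ^ 2 := by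
    rw [← Complex.normSq_eq_norm_sq, ← Complex.normSq_eq_norm_sq, Complex.normSq_apply,
      Complex.normSq_apply]
    simp; ring
  rw [h1] at h2
  have h3 := Complex.re_le_norm (inner ℂ a z)
  have h4 : (inner ℂ a z).re = 1 := by nlinarith [norm_nonneg (inner ℂ a z)]
  have h5 : ‖z - a‖ ^ 2 = 0 := by
    rw [norm_sub_rev, norm_sub_sq (𝕜 := ℂ), ha, hz]
    simp only [RCLike.re_to_complex, h4]
    norm_num
  exact sub_eq_zero.1 (norm_eq_zero.1 (pow_eq_zero_iff two_ne_zero |>.1 h5))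

lemma norm_polyFun_peakPoly_le {a z : Cn d} (ha : ‖a‖ = 1) (hz : ‖z‖ = 1) {m : ℕ} (hm : m ≠ 0) :
    ‖polyFun (peakPoly a m) z‖ ≤ 4 := by
  rw [polyFun_peakPoly, norm_mul, norm_inv]
  have h1 : (1 / 2 : ℝ) ≤ ‖1 - (1 / 2 : ℂ) ^ m‖ := by
    have h := norm_sub_norm_le (1 : ℂ) ((1 / 2 : ℂ) ^ m)
    have h2 : ‖(1 / 2 : ℂ) ^ m‖ ≤ 1 / 2 := by
      rw [norm_pow]
      calc ‖(1 / 2 : ℂ)‖ ^ m ≤ ‖(1 / 2 : ℂ)‖ ^ 1 :=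
            pow_le_pow_of_le_one (norm_nonneg _) (by norm_num) (Nat.one_le_iff_ne_zero.2 hm)
        _ = 1 / 2 := by norm_num
    rw [norm_one] at h
    linarith
  have h3 : ‖1 - (1 / 2 * (1 + inner ℂ a z) : ℂ) ^ m‖ ≤ 2 := by
    refine (norm_sub_le _ _).trans ?_
    rw [norm_one, norm_pow]
    have := pow_le_one₀ (n := m) (norm_nonneg _) (norm_half_le ha hz)
    linarith
  have h4 : ‖1 - (1 / 2 : ℂ) ^ m‖⁻¹ ≤ 2 := by
    rw [inv_le_comm₀ (by linarith) two_pos]; linarith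
  calc _ ≤ (2 : ℝ) * 2 := mul_le_mul h4 h3 (norm_nonneg _) two_pos.le
    _ = 4 := by norm_num

lemma tendsto_polyFun_peakPoly {a z : Cn d} (ha : ‖a‖ = 1) (hz : ‖z‖ = 1) (hne : z ≠ a) :
    Tendsto (fun m => polyFun (peakPoly a m) z) atTop (𝓝 1) := by
  simp only [polyFun_peakPoly]
  have h1 := tendsto_pow_atTop_nhds_zero_of_norm_lt_one (norm_half_lt ha hz hne)
  have h2 := tendsto_pow_atTop_nhds_zero_of_norm_lt_one (x := (1 / 2 : ℂ)) (by norm_num)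
  have := ((h2.const_sub 1).inv₀ (by simp)).mul (h1.const_sub 1)
  simpa using this

/-- Multiply `h` by peak polynomials at `a`. On the sphere the products are bounded by `4M`, vanish
at `a` and tend to `h` elsewhere, so dominated convergence applies. -/
lemma exists_poly_avoid_point (ν : Measure (USphere d)) [IsFiniteMeasure ν] (a : USphere d)
    {h : MvPolynomial (Fin d) ℂ} (h0 : MvPolynomial.eval 0 h = 1) {η : ℝ≥0∞} (hη : η ≠ 0) :
    ∃ q : MvPolynomial (Fin d) ℂ, MvPolynomial.eval 0 q = 1 ∧
      ∫⁻ ζ, ‖polyFun q (ζ : Cn d)‖ₑ ^ 2 ∂ν ≤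
        ∫⁻ ζ in {a}ᶜ, ‖polyFun h (ζ : Cn d)‖ₑ ^ 2 ∂ν + η := by
  obtain ⟨M, hM0, hM⟩ := exists_norm_polyFun_le h
  have hfin : ∫⁻ ζ in {a}ᶜ, ‖polyFun h (ζ : Cn d)‖ₑ ^ 2 ∂ν ≠ ∞ := by
    refine ne_top_of_le_ne_top (b := ENNReal.ofReal M ^ 2 * ν.restrict {a}ᶜ Set.univ) ?_ ?_
    · exact ENNReal.mul_ne_top (by simp) (measure_ne_top _ _)
    · rw [← lintegral_const]
      refine lintegral_mono fun ζ => ?_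
      gcongr
      rw [← ofReal_norm]
      exact ENNReal.ofReal_le_ofReal (hM _ (norm_eq_of_mem_sphere ζ).le)
  have hT : Tendsto (fun m => ∫⁻ ζ, ‖polyFun (peakPoly (a : Cn d) (m + 1) * h) (ζ : Cn d)‖ₑ ^ 2 ∂ν)
      atTop (𝓝 (∫⁻ ζ, ({a}ᶜ : Set (USphere d)).indicator
        (fun ζ => ‖polyFun h (ζ : Cn d)‖ₑ ^ 2) ζ ∂ν)) := by
    refine tendsto_lintegral_of_dominated_convergence (fun _ => ENNReal.ofReal (4 * M) ^ 2)
      (fun m => ?_) (fun m => Eventually.of_forall fun ζ => ?_) ?_ (Eventually.of_forall fun ζ => ?_)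
    · exact (((continuous_polyFun _).comp continuous_subtype_val).measurable.enorm).pow_const 2
    · have hζ := norm_eq_of_mem_sphere ζ
      have : polyFun (peakPoly (a : Cn d) (m + 1) * h) (ζ : Cn d) =
          polyFun (peakPoly (a : Cn d) (m + 1)) ζ * polyFun h ζ := by simp [polyFun]
      simp only [this]
      gcongr
      rw [← ofReal_norm, norm_mul]
      refine ENNReal.ofReal_le_ofReal ?_
      exact mul_le_mul (norm_polyFun_peakPoly_le (norm_eq_of_mem_sphere a) hζ (by simp))
        (hM _ hζ.le) (norm_nonneg _) (by norm_num)
    · rw [lintegral_const]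
      exact ENNReal.mul_ne_top (ENNReal.pow_ne_top ENNReal.ofReal_ne_top) (measure_ne_top _ _)
    · have : ∀ m, polyFun (peakPoly (a : Cn d) (m + 1) * h) (ζ : Cn d) =
          polyFun (peakPoly (a : Cn d) (m + 1)) ζ * polyFun h ζ := fun m => by simp [polyFun]
      simp only [this]
      by_cases hζ : ζ = a
      · subst hζ
        simp [polyFun_peakPoly_self (norm_eq_of_mem_sphere ζ)]
      · rw [Set.indicator_of_mem (by simpa using hζ)]
        have h1 := (tendsto_polyFun_peakPoly (norm_eq_of_mem_sphere a) (norm_eq_of_mem_sphere ζ)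
          (fun h => hζ (Subtype.ext h))).comp (tendsto_add_atTop_nat 1)
        have h2 := ((h1.mul_const (polyFun h (ζ : Cn d))).enorm)
        rw [one_mul] at h2
        exact ENNReal.Tendsto.pow h2
  rw [lintegral_indicator (by measurability)] at hT
  have hlt : ∫⁻ ζ in {a}ᶜ, ‖polyFun h (ζ : Cn d)‖ₑ ^ 2 ∂ν <
      ∫⁻ ζ in {a}ᶜ, ‖polyFun h (ζ : Cn d)‖ₑ ^ 2 ∂ν + η :=
    ENNReal.lt_add_right hfin hη
  obtain ⟨m, hm⟩ := (hT.eventually_lt_const hlt).exists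
  refine ⟨peakPoly (a : Cn d) (m + 1) * h, ?_, hm.le⟩
  rw [map_mul, eval_zero_peakPoly _ (by simp), h0, one_mul]

/-- The measure varies in the induction, because the hypothesis is applied to the restriction of `ν`
to the complement of one point. -/
lemma exists_poly_avoid_finset (s : Finset (USphere d)) :
    ∀ (ν : Measure (USphere d)) [IsFiniteMeasure ν] {h : MvPolynomial (Fin d) ℂ},
    MvPolynomial.eval 0 h = 1 → ∀ {η : ℝ≥0∞}, η ≠ 0 →
    ∃ q : MvPolynomial (Fin d) ℂ, MvPolynomial.eval 0 q = 1 ∧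
      ∫⁻ ζ, ‖polyFun q (ζ : Cn d)‖ₑ ^ 2 ∂ν ≤
        ∫⁻ ζ in (s : Set (USphere d))ᶜ, ‖polyFun h (ζ : Cn d)‖ₑ ^ 2 ∂ν + η := by
  classical
  induction s using Finset.induction_on with
  | empty => intro ν _ h h0 η hη; exact ⟨h, h0, by simp⟩
  | insert a s ha ih =>
    intro ν _ h h0 η hη
    have hη2 : η / 2 ≠ 0 := by simpa using hη
    obtain ⟨h1, h10, h1le⟩ := ih (ν.restrict {a}ᶜ) h0 hη2
    obtain ⟨q, hq0, hqle⟩ := exists_poly_avoid_point ν a h10 hη2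
    refine ⟨q, hq0, hqle.trans ?_⟩
    rw [Measure.restrict_restrict s.measurableSet.compl] at h1le
    have : (s : Set (USphere d))ᶜ ∩ {a}ᶜ = ((insert a s : Finset (USphere d)) : Set (USphere d))ᶜ := by
      ext x; simp; tauto
    rw [this] at h1le
    calc _ ≤ _ + η / 2 + η / 2 := by gcongr
      _ = _ := by rw [add_assoc, ENNReal.add_halves]

/-- By continuity from above of the finite measure `|h|² dν`, avoiding a large finite part of `S` is
as good as avoiding `S` up to `η / 2`. -/
lemma exists_poly_avoid_countable (ν : Measure (USphere d)) [IsFiniteMeasure ν]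
    {S : Set (USphere d)} (hS : S.Countable) {h : MvPolynomial (Fin d) ℂ}
    (h0 : MvPolynomial.eval 0 h = 1) {η : ℝ≥0∞} (hη : η ≠ 0) :
    ∃ q : MvPolynomial (Fin d) ℂ, MvPolynomial.eval 0 q = 1 ∧
      ∫⁻ ζ, ‖polyFun q (ζ : Cn d)‖ₑ ^ 2 ∂ν ≤
        ∫⁻ ζ in Sᶜ, ‖polyFun h (ζ : Cn d)‖ₑ ^ 2 ∂ν + η := by
  classical
  rcases S.eq_empty_or_nonempty with rfl | hne
  · exact ⟨h, h0, by simp⟩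
  obtain ⟨f, rfl⟩ := hS.exists_eq_range hne
  obtain ⟨M, hM0, hM⟩ := exists_norm_polyFun_le h
  set ρ := ν.withDensity fun ζ => ‖polyFun h (ζ : Cn d)‖ₑ ^ 2 with hρ
  have hfin : ∫⁻ ζ, ‖polyFun h (ζ : Cn d)‖ₑ ^ 2 ∂ν ≠ ∞ := by
    refine ne_top_of_le_ne_top (b := ENNReal.ofReal M ^ 2 * ν Set.univ) ?_ ?_
    · exact ENNReal.mul_ne_top (by simp) (measure_ne_top _ _)
    · rw [← lintegral_const]
      refine lintegral_mono fun ζ => ?_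
      gcongr
      rw [← ofReal_norm]
      exact ENNReal.ofReal_le_ofReal (hM _ (norm_eq_of_mem_sphere ζ).le)
  have : IsFiniteMeasure ρ := isFiniteMeasure_withDensity hfin
  let s : ℕ → Finset (USphere d) := fun k => (Finset.range k).image f
  have hT := tendsto_measure_iInter_atTop (μ := ρ) (s := fun k => ((s k : Finset _) : Set (USphere d))ᶜ)
    (fun k => (s k).measurableSet.compl.nullMeasurableSet)
    (fun i j hij => Set.compl_subset_compl.2 (by
      exact_mod_cast Finset.image_subset_image (Finset.range_mono hij)))
    ⟨0, measure_ne_top _ _⟩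
  have hI : (⋂ k, ((s k : Finset _) : Set (USphere d))ᶜ) = (Set.range f)ᶜ := by
    rw [← Set.compl_iUnion]
    congr 1
    ext x
    simp only [s, Set.mem_iUnion, Finset.coe_image, Set.mem_image, Set.mem_range, Finset.coe_range,
      Set.mem_Iio]
    exact ⟨fun ⟨k, n, _, h⟩ => ⟨n, h⟩, fun ⟨n, h⟩ => ⟨n + 1, n, n.lt_succ_self, h⟩⟩
  rw [hI] at hT
  have hη2 : η / 2 ≠ 0 := by simpa using hη
  have hlt : ρ (Set.range f)ᶜ < ρ (Set.range f)ᶜ + η / 2 :=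
    ENNReal.lt_add_right (measure_ne_top _ _) hη2
  obtain ⟨k, hk⟩ := (hT.eventually_lt_const hlt).exists
  obtain ⟨q, hq0, hq⟩ := exists_poly_avoid_finset (s k) ν h0 hη2
  refine ⟨q, hq0, hq.trans ?_⟩
  rw [Function.comp_apply, hρ, withDensity_apply _ (s k).measurableSet.compl,
    withDensity_apply _ (Set.countable_range f).measurableSet.compl] at hk
  calc _ ≤ _ + η / 2 + η / 2 := by gcongr
    _ = _ := by rw [add_assoc, ENNReal.add_halves]

end SzegoBall
end

noncomputable section
namespace SzegoBall

/-! ### The weight `|exp (-Λ)|²` and its boundary values -/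

/-- Radii increasing to `1`. -/
def rad (n : ℕ) : ℝ := 1 - 1 / (n + 2)

lemma rad_mem (n : ℕ) : rad n ∈ Set.Ioo (0 : ℝ) 1 := by
  have h : (0 : ℝ) < n + 2 := by positivity
  have h1 : 1 / ((n : ℝ) + 2) < 1 := by
    rw [div_lt_one h]; linarith [(Nat.cast_nonneg n : (0 : ℝ) ≤ n)]
  have h2 : 0 < 1 / ((n : ℝ) + 2) := by positivity
  constructor <;> (unfold rad; linarith)

lemma tendsto_rad : Tendsto rad atTop (𝓝[<] 1) := by
  refine tendsto_nhdsWithin_iff.2 ⟨?_, Eventually.of_forall fun n => (rad_mem n).2⟩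
  have h := (tendsto_one_div_add_atTop_nhds_zero_nat (𝕜 := ℝ)).comp (tendsto_add_atTop_nat 1)
  have h2 := h.const_sub 1
  rw [sub_zero] at h2
  refine h2.congr fun n => ?_
  simp only [Function.comp_apply, rad]
  push_cast
  ring

variable {d : ℕ}

lemma rad_smul_mem (n : ℕ) (ζ : USphere d) : rad n • (ζ : Cn d) ∈ unitBall d := by
  rw [mem_ball_zero_iff, norm_smul, norm_eq_of_mem_sphere ζ, mul_one, Real.norm_of_nonneg
    (rad_mem n).1.le]
  exact (rad_mem n).2

lemma tendsto_rad_smul (ζ : USphere d) :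
    Tendsto (fun n => rad n • (ζ : Cn d)) atTop (koranyiFilter (ζ : Cn d)) :=
  (tendsto_radial_koranyiFilter ζ).comp tendsto_rad

lemma continuous_rad {f : Cn d → ℂ} (hf : ContinuousOn f (unitBall d)) (n : ℕ) :
    Continuous fun ζ : USphere d => f (rad n • (ζ : Cn d)) :=
  continuous_radial hf (rad_mem n).1.le (rad_mem n).2

lemma aestronglyMeasurable_boundary {Λ : Cn d → ℂ} {ψ : USphere d → ℂ}
    (hΛ : DifferentiableOn ℂ Λ (unitBall d))
    (hψ : ∀ᵐ ζ : USphere d ∂sigma d, Tendsto (fun n => Complex.exp (-Λ (rad n • (ζ : Cn d)))) atTop (𝓝 (ψ ζ))) :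
    AEStronglyMeasurable ψ (sigma d) :=
  aestronglyMeasurable_of_tendsto_ae atTop
    (fun n => (continuous_rad (f := fun z => Complex.exp (-Λ z))
      hΛ.continuousOn.neg.cexp n).aestronglyMeasurable) hψ

lemma lintegral_withDensity_polyFun {ψ : USphere d → ℂ} (hψm : AEStronglyMeasurable ψ (sigma d))
    {w : USphere d → ℝ} (hw : ∀ᵐ ζ : USphere d ∂sigma d, w ζ = ‖ψ ζ‖ ^ 2)
    (q : MvPolynomial (Fin d) ℂ) : ∫⁻ ζ, ‖polyFun q (ζ : Cn d)‖ₑ ^ 2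
      ∂((sigma d).withDensity fun ζ => ENNReal.ofReal (w ζ)) =
        ∫⁻ ζ, ‖polyFun q (ζ : Cn d)‖ₑ ^ 2 * ‖ψ ζ‖ₑ ^ 2 ∂sigma d := by
  have hw' : (fun ζ => ENNReal.ofReal (w ζ)) =ᵐ[sigma d] fun ζ => ‖ψ ζ‖ₑ ^ 2 := by
    filter_upwards [hw] with ζ h
    rw [h, ENNReal.ofReal_pow (norm_nonneg _), ofReal_norm]
  have hmq : Measurable fun ζ : USphere d => ‖polyFun q (ζ : Cn d)‖ₑ ^ 2 :=
    ((continuous_polyFun q).comp continuous_subtype_val).measurable.enorm.pow_const 2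
  rw [withDensity_congr_ae hw', lintegral_withDensity_eq_lintegral_mul₀ (hψm.enorm.pow_const 2)
    hmq.aemeasurable]
  exact lintegral_congr fun ζ => by simp only [Pi.mul_apply]; exact mul_comm _ _

variable [NeZero d] {Λ : Cn d → ℂ}

/-- The bounded function `exp Λ` has K-limits almost everywhere. Where such a limit is `0`, `|exp
(-Λ)|²` tends to infinity along the radius, which Fatou's lemma allows only on a null set. -/
theorem ae_exists_kLimit_exp_neg (hΛ : DifferentiableOn ℂ Λ (unitBall d)) {C : ℝ}
    (hC : ∀ z ∈ unitBall d, (Λ z).re ≤ C)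
    (hI : ∀ n, ∫⁻ ζ : USphere d, ‖Complex.exp (-Λ (rad n • (ζ : Cn d)))‖ₑ ^ 2 ∂sigma d ≤ 1) :
    ∃ ψ : USphere d → ℂ, ∀ᵐ ζ : USphere d ∂sigma d,
      Tendsto (fun z => Complex.exp (-Λ z)) (koranyiFilter (ζ : Cn d)) (𝓝 (ψ ζ)) ∧ ψ ζ ≠ 0 := by
  have hm : ∀ n, Measurable fun ζ : USphere d => ‖Complex.exp (-Λ (rad n • (ζ : Cn d)))‖ₑ ^ 2 :=
    fun n => (continuous_rad (f := fun z => Complex.exp (-Λ z))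
      hΛ.continuousOn.neg.cexp n).measurable.enorm.pow_const 2
  have hG : ∀ᵐ ζ : USphere d ∂sigma d,
      liminf (fun n => ‖Complex.exp (-Λ (rad n • (ζ : Cn d)))‖ₑ ^ 2) atTop < ∞ := by
    refine ae_lt_top (.liminf hm) (ne_top_of_le_ne_top ENNReal.one_ne_top ?_)
    refine (lintegral_liminf_le hm).trans ?_
    refine (liminf_le_liminf (Eventually.of_forall hI)).trans ?_
    simp
  have hK := ae_exists_kLimit (f := fun z => Complex.exp (Λ z)) hΛ.cexp (M := Real.exp C)
    (fun z hz => by rw [Complex.norm_exp]; exact Real.exp_le_exp.2 (hC z hz))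
  have key : ∀ᵐ ζ : USphere d ∂sigma d, ∃ c,
      Tendsto (fun z => Complex.exp (-Λ z)) (koranyiFilter (ζ : Cn d)) (𝓝 c) ∧ c ≠ 0 := by
    filter_upwards [hG, hK] with ζ h1 ⟨c, hc⟩
    have hc0 : c ≠ 0 := by
      rintro rfl
      have h2 : Tendsto (fun n => ‖Complex.exp (-Λ (rad n • (ζ : Cn d)))‖ₑ ^ 2) atTop (𝓝 ∞) := by
        have h3 := (ENNReal.Tendsto.pow (n := 2) (hc.comp (tendsto_rad_smul ζ)).enorm).inv
        simp only [enorm_zero, ne_eq, OfNat.ofNat_ne_zero, not_false_eq_true, zero_pow,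
          ENNReal.inv_zero] at h3
        refine h3.congr fun n => ?_
        rw [Function.comp_apply, Complex.exp_neg, enorm_inv (Complex.exp_ne_zero _),
          ENNReal.inv_pow]
      rw [h2.liminf_eq] at h1
      exact lt_irrefl _ h1
    refine ⟨c⁻¹, ?_, inv_ne_zero hc0⟩
    simpa only [Complex.exp_neg] using hc.inv₀ hc0
  choose! ψ hψ using fun ζ : USphere d => fun h : ∃ c,
      Tendsto (fun z => Complex.exp (-Λ z)) (koranyiFilter (ζ : Cn d)) (𝓝 c) ∧ c ≠ 0 => h
  exact ⟨ψ, key.mono hψ⟩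

section

variable {ψ : USphere d → ℂ}

/-- The spherical means of `Re Λ` all equal `Re Λ 0`. They pass to the boundary by an `L²` bound:
`Re Λ` is at most `C` where it is positive, and its modulus is at most `|exp (-Λ)|` where it is
negative. -/
lemma integrable_log_boundary (hΛ : DifferentiableOn ℂ Λ (unitBall d)) {C : ℝ}
    (hC : ∀ z ∈ unitBall d, (Λ z).re ≤ C)
    (hI : ∀ n, ∫⁻ ζ : USphere d, ‖Complex.exp (-Λ (rad n • (ζ : Cn d)))‖ₑ ^ 2 ∂sigma d ≤ 1)
    (hψ : ∀ᵐ ζ : USphere d ∂sigma d, Tendsto (fun n => Complex.exp (-Λ (rad n • (ζ : Cn d)))) atTop (𝓝 (ψ ζ)))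
    (hψ0 : ∀ᵐ ζ : USphere d ∂sigma d, ψ ζ ≠ 0) :
    Integrable (fun ζ => Real.log (‖ψ ζ‖ ^ 2)) (sigma d) ∧
      ∫ ζ, Real.log (‖ψ ζ‖ ^ 2) ∂sigma d = -2 * (Λ 0).re := by
  have hcΛ := fun n => continuous_rad hΛ.continuousOn n
  have hc : ∀ n, Continuous fun ζ : USphere d => (Λ (rad n • (ζ : Cn d))).re :=
    fun n => Complex.continuous_re.comp (hcΛ n)
  have hlim : ∀ᵐ ζ : USphere d ∂sigma d, Tendsto (fun n => (Λ (rad n • (ζ : Cn d))).re) atTop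
      (𝓝 (-Real.log ‖ψ ζ‖)) := by
    filter_upwards [hψ, hψ0] with ζ h1 h2
    have h3 := (h1.norm.log (norm_ne_zero_iff.2 h2)).neg
    refine h3.congr fun n => ?_
    rw [Complex.norm_exp, Real.log_exp]
    simp
  have hb : ∀ n, ∫⁻ ζ : USphere d, ‖(Λ (rad n • (ζ : Cn d))).re‖ₑ ^ 2 ∂sigma d ≤
      ENNReal.ofReal (2 * C ^ 2) + 2 := by
    intro n
    have hp : ∀ ζ : USphere d, ‖(Λ (rad n • (ζ : Cn d))).re‖ₑ ^ 2 ≤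
        ENNReal.ofReal (2 * C ^ 2) + 2 * ‖Complex.exp (-Λ (rad n • (ζ : Cn d)))‖ₑ ^ 2 := by
      intro ζ
      set x := (Λ (rad n • (ζ : Cn d))).re with hx
      have hxC : x ≤ C := hC _ (rad_smul_mem n ζ)
      rw [← ofReal_norm, ← ofReal_norm, Complex.norm_exp, Complex.neg_re, ← hx,
        ← ENNReal.ofReal_pow (norm_nonneg _), ← ENNReal.ofReal_pow (Real.exp_nonneg _),
        show (2 : ℝ≥0∞) = ENNReal.ofReal 2 by simp, ← ENNReal.ofReal_mul two_pos.le,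
        ← ENNReal.ofReal_add (by positivity) (by positivity)]
      refine ENNReal.ofReal_le_ofReal ?_
      rw [Real.norm_eq_abs, sq_abs]
      have h1 := Real.add_one_le_exp (-x)
      have h2 := Real.exp_pos (-x)
      rcases le_total 0 x with h | h
      · nlinarith
      · nlinarith [sq_nonneg C]
    calc _ ≤ _ := lintegral_mono hp
      _ = ENNReal.ofReal (2 * C ^ 2) +
          2 * ∫⁻ ζ : USphere d, ‖Complex.exp (-Λ (rad n • (ζ : Cn d)))‖ₑ ^ 2 ∂sigma d := by
        rw [lintegral_add_left measurable_const, lintegral_const_mul' _ _ (by simp)]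
        simp
      _ ≤ ENNReal.ofReal (2 * C ^ 2) + 2 * 1 := by gcongr; exact hI n
      _ = _ := by rw [mul_one]
  obtain ⟨h1, -, h3⟩ := integrable_tendsto_integral_of_sq_bound
    (fun n => (hc n).aestronglyMeasurable) hlim
    (ENNReal.add_ne_top.2 ⟨ENNReal.ofReal_ne_top, by simp⟩) hb
  have hval : ∀ n, ∫ ζ : USphere d, (Λ (rad n • (ζ : Cn d))).re ∂sigma d = (Λ 0).re := by
    intro n
    rw [← integral_sphere_eq hΛ (rad_mem n).1.le (rad_mem n).2]
    have hint : Integrable (fun ζ : USphere d => Λ (rad n • (ζ : Cn d))) (sigma d) :=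
      (hcΛ n).integrable_of_hasCompactSupport (HasCompactSupport.of_compactSpace _)
    exact integral_re hint
  simp only [hval] at h3
  have h4 := tendsto_nhds_unique h3 tendsto_const_nhds
  have hlog : (fun ζ => Real.log (‖ψ ζ‖ ^ 2)) = fun ζ => -2 * -Real.log ‖ψ ζ‖ := by
    funext ζ; rw [Real.log_pow]; push_cast; ring
  rw [hlog]
  exact ⟨h1.const_mul _, by rw [integral_const_mul, h4]⟩

lemma lintegral_boundary_le
    (hΛ : DifferentiableOn ℂ Λ (unitBall d))
    (hI : ∀ n, ∫⁻ ζ : USphere d, ‖Complex.exp (-Λ (rad n • (ζ : Cn d)))‖ₑ ^ 2 ∂sigma d ≤ 1)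
    (hψ : ∀ᵐ ζ : USphere d ∂sigma d, Tendsto (fun n => Complex.exp (-Λ (rad n • (ζ : Cn d)))) atTop (𝓝 (ψ ζ))) :
    ∫⁻ ζ, ‖ψ ζ‖ₑ ^ 2 ∂sigma d ≤ 1 :=
  (integrable_tendsto_integral_of_sq_bound
    (fun n => (continuous_rad (f := fun z => Complex.exp (-Λ z))
      hΛ.continuousOn.neg.cexp n).aestronglyMeasurable) hψ (by simp) hI).2.1

/-- The boundary mean of `q exp (-Λ)` is its value `exp (-Λ 0)` at the origin, and on a probability
space the `L¹` norm is at most the `L²` norm. -/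
lemma exp_le_lintegral_polyFun (hΛ : DifferentiableOn ℂ Λ (unitBall d))
    (hI : ∀ n, ∫⁻ ζ : USphere d, ‖Complex.exp (-Λ (rad n • (ζ : Cn d)))‖ₑ ^ 2 ∂sigma d ≤ 1)
    (hψ : ∀ᵐ ζ : USphere d ∂sigma d, Tendsto (fun n => Complex.exp (-Λ (rad n • (ζ : Cn d)))) atTop (𝓝 (ψ ζ)))
    {q : MvPolynomial (Fin d) ℂ} (hq : MvPolynomial.eval 0 q = 1) :
    ENNReal.ofReal (Real.exp (-2 * (Λ 0).re)) ≤
      ∫⁻ ζ, ‖polyFun q (ζ : Cn d)‖ₑ ^ 2 * ‖ψ ζ‖ₑ ^ 2 ∂sigma d := by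
  obtain ⟨M, hM0, hM⟩ := exists_norm_polyFun_le q
  set h : Cn d → ℂ := fun z => polyFun q z * Complex.exp (-Λ z) with hh
  have hd : DifferentiableOn ℂ h (unitBall d) :=
    (differentiable_polyFun q).differentiableOn.mul hΛ.neg.cexp
  have hlim : ∀ᵐ ζ : USphere d ∂sigma d, Tendsto (fun n => h (rad n • (ζ : Cn d))) atTop
      (𝓝 (polyFun q (ζ : Cn d) * ψ ζ)) := by
    filter_upwards [hψ] with ζ h1
    refine Tendsto.mul ?_ h1
    refine ((continuous_polyFun q).tendsto _).comp ?_
    have := (tendsto_nhdsWithin_iff.1 tendsto_rad).1.smul_const (ζ : Cn d)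
    rwa [one_smul] at this
  have hb : ∀ n, ∫⁻ ζ : USphere d, ‖h (rad n • (ζ : Cn d))‖ₑ ^ 2 ∂sigma d ≤
      ENNReal.ofReal M ^ 2 := by
    intro n
    calc _ ≤ ∫⁻ ζ : USphere d, ENNReal.ofReal M ^ 2 *
          ‖Complex.exp (-Λ (rad n • (ζ : Cn d)))‖ₑ ^ 2 ∂sigma d := by
          refine lintegral_mono fun ζ => ?_
          rw [hh, enorm_mul, mul_pow]
          gcongr
          rw [← ofReal_norm]
          exact ENNReal.ofReal_le_ofReal (hM _ (mem_ball_zero_iff.1 (rad_smul_mem n ζ)).le)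
      _ = ENNReal.ofReal M ^ 2 * _ :=
          lintegral_const_mul' _ _ (ENNReal.pow_ne_top ENNReal.ofReal_ne_top)
      _ ≤ ENNReal.ofReal M ^ 2 * 1 := by gcongr; exact hI n
      _ = _ := mul_one _
  obtain ⟨h1, -, h3⟩ := integrable_tendsto_integral_of_sq_bound
    (fun n => (continuous_rad hd.continuousOn n).aestronglyMeasurable) hlim
    (ENNReal.pow_ne_top ENNReal.ofReal_ne_top) hb
  simp only [fun n => integral_sphere_eq hd (rad_mem n).1.le (rad_mem n).2] at h3
  have h4 := tendsto_nhds_unique h3 tendsto_const_nhds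
  have h5 : h 0 = Complex.exp (-Λ 0) := by
    rw [hh]; simp only [polyFun_zero, hq, one_mul]
  have h6 : ENNReal.ofReal (Real.exp (-2 * (Λ 0).re)) = ‖h 0‖ₑ ^ 2 := by
    rw [h5, ← ofReal_norm, Complex.norm_exp, ← ENNReal.ofReal_pow (Real.exp_nonneg _),
      ← Real.exp_nat_mul]
    congr 2
    simp
  rw [h6, ← h4]
  have h7 := eLpNorm_le_eLpNorm_of_exponent_le (μ := sigma d) (p := 1) (q := 2) (by norm_num)
    h1.aestronglyMeasurable
  rw [eLpNorm_one_eq_lintegral_enorm, eLpNorm_eq_lintegral_rpow_enorm_toReal (by norm_num)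
    (by norm_num)] at h7
  have h8 := (enorm_integral_le_lintegral_enorm _).trans h7
  calc _ ≤ _ := pow_le_pow_left' h8 2
    _ = _ := by
      rw [← ENNReal.rpow_natCast, ← ENNReal.rpow_mul]
      simp [enorm_mul, mul_pow]

/-- The function `exp (Λ - Λ 0)` times `ψ` is the constant `exp (-Λ 0)` on the boundary. It is
bounded since `Re Λ ≤ C`, so polynomials approximate its dilations, and a multiple of `|ψ|²`
dominates the integrands. -/
lemma exists_poly_lintegral_le (hΛ : DifferentiableOn ℂ Λ (unitBall d)) {C : ℝ}
    (hC : ∀ z ∈ unitBall d, (Λ z).re ≤ C)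
    (hI : ∀ n, ∫⁻ ζ : USphere d, ‖Complex.exp (-Λ (rad n • (ζ : Cn d)))‖ₑ ^ 2 ∂sigma d ≤ 1)
    (hψ : ∀ᵐ ζ : USphere d ∂sigma d, Tendsto (fun n => Complex.exp (-Λ (rad n • (ζ : Cn d)))) atTop (𝓝 (ψ ζ)))
    (hψ0 : ∀ᵐ ζ : USphere d ∂sigma d, ψ ζ ≠ 0) {η : ℝ≥0∞} (hη : η ≠ 0) :
    ∃ q : MvPolynomial (Fin d) ℂ, MvPolynomial.eval 0 q = 1 ∧
      ∫⁻ ζ, ‖polyFun q (ζ : Cn d)‖ₑ ^ 2 * ‖ψ ζ‖ₑ ^ 2 ∂sigma d ≤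
        ENNReal.ofReal (Real.exp (-2 * (Λ 0).re)) + η := by
  set F : Cn d → ℂ := fun z => Complex.exp (Λ z - Λ 0) with hF
  have hFd : DifferentiableOn ℂ F (unitBall d) := (hΛ.sub_const _).cexp
  set M := Real.exp (C - (Λ 0).re) with hMdef
  have hFM : ∀ z ∈ unitBall d, ‖F z‖ ≤ M := fun z hz => by
    rw [hF, Complex.norm_exp, Complex.sub_re]
    exact Real.exp_le_exp.2 (by linarith [hC z hz])
  have hF0 : F 0 = 1 := by simp [hF]
  have hε : ∀ n : ℕ, (0 : ℝ) < 1 / (n + 1) := fun n => by positivity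
  choose h h0 hh using fun n : ℕ =>
    exists_mvPolynomial_approx hFd hFM (rad_mem n).1.le (rad_mem n).2 (hε n)
  simp only [hF0] at h0
  have hψm := aestronglyMeasurable_boundary hΛ hψ
  have hlim : ∀ᵐ ζ : USphere d ∂sigma d,
      Tendsto (fun n => polyFun (h n) (ζ : Cn d) * ψ ζ) atTop (𝓝 (Complex.exp (-Λ 0))) := by
    filter_upwards [hψ, hψ0] with ζ h1 h2
    have h3 : Tendsto (fun n => F (rad n • (ζ : Cn d))) atTop
        (𝓝 ((ψ ζ)⁻¹ * Complex.exp (-Λ 0))) := by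
      refine ((h1.inv₀ h2).mul_const (Complex.exp (-Λ 0))).congr fun n => ?_
      rw [← Complex.exp_neg, neg_neg, ← Complex.exp_add, ← sub_eq_add_neg]
    have h4 : Tendsto (fun n => F (rad n • (ζ : Cn d)) - polyFun (h n) (ζ : Cn d)) atTop (𝓝 0) := by
      refine squeeze_zero_norm (fun n => hh n (ζ : Cn d) (norm_eq_of_mem_sphere ζ).le) ?_
      exact tendsto_one_div_add_atTop_nhds_zero_nat
    have h5 := (h3.sub h4).mul_const (ψ ζ)
    have h6 : ((ψ ζ)⁻¹ * Complex.exp (-Λ 0) - 0) * ψ ζ = Complex.exp (-Λ 0) := by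
      field_simp; ring
    rw [h6] at h5
    refine h5.congr fun n => ?_
    ring
  have hbd : ∀ n (ζ : USphere d), ‖polyFun (h n) (ζ : Cn d)‖ ≤ M + 1 := by
    intro n ζ
    have h1 := hh n (ζ : Cn d) (norm_eq_of_mem_sphere ζ).le
    have h2 := hFM _ (rad_smul_mem n ζ)
    have h3 : (1 : ℝ) / (n + 1) ≤ 1 := by
      rw [div_le_one (by positivity)]; linarith [(Nat.cast_nonneg n : (0 : ℝ) ≤ n)]
    have h4 := norm_sub_norm_le (polyFun (h n) (ζ : Cn d)) (F (rad n • (ζ : Cn d)))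
    rw [norm_sub_rev] at h4
    have h5 : ‖F (rad n • (ζ : Cn d)) - polyFun (h n) (ζ : Cn d)‖ ≤ 1 / (n + 1) := h1
    linarith
  have hT : Tendsto (fun n => ∫⁻ ζ, ‖polyFun (h n) (ζ : Cn d)‖ₑ ^ 2 * ‖ψ ζ‖ₑ ^ 2 ∂sigma d) atTop
      (𝓝 (∫⁻ _ : USphere d, ‖Complex.exp (-Λ 0)‖ₑ ^ 2 ∂sigma d)) := by
    refine tendsto_lintegral_of_dominated_convergence'
      (fun ζ => ENNReal.ofReal (M + 1) ^ 2 * ‖ψ ζ‖ₑ ^ 2) (fun n => ?_)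
      (fun n => Eventually.of_forall fun ζ => ?_) ?_ ?_
    · exact ((((continuous_polyFun _).comp continuous_subtype_val).measurable.enorm).pow_const
        2).aemeasurable.mul (hψm.enorm.pow_const 2)
    · refine mul_le_mul_left (pow_le_pow_left' ?_ 2) _
      rw [← ofReal_norm]
      exact ENNReal.ofReal_le_ofReal (hbd n ζ)
    · rw [lintegral_const_mul' _ _ (ENNReal.pow_ne_top ENNReal.ofReal_ne_top)]
      exact ENNReal.mul_ne_top (ENNReal.pow_ne_top ENNReal.ofReal_ne_top)
        (ne_top_of_le_ne_top ENNReal.one_ne_top (lintegral_boundary_le hΛ hI hψ))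
    · filter_upwards [hlim] with ζ h1
      have := ENNReal.Tendsto.pow (n := 2) h1.enorm
      simpa only [enorm_mul, mul_pow] using this
  have hval : ∫⁻ _ : USphere d, ‖Complex.exp (-Λ 0)‖ₑ ^ 2 ∂sigma d =
      ENNReal.ofReal (Real.exp (-2 * (Λ 0).re)) := by
    rw [lintegral_const, measure_univ, mul_one, ← ofReal_norm, Complex.norm_exp,
      ← ENNReal.ofReal_pow (Real.exp_nonneg _), ← Real.exp_nat_mul]
    congr 2
    simp
  rw [hval] at hT
  obtain ⟨n, hn⟩ := (hT.eventually_lt_const (ENNReal.lt_add_right ENNReal.ofReal_ne_top hη)).exists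
  exact ⟨h n, h0 n, hn.le⟩

end

/-- The extremal problem for `w dσ + dμ_s`, with `w` the boundary function of `|exp (-Λ)|²` and
`μ_s` discrete. -/
theorem isGLB_lintegral_polyFun (hΛ : DifferentiableOn ℂ Λ (unitBall d)) {C : ℝ}
    (hC : ∀ z ∈ unitBall d, (Λ z).re ≤ C)
    (hI : ∀ n, ∫⁻ ζ : USphere d, ‖Complex.exp (-Λ (rad n • (ζ : Cn d)))‖ₑ ^ 2 ∂sigma d ≤ 1)
    {ψ : USphere d → ℂ}
    (hψ : ∀ᵐ ζ : USphere d ∂sigma d, Tendsto (fun n => Complex.exp (-Λ (rad n • (ζ : Cn d)))) atTop (𝓝 (ψ ζ)))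
    (hψ0 : ∀ᵐ ζ : USphere d ∂sigma d, ψ ζ ≠ 0) {w : USphere d → ℝ} (hw : ∀ᵐ ζ : USphere d ∂sigma d, w ζ = ‖ψ ζ‖ ^ 2)
    {μs : Measure (USphere d)} (hμs : IsDiscreteMeasure μs) [IsFiniteMeasure (weighted w μs)] :
    IsGLB ((fun q => ∫⁻ ζ, ‖polyFun q (ζ : Cn d)‖ₑ ^ 2 ∂weighted w μs) ''
      {q : MvPolynomial (Fin d) ℂ | MvPolynomial.eval 0 q = 1})
      (ENNReal.ofReal (Real.exp (-2 * (Λ 0).re))) := by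
  have hψm := aestronglyMeasurable_boundary hΛ hψ
  have hdens := lintegral_withDensity_polyFun hψm hw
  refine ⟨?_, fun b hb => ?_⟩
  · rintro _ ⟨q, hq, rfl⟩
    refine (exp_le_lintegral_polyFun hΛ hI hψ hq).trans ?_
    rw [← hdens]
    simp only [weighted, lintegral_add_measure]
    exact le_self_add
  · refine ENNReal.le_of_forall_pos_le_add fun ε hε _ => ?_
    have hε2 : (ε : ℝ≥0∞) / 2 ≠ 0 := by simpa using hε.ne'
    obtain ⟨h, h0, hh⟩ := exists_poly_lintegral_le hΛ hC hI hψ hψ0 hε2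
    obtain ⟨S, hS, hS0⟩ := hμs
    obtain ⟨q, hq0, hq⟩ := exists_poly_avoid_countable (weighted w μs) hS h0 hε2
    refine (hb ⟨q, hq0, rfl⟩).trans (hq.trans ?_)
    -- Discarding `S` removes all of `μs` and cannot increase the absolutely continuous part.
    have h1 : ∫⁻ ζ in Sᶜ, ‖polyFun h (ζ : Cn d)‖ₑ ^ 2 ∂weighted w μs ≤
        ∫⁻ ζ, ‖polyFun h (ζ : Cn d)‖ₑ ^ 2 * ‖ψ ζ‖ₑ ^ 2 ∂sigma d := by
      rw [weighted, Measure.restrict_add, lintegral_add_measure,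
        Measure.restrict_eq_zero.2 hS0, lintegral_zero_measure, add_zero, ← hdens]
      exact setLIntegral_le_lintegral _ _
    calc _ ≤ ENNReal.ofReal (Real.exp (-2 * (Λ 0).re)) + ε / 2 + ε / 2 := by
          gcongr; exact h1.trans hh
      _ = _ := by rw [add_assoc, ENNReal.add_halves]

end SzegoBall
end

noncomputable section
namespace SzegoBall

/-! ### Verblunsky coefficients and the extremal problem -/

variable {d : ℕ}

/-- By the maximum principle `q` vanishes on the ball, which contains a product of discs; a
polynomial that vanishes on a product of infinite sets is zero. -/
lemma eq_zero_of_polyFun_eq_zero {q : MvPolynomial (Fin d) ℂ} (hd : 1 ≤ d)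
    (h : ∀ ζ : USphere d, polyFun q (ζ : Cn d) = 0) : q = 0 := by
  have : NeZero d := ⟨by omega⟩
  have h1 : Set.EqOn (polyFun q) (fun _ => 0) (closure (unitBall d)) := by
    refine Complex.eqOn_closure_of_eqOn_frontier Metric.isBounded_ball
      (differentiable_polyFun q).diffContOnCl diffContOnCl_const fun z hz => ?_
    rw [frontier_ball (0 : Cn d) one_ne_zero] at hz
    exact h ⟨z, hz⟩
  have hU : ∀ᶠ x : Fin d → ℂ in 𝓝 0, (WithLp.toLp 2 x : Cn d) ∈ unitBall d := by
    have hc : Continuous fun x : Fin d → ℂ => (WithLp.toLp 2 x : Cn d) := by fun_prop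
    exact (Metric.isOpen_ball.preimage hc).mem_nhds (by simp)
  obtain ⟨ε, hε, hsub⟩ := Metric.eventually_nhds_iff_ball.1 hU
  refine MvPolynomial.funext_set (fun _ => Metric.ball (0 : ℂ) ε)
    (fun _ => infinite_of_mem_nhds 0 (Metric.ball_mem_nhds 0 hε)) fun x hx => ?_
  have hx' : x ∈ Metric.ball (0 : Fin d → ℂ) ε := by
    rw [ball_pi _ hε]; exact hx
  rw [map_zero]
  exact h1 (subset_closure (hsub x hx'))

instance [NeZero d] : (sigma d).IsOpenPosMeasure := by
  refine Measure.isOpenPosMeasure_smul _ ?_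
  exact ENNReal.inv_ne_zero.2 (measure_ne_top _ _)

variable (μ : Measure (USphere d)) [IsProbabilityMeasure μ]

/-- Polynomials as elements of `L²(μ)`. -/
def polyLp : MvPolynomial (Fin d) ℂ →ₗ[ℂ] Lp ℂ 2 μ where
  toFun q := ContinuousMap.toLp 2 μ ℂ
    ⟨fun ζ : USphere d => polyFun q (ζ : Cn d), (continuous_polyFun q).comp continuous_subtype_val⟩
  map_add' p q := by
    rw [← map_add]; congr 1; ext ζ; simp [polyFun]
  map_smul' c q := by
    rw [RingHom.id_apply, ← map_smul]; congr 1; ext ζ; simp [polyFun, MvPolynomial.smul_eval]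

lemma inner_polyLp (p q : MvPolynomial (Fin d) ℂ) :
    inner ℂ (polyLp μ p) (polyLp μ q) =
      ∫ ζ : USphere d, polyFun q (ζ : Cn d) * conj (polyFun p (ζ : Cn d)) ∂μ :=
  ContinuousMap.inner_toLp μ
    ⟨fun ζ : USphere d => polyFun p (ζ : Cn d), (continuous_polyFun p).comp continuous_subtype_val⟩
    ⟨fun ζ : USphere d => polyFun q (ζ : Cn d), (continuous_polyFun q).comp continuous_subtype_val⟩

lemma enorm_polyLp_sq (q : MvPolynomial (Fin d) ℂ) :
    ENNReal.ofReal (‖polyLp μ q‖ ^ 2) = ∫⁻ ζ : USphere d, ‖polyFun q (ζ : Cn d)‖ₑ ^ 2 ∂μ := by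
  have h1 : eLpNorm (polyLp μ q) 2 μ = eLpNorm (fun ζ : USphere d => polyFun q (ζ : Cn d)) 2 μ :=
    eLpNorm_congr_ae (ContinuousMap.coeFn_toLp (𝕜 := ℂ) μ _)
  rw [ENNReal.ofReal_pow (norm_nonneg _), ofReal_norm, Lp.enorm_def, h1,
    eLpNorm_eq_lintegral_rpow_enorm_toReal (by norm_num) (by norm_num), ← ENNReal.rpow_natCast,
    ← ENNReal.rpow_mul]
  simp

/-- The monomials in the shortlex order. -/
def mono (d n : ℕ) : MvPolynomial (Fin d) ℂ :=
  MvPolynomial.monomial (Finsupp.equivFunOnFinite.symm (nthIndex d n)) 1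

lemma polyFun_mono (n : ℕ) (z : Cn d) : polyFun (mono d n) z = ∏ i, z i ^ nthIndex d n i := by
  rw [polyFun, mono, MvPolynomial.eval_monomial, one_mul, Finsupp.prod_fintype _ _ (by simp)]
  simp

/-- The indices are exchanged because the inner product is conjugate linear in its first argument.
-/
lemma momentKernel_eq (n m : ℕ) : momentKernel μ (nthIndex d n) (nthIndex d m) =
    inner ℂ (polyLp μ (mono d m)) (polyLp μ (mono d n)) := by
  rw [inner_polyLp]
  simp only [polyFun_mono, momentKernel]

/-- The normalised monomials. -/
def unitMono (n : ℕ) : Lp ℂ 2 μ := ((‖polyLp μ (mono d n)‖ : ℂ))⁻¹ • polyLp μ (mono d n)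

lemma normalise_momentKernel (n m : ℕ) :
    normalise (fun n m => momentKernel μ (nthIndex d n) (nthIndex d m)) n m =
      inner ℂ (unitMono μ m) (unitMono μ n) := by
  have h : ∀ n, (momentKernel μ (nthIndex d n) (nthIndex d n)).re =
      ‖polyLp μ (mono d n)‖ ^ 2 := by
    intro n
    rw [momentKernel_eq, inner_self_eq_norm_sq_to_K]
    norm_cast
  simp only [normalise, h, Real.sqrt_sq (norm_nonneg _)]
  rw [momentKernel_eq, unitMono, unitMono, inner_smul_left, inner_smul_right]
  simp only [map_inv₀, Complex.conj_ofReal]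
  push_cast
  rw [div_eq_mul_inv, mul_inv]
  ring

variable {μ}

/-- The hypothesis excludes measures carried by the zero set of a nonzero polynomial. Injectivity
keeps the monomials linearly independent in `L²(μ)`, so that no defect vanishes. -/
lemma polyLp_injective (hμ : ∀ q : MvPolynomial (Fin d) ℂ,
    ∫⁻ ζ : USphere d, ‖polyFun q (ζ : Cn d)‖ₑ ^ 2 ∂μ = 0 → q = 0) :
    Function.Injective (polyLp μ) := by
  rw [injective_iff_map_eq_zero]
  intro q hq
  refine hμ q ?_
  rw [← enorm_polyLp_sq, hq]
  simp

lemma linearIndependent_mono (hd : 1 ≤ d) : LinearIndependent ℂ (mono d) := by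
  have h := (MvPolynomial.basisMonomials (Fin d) ℂ).linearIndependent
  have hi : Function.Injective fun n => Finsupp.equivFunOnFinite.symm (nthIndex d n) := by
    refine (Equiv.injective _).comp ?_
    intro a b hab
    rw [nthIndex_eq hd, nthIndex_eq hd] at hab
    exact (Equiv.injective _) hab
  have h2 := h.comp _ hi
  have h3 : mono d = ⇑(MvPolynomial.basisMonomials (Fin d) ℂ) ∘
      fun n => Finsupp.equivFunOnFinite.symm (nthIndex d n) := by
    funext n
    simp [mono]
  rw [h3]
  exact h2

lemma polyLp_mono_ne_zero (hd : 1 ≤ d) (hT : Function.Injective (polyLp μ)) (n : ℕ) :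
    polyLp μ (mono d n) ≠ 0 := by
  rw [Ne, map_eq_zero_iff _ hT]
  exact (linearIndependent_mono hd).ne_zero n

lemma norm_unitMono (hd : 1 ≤ d) (hT : Function.Injective (polyLp μ)) (n : ℕ) :
    ‖unitMono μ n‖ = 1 := by
  have h := norm_ne_zero_iff.2 (polyLp_mono_ne_zero hd hT n)
  rw [unitMono, norm_smul, norm_inv, Complex.norm_real, norm_norm, inv_mul_cancel₀ h]

lemma linearIndependent_unitMono (hd : 1 ≤ d) (hT : Function.Injective (polyLp μ)) :
    LinearIndependent ℂ (unitMono μ) := by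
  have h1 := (linearIndependent_mono hd).map' (polyLp μ) (LinearMap.ker_eq_bot.2 hT)
  have h2 := h1.units_smul fun n => (Units.mk0 ((‖polyLp μ (mono d n)‖ : ℂ))
    (by exact_mod_cast norm_ne_zero_iff.2 (polyLp_mono_ne_zero hd hT n)))⁻¹
  exact h2

lemma nthIndex_zero (hd : 1 ≤ d) : nthIndex d 0 = 0 := by
  rw [nthIndex_eq hd, Equiv.symm_apply_eq, shortlexEquiv_apply, shortlexPosition_zero]

lemma mono_zero (hd : 1 ≤ d) : mono d 0 = 1 := by
  have : Finsupp.equivFunOnFinite.symm (0 : Fin d → ℕ) = 0 := by ext; simp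
  rw [mono, nthIndex_zero hd, this]
  rfl

lemma unitMono_zero (hd : 1 ≤ d) : unitMono μ 0 = polyLp μ 1 := by
  have h := enorm_polyLp_sq μ (1 : MvPolynomial (Fin d) ℂ)
  have h1 : ∫⁻ ζ : USphere d, ‖polyFun 1 (ζ : Cn d)‖ₑ ^ 2 ∂μ = 1 := by simp [polyFun]
  rw [h1, ENNReal.ofReal_eq_one] at h
  have h2 : ‖polyLp μ (1 : MvPolynomial (Fin d) ℂ)‖ = 1 := by
    rwa [pow_eq_one_iff_of_nonneg (norm_nonneg _) two_ne_zero] at h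
  rw [unitMono, mono_zero hd, h2]
  simp

lemma eval_zero_mono (hd : 1 ≤ d) {n : ℕ} (hn : n ≠ 0) : MvPolynomial.eval 0 (mono d n) = 0 := by
  classical
  rw [MvPolynomial.eval_zero, mono, MvPolynomial.constantCoeff_monomial, if_neg]
  intro h
  have h1 : nthIndex d n = 0 := by
    have := congrArg Finsupp.equivFunOnFinite h
    rw [Equiv.apply_symm_apply] at this
    rw [this]; rfl
  rw [nthIndex_eq hd, Equiv.symm_apply_eq, shortlexEquiv_apply, shortlexPosition_zero] at h1
  exact hn h1

lemma exists_poly_of_mem_winSpan (hd : 1 ≤ d) {N : ℕ} {v : Lp ℂ 2 μ}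
    (hv : v ∈ winSpan (unitMono μ) 1 (N + 1)) :
    ∃ q : MvPolynomial (Fin d) ℂ, MvPolynomial.eval 0 q = 1 ∧ polyLp μ q = unitMono μ 0 - v := by
  suffices ∃ p : MvPolynomial (Fin d) ℂ, MvPolynomial.eval 0 p = 0 ∧ polyLp μ p = v by
    obtain ⟨p, hp0, hp⟩ := this
    exact ⟨1 - p, by simp only [map_sub, map_one, hp0, sub_zero], by
      rw [map_sub, hp, unitMono_zero hd]⟩
  induction hv using Submodule.span_induction with
  | mem x hx =>
    obtain ⟨n, hn, rfl⟩ := hx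
    refine ⟨((‖polyLp μ (mono d n)‖ : ℂ))⁻¹ • mono d n, ?_, by rw [map_smul]; rfl⟩
    rw [MvPolynomial.smul_eval, eval_zero_mono hd (Nat.one_le_iff_ne_zero.1 hn.1), mul_zero]
  | zero => exact ⟨0, by simp, by simp⟩
  | add x y _ _ hx hy =>
    obtain ⟨p, hp0, hp⟩ := hx
    obtain ⟨q, hq0, hq⟩ := hy
    exact ⟨p + q, by rw [map_add, hp0, hq0, add_zero], by rw [map_add, hp, hq]⟩
  | smul c x _ hx =>
    obtain ⟨p, hp0, hp⟩ := hx
    exact ⟨c • p, by rw [MvPolynomial.smul_eval, hp0, mul_zero], by rw [map_smul, hp]⟩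

/-- Together with `exists_poly_of_mem_winSpan` this identifies the polynomials with `q(0) = 1` with
the competitors in the distance problems. `N` bounds the shortlex positions of the monomials of `q`,
not its degree. -/
lemma exists_mem_winSpan (hd : 1 ≤ d) (hT : Function.Injective (polyLp μ))
    (q : MvPolynomial (Fin d) ℂ) :
    ∃ N, MvPolynomial.eval 0 q • unitMono μ 0 - polyLp μ q ∈ winSpan (unitMono μ) 1 (N + 1) := by
  classical
  induction q using MvPolynomial.induction_on' with
  | monomial u a =>
    set n := shortlexEquiv hd (Finsupp.equivFunOnFinite u) with hn
    have hmono : MvPolynomial.monomial u a = a • mono d n := by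
      rw [mono, nthIndex_eq hd, hn, Equiv.symm_apply_apply, Equiv.symm_apply_apply,
        MvPolynomial.smul_monomial, smul_eq_mul, mul_one]
    have hx : polyLp μ (mono d n) = (‖polyLp μ (mono d n)‖ : ℂ) • unitMono μ n := by
      rw [unitMono, smul_smul, mul_inv_cancel₀, one_smul]
      exact_mod_cast norm_ne_zero_iff.2 (polyLp_mono_ne_zero hd hT n)
    refine ⟨n, ?_⟩
    rw [hmono, map_smul (polyLp μ), MvPolynomial.smul_eval]
    rcases eq_or_ne n 0 with h0 | h0
    · rw [h0, mono_zero hd, map_one, mul_one, unitMono_zero hd, sub_self]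
      exact zero_mem _
    · rw [eval_zero_mono hd h0, mul_zero, zero_smul, zero_sub, hx]
      exact neg_mem (Submodule.smul_mem _ _ (Submodule.smul_mem _ _
        (mem_winSpan (Nat.one_le_iff_ne_zero.2 h0) n.lt_succ_self)))
  | add p q hp hq =>
    obtain ⟨N, hN⟩ := hp
    obtain ⟨M, hM⟩ := hq
    refine ⟨N + M, ?_⟩
    have e : MvPolynomial.eval 0 (p + q) • unitMono μ 0 - polyLp μ (p + q) =
        (MvPolynomial.eval 0 p • unitMono μ 0 - polyLp μ p) +
          (MvPolynomial.eval 0 q • unitMono μ 0 - polyLp μ q) := by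
      rw [map_add, map_add, add_smul]; abel
    rw [e]
    exact add_mem (winSpan_mono le_rfl (by omega) hN) (winSpan_mono le_rfl (by omega) hM)

/-- The product of the defects `1 - |γ_{0,α}|²` is the infimum of `∫ |q|² dμ` over the polynomials
with `q(0) = 1`. -/
theorem hasProd_verblunsky (hd : 1 ≤ d) (hμ : ∀ q : MvPolynomial (Fin d) ℂ,
    ∫⁻ ζ : USphere d, ‖polyFun q (ζ : Cn d)‖ₑ ^ 2 ∂μ = 0 → q = 0) {L : ℝ} (hL : 0 ≤ L)
    (hglb : IsGLB ((fun q => ∫⁻ ζ : USphere d, ‖polyFun q (ζ : Cn d)‖ₑ ^ 2 ∂μ) ''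
      {q : MvPolynomial (Fin d) ℂ | MvPolynomial.eval 0 q = 1}) (ENNReal.ofReal L)) :
    HasProd (fun α : Fin d → ℕ => 1 - ‖verblunsky μ 0 α‖ ^ 2) L := by
  have hT := polyLp_injective hμ
  set K := normalise fun n m => momentKernel μ (nthIndex d n) (nthIndex d m) with hKdef
  have hK : ∀ n m, K n m = inner ℂ (unitMono μ m) (unitMono μ n) := normalise_momentKernel μ
  have hl := linearIndependent_unitMono hd hT
  have hu := norm_unitMono hd hT
  have hv : ∀ α : Fin d → ℕ, verblunsky μ 0 α = schurParam K 0 (shortlexEquiv hd α) := fun α => by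
    rw [verblunsky, shortlexPosition_zero, shortlexEquiv_apply]
  have hmem := fun n => one_sub_norm_schurParam_sq_mem hl hu hK n
  set P : ℕ → ℝ := fun N => ∏ l ∈ Finset.range N, (1 - ‖schurParam K 0 (l + 1)‖ ^ 2) with hP
  have hleast := fun N => prod_one_sub_norm_schurParam_sq hl hu hK N
  have hanti : Antitone P := antitone_nat_of_succ_le fun N => by
    simp only [hP, Finset.prod_range_succ]
    exact mul_le_of_le_one_right (Finset.prod_nonneg fun i _ => (hmem _).1.le) (hmem _).2
  have hlow : ∀ N, L ≤ P N := by
    intro N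
    obtain ⟨v, hvm, hve⟩ := (hleast N).1
    obtain ⟨q, hq0, hq⟩ := exists_poly_of_mem_winSpan hd hvm
    have h1 := hglb.1 ⟨q, hq0, rfl⟩
    simp only [← enorm_polyLp_sq, hq] at h1
    have h2 := (ENNReal.ofReal_le_ofReal_iff (by positivity)).1 h1
    exact h2.trans_eq hve
  have hup : ∀ ε > 0, ∃ N, P N < L + ε := by
    intro ε hε
    have hlt : ENNReal.ofReal L < ENNReal.ofReal (L + ε) :=
      (ENNReal.ofReal_lt_ofReal_iff (by linarith)).2 (by linarith)
    obtain ⟨_, ⟨q, hq0, rfl⟩, -, hq⟩ := hglb.exists_between hlt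
    obtain ⟨N, hN⟩ := exists_mem_winSpan hd hT q
    rw [Set.mem_ofPred_eq] at hq0
    rw [hq0, one_smul] at hN
    simp only [← enorm_polyLp_sq] at hq
    refine ⟨N, ((hleast N).2 ⟨_, hN, rfl⟩).trans_lt ?_⟩
    simp only [sub_sub_cancel]
    exact (ENNReal.ofReal_lt_ofReal_iff (by linarith)).1 hq
  have hlim : Tendsto P atTop (𝓝 L) := by
    rw [Metric.tendsto_atTop]
    intro ε hε
    obtain ⟨N, hN⟩ := hup ε hε
    refine ⟨N, fun n hn => ?_⟩
    rw [Real.dist_eq, abs_lt]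
    constructor
    · linarith [hlow n]
    · linarith [hanti hn]
  simp only [hv]
  refine hasProd_of_antitone (shortlexEquiv hd) (fun α => (hmem _).1.le) (fun α => (hmem _).2) ?_
  simp only [Equiv.apply_symm_apply]
  -- `P` starts at position `1`; the factor at position `0` is `1` because `schurParam K 0 0 = 0`.
  rw [← tendsto_add_atTop_iff_nat 1]
  refine hlim.congr fun N => ?_
  rw [Finset.prod_range_succ', hP]
  have h0 : schurParam K 0 0 = 0 := rfl
  simp [h0]

end SzegoBall
end

noncomputable section
namespace SzegoBall

/-! ### The Szegő–Verblunsky theorem -/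

variable {d : ℕ}

/-- The density is positive almost everywhere, so `q` vanishes `sigma`-almost everywhere, and by
continuity on the whole sphere. -/
lemma eq_zero_of_lintegral_weighted_eq_zero (hd : 1 ≤ d) {ψ : USphere d → ℂ}
    (hψm : AEStronglyMeasurable ψ (sigma d)) (hψ0 : ∀ᵐ ζ : USphere d ∂sigma d, ψ ζ ≠ 0)
    {w : USphere d → ℝ} (hw : ∀ᵐ ζ : USphere d ∂sigma d, w ζ = ‖ψ ζ‖ ^ 2)
    {μs : Measure (USphere d)} {q : MvPolynomial (Fin d) ℂ}
    (hq : ∫⁻ ζ : USphere d, ‖polyFun q (ζ : Cn d)‖ₑ ^ 2 ∂weighted w μs = 0) : q = 0 := by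
  have : NeZero d := ⟨by omega⟩
  rw [weighted, lintegral_add_measure, add_eq_zero, lintegral_withDensity_polyFun hψm hw] at hq
  have hc : Continuous fun ζ : USphere d => polyFun q (ζ : Cn d) :=
    (continuous_polyFun q).comp continuous_subtype_val
  have h1 := (lintegral_eq_zero_iff' ((hc.measurable.enorm.pow_const 2).aemeasurable.mul
    (hψm.enorm.pow_const 2))).1 hq.1
  have h2 : (fun ζ : USphere d => polyFun q (ζ : Cn d)) =ᵐ[sigma d] fun _ => 0 := by
    filter_upwards [h1, hψ0] with ζ h3 h4
    simpa [h4] using h3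
  rw [hc.ae_eq_iff_eq _ continuous_const] at h2
  exact eq_zero_of_polyFun_eq_zero hd fun ζ => congrFun h2 ζ

lemma eventually_mem_unitBall (ζ : USphere d) : ∀ᶠ z in koranyiFilter (ζ : Cn d), z ∈ unitBall d :=
  eventually_koranyiFilter.2 fun _ ha =>
    eventually_nhdsWithin_of_forall fun _ hz => koranyiRegion_subset ha _ hz

theorem szego_of_hardy (hd : 1 ≤ d) {p : ℝ} (hp : 1 ≤ p) {g : Cn d → ℂ}
    (hg : DifferentiableOn ℂ g (unitBall d)) (hnorm : hardyNorm p g ≤ 1)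
    (h0 : ∀ z ∈ unitBall d, g z ≠ 0) (hinv : hInfNorm (fun z => (g z)⁻¹) < ∞)
    {w : USphere d → ℝ} (hw : w = boundaryFun (fun z => ‖g z‖ ^ p)) :
    (∀ᵐ ζ : USphere d ∂sigma d, HasKLimit (fun z => ‖g z‖ ^ p) (ζ : Cn d) (w ζ)) ∧
      ∀ μs : Measure (USphere d), IsDiscreteMeasure μs → IsProbabilityMeasure (weighted w μs) →
        Integrable (fun ζ => Real.log (w ζ)) (sigma d) ∧
        HasProd (fun α : Fin d → ℕ => 1 - ‖verblunsky (weighted w μs) 0 α‖ ^ 2)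
          (Real.exp (∫ ζ, Real.log (w ζ) ∂sigma d)) := by
  have : NeZero d := ⟨by omega⟩
  have hp0 : 0 < p := one_pos.trans_le hp
  obtain ⟨Λ₀, hΛ₀, hexp⟩ := exists_holomorphic_log (f := fun z => (g z)⁻¹)
    (hg.fun_inv h0) (fun z hz => inv_ne_zero (h0 z hz))
  -- The factor `p / 2` turns `|g|^p` into `|exp (-Λ)|²`; from here on `p` plays no role in the
  -- extremal problem.
  set Λ : Cn d → ℂ := fun z => (p / 2 : ℝ) * Λ₀ z with hΛdef
  have hΛ : DifferentiableOn ℂ Λ (unitBall d) := hΛ₀.const_mul _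
  have hgn : ∀ z ∈ unitBall d, ‖g z‖ = Real.exp (-(Λ₀ z).re) := by
    intro z hz
    rw [Real.exp_neg, ← Complex.norm_exp, hexp z hz, norm_inv, inv_inv]
  have hgp : ∀ z ∈ unitBall d, ‖g z‖ ^ p = ‖Complex.exp (-Λ z)‖ ^ 2 := by
    intro z hz
    rw [hgn z hz, Complex.norm_exp, ← Real.exp_mul, ← Real.exp_nat_mul]
    congr 1
    simp only [hΛdef, Complex.neg_re, Complex.re_ofReal_mul]
    push_cast
    ring
  have hgE : ∀ z ∈ unitBall d, ‖g z‖ₑ ^ p = ‖Complex.exp (-Λ z)‖ₑ ^ 2 := by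
    intro z hz
    rw [← ofReal_norm, ← ofReal_norm, ENNReal.ofReal_rpow_of_nonneg (norm_nonneg _) hp0.le,
      ← ENNReal.ofReal_pow (norm_nonneg _), hgp z hz]
  have hI : ∀ n, ∫⁻ ζ : USphere d, ‖Complex.exp (-Λ (rad n • (ζ : Cn d)))‖ₑ ^ 2 ∂sigma d ≤ 1 := by
    intro n
    have h1 : (∫⁻ ζ : USphere d, ‖g (rad n • (ζ : Cn d))‖ₑ ^ p ∂sigma d) ^ (1 / p) ≤ 1 :=
      (le_iSup₂ (f := fun r (_ : r ∈ Set.Ioo (0 : ℝ) 1) =>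
        (∫⁻ ζ : USphere d, ‖g (r • (ζ : Cn d))‖ₑ ^ p ∂sigma d) ^ (1 / p)) (rad n)
        (rad_mem n)).trans hnorm
    replace h1 := not_lt.1 fun h => h1.not_gt (ENNReal.one_lt_rpow h (by positivity))
    refine (lintegral_congr fun ζ => ?_).trans_le h1
    exact (hgE _ (rad_smul_mem n ζ)).symm
  have hC : ∀ z ∈ unitBall d,
      (Λ z).re ≤ p / 2 * (hInfNorm (fun z => (g z)⁻¹)).toReal := by
    intro z hz
    have h1 : ‖(g z)⁻¹‖ₑ ≤ hInfNorm (fun z => (g z)⁻¹) :=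
      le_iSup₂ (f := fun z (_ : z ∈ unitBall d) => ‖(g z)⁻¹‖ₑ) z hz
    have h2 : ‖(g z)⁻¹‖ ≤ (hInfNorm (fun z => (g z)⁻¹)).toReal := by
      rw [← ofReal_norm] at h1
      exact (ENNReal.ofReal_le_iff_le_toReal hinv.ne).1 h1
    rw [← hexp z hz, Complex.norm_exp] at h2
    have h3 : (Λ z).re = p / 2 * (Λ₀ z).re := Complex.re_ofReal_mul _ _
    rw [h3]
    -- Any upper bound for `Re Λ₀` will do, so `x ≤ exp x` replaces the logarithm of the bound of
    -- `1/g`.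
    have h4 := Real.add_one_le_exp (Λ₀ z).re
    gcongr
    linarith
  obtain ⟨ψ, hψ⟩ := ae_exists_kLimit_exp_neg hΛ hC hI
  have hlim : ∀ᵐ ζ : USphere d ∂sigma d,
      HasKLimit (fun z => ‖g z‖ ^ p) (ζ : Cn d) (‖ψ ζ‖ ^ 2) := by
    filter_upwards [hψ] with ζ h
    refine (h.1.norm.pow 2).congr' ?_
    filter_upwards [eventually_mem_unitBall ζ] with z hz
    exact (hgp z hz).symm
  have hwψ : ∀ᵐ ζ : USphere d ∂sigma d, w ζ = ‖ψ ζ‖ ^ 2 := by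
    filter_upwards [hlim] with ζ h
    rw [hw]
    exact Tendsto.limUnder_eq h
  refine ⟨?_, fun μs hμs hprob => ?_⟩
  · filter_upwards [hlim, hwψ] with ζ h1 h2
    rwa [h2]
  have hψr : ∀ᵐ ζ : USphere d ∂sigma d,
      Tendsto (fun n => Complex.exp (-Λ (rad n • (ζ : Cn d)))) atTop (𝓝 (ψ ζ)) :=
    hψ.mono fun ζ h => h.1.comp (tendsto_rad_smul ζ)
  have hψ0 : ∀ᵐ ζ : USphere d ∂sigma d, ψ ζ ≠ 0 := hψ.mono fun ζ h => h.2
  obtain ⟨hint, hval⟩ := integrable_log_boundary hΛ hC hI hψr hψ0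
  have hlog : (fun ζ => Real.log (‖ψ ζ‖ ^ 2)) =ᵐ[sigma d] fun ζ => Real.log (w ζ) := by
    filter_upwards [hwψ] with ζ h
    rw [h]
  refine ⟨hint.congr hlog, ?_⟩
  rw [← integral_congr_ae hlog, hval]
  exact hasProd_verblunsky hd
    (fun q => eq_zero_of_lintegral_weighted_eq_zero hd (aestronglyMeasurable_boundary hΛ hψr) hψ0 hwψ)
    (Real.exp_nonneg _) (isGLB_lintegral_polyFun hΛ hC hI hψr hψ0 hwψ hμs)

lemma hardyNorm_two_le (hd : 1 ≤ d) {g : Cn d → ℂ} (hg : hInfNorm g ≤ 1) : hardyNorm 2 g ≤ 1 := by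
  have : NeZero d := ⟨by omega⟩
  refine iSup₂_le fun r hr => ?_
  refine ENNReal.rpow_le_one ?_ (by norm_num)
  calc ∫⁻ ζ : USphere d, ‖g (r • (ζ : Cn d))‖ₑ ^ (2 : ℝ) ∂sigma d ≤ ∫⁻ _, 1 ∂sigma d := by
        refine lintegral_mono fun ζ => ?_
        refine ENNReal.rpow_le_one ?_ two_pos.le
        refine (le_iSup₂ (f := fun z (_ : z ∈ unitBall d) => ‖g z‖ₑ) (r • (ζ : Cn d)) ?_).trans hg
        rw [mem_ball_zero_iff, norm_smul, norm_eq_of_mem_sphere ζ, mul_one,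
          Real.norm_of_nonneg hr.1.le]
        exact hr.2
    _ = 1 := by simp

end SzegoBall
end

theorem mainTheorem10 (d : ℕ) (hd : 1 ≤ d) :
    (∀ g : Cn d → ℂ, MemHInf g → hInfNorm g ≤ 1 →
      (∀ z ∈ unitBall d, g z ≠ 0) → MemHInf (fun z => (g z)⁻¹) →
      ∀ w : USphere d → ℝ, w = boundaryFun (fun z => ‖g z‖ ^ 2) →
        (∀ᵐ ζ : USphere d ∂sigma d, HasKLimit (fun z => ‖g z‖ ^ 2) (ζ : Cn d) (w ζ)) ∧
        ∀ μs : Measure (USphere d), IsDiscreteMeasure μs → IsProbabilityMeasure (weighted w μs) →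
          Integrable (fun ζ => Real.log (w ζ)) (sigma d) ∧
          HasProd (fun α : Fin d → ℕ => 1 - ‖verblunsky (weighted w μs) 0 α‖ ^ 2)
            (Real.exp (∫ ζ, Real.log (w ζ) ∂sigma d))) ∧
    (∀ p : ℝ, 1 ≤ p →
      ∀ g : Cn d → ℂ, MemHardy p g → hardyNorm p g ≤ 1 →
      (∀ z ∈ unitBall d, g z ≠ 0) → MemHInf (fun z => (g z)⁻¹) →
      ∀ w : USphere d → ℝ, w = boundaryFun (fun z => ‖g z‖ ^ p) →
        (∀ᵐ ζ : USphere d ∂sigma d, HasKLimit (fun z => ‖g z‖ ^ p) (ζ : Cn d) (w ζ)) ∧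
        ∀ μs : Measure (USphere d), IsDiscreteMeasure μs → IsProbabilityMeasure (weighted w μs) →
          Integrable (fun ζ => Real.log (w ζ)) (sigma d) ∧
          HasProd (fun α : Fin d → ℕ => 1 - ‖verblunsky (weighted w μs) 0 α‖ ^ 2)
            (Real.exp (∫ ζ, Real.log (w ζ) ∂sigma d))) := by
  refine ⟨fun g hg hn h0 hinv w hw => ?_, fun p hp g hg hn h0 hinv w hw =>
    szego_of_hardy hd hp hg.1 hn h0 hinv.2 hw⟩
  -- Since `sigma` has mass `1`, the supremum norm dominates the Hardy norm with exponent `2`. Only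
  -- the real exponent has to be rewritten as a natural one.
  have h := szego_of_hardy hd one_le_two hg.1 (hardyNorm_two_le hd hn) h0 hinv.2
    (w := w) (by simpa only [Real.rpow_two] using hw)
  simpa only [Real.rpow_two] using h
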